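/- **Setting.** Let $d,n,K\ge 1$ be integers with $d\mid n$. Consider a uniform Cartesian grid in $\mathbb R^d$ with $2^{n/d}$ points and spacing $h_\mu>0$ along each coordinate $\mu=0,\dots,d-1$; the grid points $x^{[j]}$ label the basis states of $n$ qubits. Let $\varrho,\zeta,\kappa,\gamma$ be real functions with $\varrho>0$, $\kappa,\gamma\ge 0$ on the grid, the coefficients of $\varrho\,\partial_t^2u+\zeta\,\partial_tu-\nabla\cdot\kappa\nabla u+\gamma u=0$. Write $C_f=\sum_j f(x^{[j]})|j\rangle\langle j|$. Let $D_\mu^{+}$, $D_\mu^{-}$ be the forward and backward differences with spacing $h_\mu$ along coordinate $\mu$, including boundary terms: each is the difference operator with zero exterior values plus $h_\mu^{-1}$ times a $2\times2$ matrix of spectral norm at most $1$ acting on the first and last grid point along coordinate $\mu$ (this covers Dirichlet, Neumann and periodic conditions). Put $$A=|0\rangle\langle 0|\otimes C_\varrho^{-1}C_\zeta-\sum_{\mu}|0\rangle\langle\mu+1|\otimes C_\varrho^{-1/2}D_\mu^{+}C_\kappa^{1/2}+|0\rangle\langle d+1|\otimes C_\varrho^{-1/2}C_\gamma^{1/2}-\sum_\mu|\mu+1\rangle\langle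 0|\otimes C_\kappa^{1/2}D_\mu^{-}C_\varrho^{-1/2}-|d+1\rangle\langle 0|\otimes C_\varrho^{-1/2}C_\gamma^{1/2},$$ acting on $\lceil\log_2(d+2)\rceil+n$ qubits (zero on unused labels). A unitary $U$ with $a$ ancilla qubits is an $(\alpha,a,\epsilon)$-block-encoding of $M$ if $\|M-\alpha\,(\langle 0^a|\otimes I)U(|0^a\rangle\otimes I)\|\le\epsilon$ in the spectral norm. For each $f\in\{\varrho^{-1/2},\kappa^{1/2},\zeta,\gamma^{1/2}\}$ let $\sum_{|k_\mu|\le K}c^f_k\,e^{2\pi i\sum_\mu k_\mu x_\mu/L_\mu}$ (with periods $L_\mu>0$) be a Fourier series that approximates $f$ within $\epsilon_f$ at all grid points, and let $\alpha_f>0$ satisfy $\alpha_f\ge\sum_k|c^f_k|$ and $\alpha_f\ge|f|$ on the grid. Let $\alpha_D\ge 3/h_\mu$ for all $\mu$. **Theorem.** There are absolute constants $C$ and $a_D$ such that in every such situation the following hold. 1. There are $(\alpha_f,\,d\lceil\log_2(2K+1)\rceil,\,\epsilon_f)$-block-encodings $U_f$ of $C_f$ of LCU-Fourier form $U_f=(P_L^\dagger\otimes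 I)\cdot\mathrm{SELECT}\cdot(P_R\otimes I)$, where $\mathrm{SELECT}$ applies the Fourier mode labelled by the ancilla register and $P_L,P_R$ are unitaries on the ancilla register with $\alpha_f\,\overline{\langle k|P_L|0\rangle}\,\langle k|P_R|0\rangle=c^f_k$ (and $=0$ on unused labels), and $(\alpha_D,a_D,0)$-block-encodings $U_{D_\mu^\pm}$ of $D_\mu^\pm$. 2. There is a circuit $Q$ of two-qubit gates and the following controlled oracle uses: $2d+2$ of $U_{\varrho^{-1/2}}$, $1$ of $U_{\varrho^{-1/2}}^\dagger$, $2d$ of $U_{\kappa^{1/2}}$, $1$ of $U_\zeta$, $1$ of $U_{\gamma^{1/2}}$, and $1$ of each $U_{D_\mu^+}$ and each $U_{D_\mu^-}$. With clean work qubits (starting and ending in $|0\rangle$), $Q$ implements an $(\alpha,a,\epsilon)$-block-encoding of $A$ with $$\alpha=(d+2)\max\bigl(\alpha_{\varrho^{-1/2}}^2\alpha_\zeta,\ \alpha_{\kappa^{1/2}}\alpha_D\alpha_{\varrho^{-1/2}},\ \alpha_{\varrho^{-1/2}}\alpha_{\gamma^{1/2}}\bigr),\qquad a=2d\lceil\log_2(2K+1)\rceil+a_D+1+\lceil\log_2(d+2)\rceil,$$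 $$\begin{aligned}\epsilon=(d+2)\max\bigl(&\alpha_D\alpha_{\kappa^{1/2}}\epsilon_{\varrho^{-1/2}}+\alpha_{\varrho^{-1/2}}\alpha_D\epsilon_{\kappa^{1/2}},\ \ \alpha_{\varrho^{-1/2}}\epsilon_{\gamma^{1/2}}+\alpha_{\gamma^{1/2}}\epsilon_{\varrho^{-1/2}},\\&\alpha_{\varrho^{-1/2}}^2\epsilon_\zeta+\alpha_\zeta\min(2\alpha_{\varrho^{-1/2}}\epsilon_{\varrho^{-1/2}},\alpha_{\varrho^{-1/2}}^2)\bigr).\end{aligned}$$ 3. Every controlled oracle can be implemented by a circuit of two-qubit gates with clean work qubits such that, after substituting these circuits for the oracle uses, $Q$ becomes a circuit with the same action (on clean work qubits) that consists of at most $$C\,\bigl(4^d\,dK^d+dn\log K+n^2\bigr)$$ two-qubit gates and uses at most $C(n+d\log K)$ work qubits. Thus it uses $\mathcal O(dK^d+dn\log K+n^2)$ two-qubit gates, where the implied constant depends on $d$ only, and only through the factor $4^d$ of the first term. -/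

import Mathlib

/-! ## Qubits, gates and circuits -/

/-- Computational basis states of a register whose qubits are indexed by `ι`. -/
abbrev Bits (ι : Type) : Type := ι → Bool

/-- The number written in binary (least significant bit first) in an `m`-qubit register. -/
def bitsVal {m : ℕ} (x : Bits (Fin m)) : ℕ := ∑ i : Fin m, if x i then 2 ^ (i : ℕ) else 0

/-- An operator on the qubits `κ`, acting on the qubits `e k` of a larger register `ι`
and as the identity on all other qubits. -/
def embedOp {κ ι : Type} [Fintype κ] [Fintype ι] [DecidableEq ι] (e : κ ↪ ι)
    (M : Matrix (Bits κ) (Bits κ) ℂ) : Matrix (Bits ι) (Bits ι) ℂ :=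
  fun x y => if ∀ i : ι, (∀ k : κ, e k ≠ i) → x i = y i then M (x ∘ e) (y ∘ e) else 0

/-- The controlled version of `M`; the control qubit is `none`. -/
def controlled {κ : Type} [Fintype κ] [DecidableEq κ]
    (M : Matrix (Bits κ) (Bits κ) ℂ) : Matrix (Bits (Option κ)) (Bits (Option κ)) ℂ :=
  fun x y =>
    if x none = y none then
      (if x none then M (x ∘ some) (y ∘ some)
        else (1 : Matrix (Bits κ) (Bits κ) ℂ) (x ∘ some) (y ∘ some))
    else 0

/-- A two-qubit gate: an arbitrary `4 × 4` unitary on an ordered pair of distinct qubits. -/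
structure TwoQubitGate (ι : Type) where
  wires : Fin 2 ↪ ι
  mat : Matrix (Bits (Fin 2)) (Bits (Fin 2)) ℂ
  unitary : mat ∈ Matrix.unitaryGroup (Bits (Fin 2)) ℂ

/-- The operator of a two-qubit gate on the whole register. -/
def TwoQubitGate.op {ι : Type} [Fintype ι] [DecidableEq ι] (g : TwoQubitGate ι) :
    Matrix (Bits ι) (Bits ι) ℂ :=
  embedOp g.wires g.mat

/-- Relabelling of the qubits of a gate. -/
def TwoQubitGate.map {κ ι : Type} (f : κ ↪ ι) (g : TwoQubitGate κ) : TwoQubitGate ι where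
  wires := g.wires.trans f
  mat := g.mat
  unitary := g.unitary

/-- A circuit: a list of two-qubit gates, applied from left to right. Its two-qubit gate count is
the length of the list. -/
abbrev Circuit (ι : Type) : Type := List (TwoQubitGate ι)

/-- The unitary of a circuit. -/
def Circuit.op {ι : Type} [Fintype ι] [DecidableEq ι] (P : Circuit ι) :
    Matrix (Bits ι) (Bits ι) ℂ :=
  P.foldr (fun g M => M * g.op) 1

/-- The block of `U` in which the qubits `τ` go from `|0…0⟩` to `|0…0⟩`. -/
def zeroBlock {σ τ : Type} (U : Matrix (Bits (σ ⊕ τ)) (Bits (σ ⊕ τ)) ℂ) :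
    Matrix (Bits σ) (Bits σ) ℂ :=
  fun x y => U (Sum.elim x fun _ => false) (Sum.elim y fun _ => false)

/-- `U` implements `W` with clean work qubits `ω`: `U (|y⟩ ⊗ |0…0⟩) = (W |y⟩) ⊗ |0…0⟩`. -/
def Implements {κ ω : Type} (U : Matrix (Bits (κ ⊕ ω)) (Bits (κ ⊕ ω)) ℂ)
    (W : Matrix (Bits κ) (Bits κ) ℂ) : Prop :=
  ∀ (x : Bits κ) (z : Bits ω) (y : Bits κ),
    ((∀ i, z i = false) → U (Sum.elim x z) (Sum.elim y fun _ => false) = W x y) ∧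
    ((∃ i, z i = true) → U (Sum.elim x z) (Sum.elim y fun _ => false) = 0)

/-- Spectral (operator) norm of a matrix. -/
noncomputable def specNorm {m : Type} [Fintype m] [DecidableEq m] (M : Matrix m m ℂ) : ℝ :=
  ‖Matrix.toEuclideanCLM (n := m) (𝕜 := ℂ) M‖

/-- `U` is an `(α, a, ε)`-block-encoding of `A`, the `a` ancilla qubits being those in `τ`. -/
def IsBlockEncoding {σ τ : Type} [Fintype σ] [DecidableEq σ] [Fintype τ] [DecidableEq τ]
    (α ε : ℝ) (U : Matrix (Bits (σ ⊕ τ)) (Bits (σ ⊕ τ)) ℂ) (A : Matrix (Bits σ) (Bits σ) ℂ) :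
    Prop :=
  U ∈ Matrix.unitaryGroup (Bits (σ ⊕ τ)) ℂ ∧ specNorm (A - (α : ℂ) • zeroBlock U) ≤ ε

/-! ## The discretized differential operator -/

/-- The `n` system qubits: `n / d` qubits for each of the `d` coordinates, least significant
bit first. -/
abbrev Sys (d n : ℕ) : Type := Fin d × Fin (n / d)

/-- The `μ`-th grid index of the grid point labelled by a basis state. -/
def axisIndex {d n : ℕ} (s : Bits (Sys d n)) (μ : Fin d) : ℕ := bitsVal fun i => s (μ, i)

/-- A uniform Cartesian grid in `ℝ^d`, and the periods of the Fourier modes used on it. -/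
structure Grid (d : ℕ) where
  origin : Fin d → ℝ
  spacing : Fin d → ℝ
  period : Fin d → ℝ
  spacing_pos : ∀ μ, 0 < spacing μ
  period_pos : ∀ μ, 0 < period μ

/-- The grid point labelled by a computational basis state. -/
def Grid.point {d n : ℕ} (G : Grid d) (s : Bits (Sys d n)) : Fin d → ℝ :=
  fun μ => G.origin μ + G.spacing μ * (axisIndex s μ : ℝ)

/-- The coefficient fields of `ϱ ∂ₜ²u + ζ ∂ₜu - ∇·κ∇u + γ u = 0`. -/
structure PDECoefficients (d : ℕ) where
  rho : (Fin d → ℝ) → ℝ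
  zeta : (Fin d → ℝ) → ℝ
  kappa : (Fin d → ℝ) → ℝ
  gamma : (Fin d → ℝ) → ℝ

/-- The four functions whose diagonal operators are block-encoded. -/
inductive Coeff : Type
  | invSqrtRho
  | sqrtKappa
  | zeta
  | sqrtGamma

/-- The functions `ϱ^(-1/2)`, `κ^(1/2)`, `ζ`, `γ^(1/2)`. -/
noncomputable def PDECoefficients.field {d : ℕ} (p : PDECoefficients d) :
    Coeff → (Fin d → ℝ) → ℝ
  | .invSqrtRho => fun x => (Real.sqrt (p.rho x))⁻¹
  | .sqrtKappa => fun x => Real.sqrt (p.kappa x)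
  | .zeta => p.zeta
  | .sqrtGamma => fun x => Real.sqrt (p.gamma x)

/-- The diagonal operator `C_f = ∑ⱼ f(x^[j]) |j⟩⟨j|`. -/
def diagOp {d n : ℕ} (G : Grid d) (f : (Fin d → ℝ) → ℝ) :
    Matrix (Bits (Sys d n)) (Bits (Sys d n)) ℂ :=
  Matrix.diagonal fun s => (f (G.point s) : ℂ)

/-- The boundary part of a one-dimensional difference stencil on `N` points: a `2 × 2` matrix `B`
acting on the first (`false`) and the last (`true`) grid point. -/
def cornerEntry (N : ℕ) (B : Matrix Bool Bool ℂ) (i j : ℕ) : ℂ :=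
  if (i = 0 ∨ i + 1 = N) ∧ (j = 0 ∨ j + 1 = N) then B (decide (i ≠ 0)) (decide (j ≠ 0)) else 0

/-- One-dimensional forward difference `v ↦ (v_{i+1} - v_i) / h` on `N` points (with `v_N = 0`),
with boundary part `B / h`. -/
noncomputable def forwardEntry (N : ℕ) (h : ℝ) (B : Matrix Bool Bool ℂ) (i j : ℕ) : ℂ :=
  ((if j = i + 1 then 1 else 0) - (if j = i then 1 else 0) + cornerEntry N B i j) / (h : ℂ)

/-- One-dimensional backward difference `v ↦ (v_i - v_{i-1}) / h` on `N` points (with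
`v_{-1} = 0`), with boundary part `B / h`. -/
noncomputable def backwardEntry (N : ℕ) (h : ℝ) (B : Matrix Bool Bool ℂ) (i j : ℕ) : ℂ :=
  ((if j = i then 1 else 0) - (if i = j + 1 then 1 else 0) + cornerEntry N B i j) / (h : ℂ)

/-- A one-dimensional operator (given by its entries) acting along the `μ`-th coordinate. -/
def axisOp {d n : ℕ} (μ : Fin d) (E : ℕ → ℕ → ℂ) :
    Matrix (Bits (Sys d n)) (Bits (Sys d n)) ℂ :=
  fun s t => if ∀ ν i, ν ≠ μ → s (ν, i) = t (ν, i) then E (axisIndex s μ) (axisIndex t μ) else 0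

/-- The difference operators `D_μ^{+'}` (`fwd = true`) and `D_μ^{-'}` (`fwd = false`), including
the boundary terms; `B fwd μ` is the boundary part. -/
noncomputable def diffOp {d n : ℕ} (G : Grid d) (B : Bool → Fin d → Matrix Bool Bool ℂ) (fwd : Bool)
    (μ : Fin d) : Matrix (Bits (Sys d n)) (Bits (Sys d n)) ℂ :=
  axisOp μ (if fwd then forwardEntry (2 ^ (n / d)) (G.spacing μ) (B true μ)
    else backwardEntry (2 ^ (n / d)) (G.spacing μ) (B false μ))

/-- The selector register, with `⌈log₂ (d + 2)⌉` qubits, labelling the blocks `0, …, d + 1`. -/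
abbrev Sel (d : ℕ) : Type := Fin (Nat.clog 2 (d + 2))

/-- `|i⟩⟨j| ⊗ M`. -/
def selBlock {d n : ℕ} (i j : ℕ) (M : Matrix (Bits (Sys d n)) (Bits (Sys d n)) ℂ) :
    Matrix (Bits (Sel d ⊕ Sys d n)) (Bits (Sel d ⊕ Sys d n)) ℂ :=
  fun x y => if bitsVal (x ∘ Sum.inl) = i ∧ bitsVal (y ∘ Sum.inl) = j
    then M (x ∘ Sum.inr) (y ∘ Sum.inr) else 0

/-- The operator `A` of the second-order equation. -/
noncomputable def secondOrderOp {d n : ℕ} (G : Grid d) (p : PDECoefficients d)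
    (B : Bool → Fin d → Matrix Bool Bool ℂ) :
    Matrix (Bits (Sel d ⊕ Sys d n)) (Bits (Sel d ⊕ Sys d n)) ℂ :=
  selBlock 0 0 (diagOp G (fun x => (p.rho x)⁻¹) * diagOp G p.zeta)
  - ∑ μ : Fin d, selBlock 0 (μ + 1)
      (diagOp G (p.field .invSqrtRho) * diffOp G B true μ * diagOp G (p.field .sqrtKappa))
  + selBlock 0 (d + 1) (diagOp G (p.field .invSqrtRho) * diagOp G (p.field .sqrtGamma))
  - ∑ μ : Fin d, selBlock (μ + 1) 0
      (diagOp G (p.field .sqrtKappa) * diffOp G B false μ * diagOp G (p.field .invSqrtRho))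
  - selBlock (d + 1) 0 (diagOp G (p.field .invSqrtRho) * diagOp G (p.field .sqrtGamma))

/-! ## Fourier series and the LCU Fourier method -/

/-- The Fourier mode `exp(2πi ∑_μ k_μ x_μ / L_μ)`. -/
noncomputable def fourierMode {d : ℕ} (G : Grid d) (k : Fin d → ℤ) (x : Fin d → ℝ) : ℂ :=
  Complex.exp (2 * Real.pi * Complex.I * ((∑ μ, (k μ : ℝ) * x μ / G.period μ : ℝ) : ℂ))

/-- Multi-indices of a Fourier series of maximum degree `K`. -/
noncomputable def degreeBox (d K : ℕ) : Finset (Fin d → ℤ) :=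
  Fintype.piFinset fun _ => Finset.Icc (-(K : ℤ)) (K : ℤ)

/-- The Fourier series with coefficients `c` and maximum degree `K`. -/
noncomputable def fourierSeries {d : ℕ} (G : Grid d) (K : ℕ) (c : (Fin d → ℤ) → ℂ)
    (x : Fin d → ℝ) : ℂ :=
  ∑ k ∈ degreeBox d K, c k * fourierMode G k x

/-- The ancilla qubits of the LCU Fourier method: `⌈log₂ (2K + 1)⌉` qubits per coordinate. -/
abbrev FourierAnc (d K : ℕ) : Type := Fin d × Fin (Nat.clog 2 (2 * K + 1))

/-- The number in the ancilla register of the `μ`-th coordinate. -/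
def freqIndex {d K : ℕ} (r : Bits (FourierAnc d K)) (μ : Fin d) : ℕ := bitsVal fun i => r (μ, i)

/-- The ancilla state `|r⟩` labels the multi-index with entries `r_μ - K`. -/
def freq {d K : ℕ} (r : Bits (FourierAnc d K)) : Fin d → ℤ :=
  fun μ => (freqIndex r μ : ℤ) - (K : ℤ)

/-- The SELECT operation `∑_r |r⟩⟨r| ⊗ ∑_j e^{2πi ∑ k_μ(r) x_μ^[j] / L_μ} |j⟩⟨j|`. -/
noncomputable def fourierSelect {d n K : ℕ} (G : Grid d) :
    Matrix (Bits (Sys d n ⊕ FourierAnc d K)) (Bits (Sys d n ⊕ FourierAnc d K)) ℂ :=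
  Matrix.diagonal fun x => fourierMode G (freq (x ∘ Sum.inr)) (G.point (x ∘ Sum.inl))

/-- `U` is obtained by the LCU Fourier method from the coefficients `c`, with normalization `α`:
`U = (P_L† ⊗ I) · SELECT · (P_R ⊗ I)`, where `P_L`, `P_R` is a state-preparation pair for
`c / α` (unused labels carry zero amplitude). -/
def IsLCUFourier {d n K : ℕ} (G : Grid d) (α : ℝ) (c : (Fin d → ℤ) → ℂ)
    (U : Matrix (Bits (Sys d n ⊕ FourierAnc d K)) (Bits (Sys d n ⊕ FourierAnc d K)) ℂ) : Prop :=
  ∃ PL ∈ Matrix.unitaryGroup (Bits (FourierAnc d K)) ℂ,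
  ∃ PR ∈ Matrix.unitaryGroup (Bits (FourierAnc d K)) ℂ,
    (∀ r : Bits (FourierAnc d K),
      (α : ℂ) * (star (PL r fun _ => false) * PR r fun _ => false) =
        if ∀ μ, freqIndex r μ ≤ 2 * K then c (freq r) else 0) ∧
    U = embedOp Function.Embedding.inr PL.conjTranspose * fourierSelect G *
      embedOp Function.Embedding.inr PR

/-! ## Circuits with oracle calls -/

/-- The oracles for coefficients: `U_f` for each of the four functions, and the inverse of the one
for `ϱ^(-1/2)`. -/
inductive CoeffCall : Type
  | direct (g : Coeff)
  | adjInvSqrtRho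

/-- An instruction on the qubits `ι`: a two-qubit gate, or a controlled use of an oracle for a
coefficient (acting on qubits `κ`) or for a difference operator `D_μ^{±'}` (acting on
qubits `δ`). -/
inductive Instr (d : ℕ) (κ δ ι : Type) : Type
  | gate (g : TwoQubitGate ι)
  | coeff (q : CoeffCall) (e : Option κ ↪ ι)
  | diff (fwd : Bool) (μ : Fin d) (e : Option δ ↪ ι)

/-- A circuit with controlled oracle calls, applied from left to right. -/
abbrev QueryCircuit (d : ℕ) (κ δ ι : Type) : Type := List (Instr d κ δ ι)

/-- The unitaries behind the coefficient oracles. -/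
def coeffCallOp {κ : Type} (U : Coeff → Matrix (Bits κ) (Bits κ) ℂ) :
    CoeffCall → Matrix (Bits κ) (Bits κ) ℂ
  | .direct g => U g
  | .adjInvSqrtRho => (U .invSqrtRho).conjTranspose

section
variable {d : ℕ} {κ δ ι : Type} [Fintype κ] [DecidableEq κ] [Fintype δ] [DecidableEq δ]
  [Fintype ι] [DecidableEq ι]

/-- The operator of an instruction for given oracles. -/
def Instr.op (U : Coeff → Matrix (Bits κ) (Bits κ) ℂ)
    (V : Bool → Fin d → Matrix (Bits δ) (Bits δ) ℂ) :
    Instr d κ δ ι → Matrix (Bits ι) (Bits ι) ℂ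
  | .gate g => g.op
  | .coeff q e => embedOp e (controlled (coeffCallOp U q))
  | .diff fwd μ e => embedOp e (controlled (V fwd μ))

/-- The unitary of a circuit with oracle calls. -/
def QueryCircuit.op (U : Coeff → Matrix (Bits κ) (Bits κ) ℂ)
    (V : Bool → Fin d → Matrix (Bits δ) (Bits δ) ℂ) (Q : QueryCircuit d κ δ ι) :
    Matrix (Bits ι) (Bits ι) ℂ :=
  Q.foldr (fun g M => M * g.op U V) 1

end

section
variable {d : ℕ} {κ δ ι ω : Type}

/-- Replace an oracle call by a given circuit for it, which may use further work qubits `ω`. -/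
def Instr.expand (FU : CoeffCall → Circuit (Option κ ⊕ ω))
    (FV : Bool → Fin d → Circuit (Option δ ⊕ ω)) :
    Instr d κ δ ι → Circuit (ι ⊕ ω)
  | .gate g => [g.map Function.Embedding.inl]
  | .coeff q e => (FU q).map fun g => g.map (e.sumMap (Function.Embedding.refl ω))
  | .diff fwd μ e => (FV fwd μ).map fun g => g.map (e.sumMap (Function.Embedding.refl ω))

/-- Replace all oracle calls by circuits; the result consists of two-qubit gates only. -/
def QueryCircuit.expand (FU : CoeffCall → Circuit (Option κ ⊕ ω))
    (FV : Bool → Fin d → Circuit (Option δ ⊕ ω)) (Q : QueryCircuit d κ δ ι) :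
    Circuit (ι ⊕ ω) :=
  Q.flatMap fun g => g.expand FU FV

open Classical in
/-- The number of uses of a coefficient oracle. -/
noncomputable def QueryCircuit.coeffUses (Q : QueryCircuit d κ δ ι) (q : CoeffCall) : ℕ :=
  Q.countP fun g => decide (∃ e, g = Instr.coeff q e)

open Classical in
/-- The number of uses of the oracle for `D_μ^{+'}` (`fwd = true`) or `D_μ^{-'}`. -/
noncomputable def QueryCircuit.diffUses (Q : QueryCircuit d κ δ ι) (fwd : Bool) (μ : Fin d) : ℕ :=
  Q.countP fun g => decide (∃ e, g = Instr.diff fwd μ e)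

end

/-! ## Parameters of the block-encoding -/

/-- The normalization
`(d+2) max(α_{1/√ϱ}² α_ζ, α_{√κ} α_D α_{1/√ϱ}, α_{1/√ϱ} α_{√γ})`. -/
def totalAlpha (d : ℕ) (α : Coeff → ℝ) (αD : ℝ) : ℝ :=
  (d + 2) * max (α .invSqrtRho ^ 2 * α .zeta)
    (max (α .sqrtKappa * αD * α .invSqrtRho) (α .invSqrtRho * α .sqrtGamma))

/-- The error bound. Here `min (2 α ε) (α ^ 2)`, with `α`, `ε` those of `ϱ^(-1/2)`, is the error of
squaring; it is at most `8 α^(3/2) √ε`. -/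
def totalEps (d : ℕ) (α ε : Coeff → ℝ) (αD : ℝ) : ℝ :=
  (d + 2) * max (αD * α .sqrtKappa * ε .invSqrtRho + α .invSqrtRho * αD * ε .sqrtKappa)
    (max (α .invSqrtRho * ε .sqrtGamma + α .sqrtGamma * ε .invSqrtRho)
      (α .invSqrtRho ^ 2 * ε .zeta +
        α .zeta * min (2 * α .invSqrtRho * ε .invSqrtRho) (α .invSqrtRho ^ 2)))

/-- The number of ancilla qubits: `a_{1/√ϱ} + max(a_{√κ}, a_ζ, a_{√γ}) + a_D + 1` with all four
coefficient block-encodings using `d ⌈log₂ (2K+1)⌉` ancillas, plus the `⌈log₂ (d+2)⌉` ancillas of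
the outer linear combination. -/
def totalAncillas (d K aD : ℕ) : ℕ :=
  2 * (d * Nat.clog 2 (2 * K + 1)) + aD + 1 + Nat.clog 2 (d + 2)

/-! The operator A is an arrow matrix: its only blocks lie in row 0 or column 0 of the selector.
Each block is a product of diagonal coefficient operators and difference operators. So A is
block-encoded by a linear combination of unitaries (LCU) whose terms, the branches, are products of
block-encodings.

Coefficients. The LCU of Fourier modes needs a state-preparation pair on d⌈log₂(2K+1)⌉ qubits. Any
state on m qubits costs O(2^m) gates by uniformly controlled rotations (`exists_prep`), and
2^⌈log₂(2K+1)⌉ ≤ 4K gives the factor 4^d K^d. Since 2K+1 is never a power of two, an unused label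
always exists, and it absorbs the slack between α_f and the sum of the |c_k| (`exists_prep_pair`).
SELECT is cheap: its phase is a product of two numbers that are affine in their binary digits, so it
is a product of phases in one frequency digit and one position digit (`fourierSelect_eq_phaseOp`).

Differences. Each D_μ^± is 1/h times a signed sum of a truncated shift, the identity and a corner
matrix, which is an LCU with three weights of modulus at most 1/3. The truncated shift is a
decrement with an overflow qubit, which leaves |0⟩ exactly on wrap-around (`mcOp_decGates_apply`).
The corner contraction is written UΣV†. CNOTs bring the first and the last grid point to one qubit,
where U and V† act, and a flag qubit keeps amplitude σ in |0⟩ (`mcOp_cornerGates_apply`). Gates with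
many controls are expanded by a ladder of clean work qubits (`exists_ladder`), so one oracle costs
O((n/d)²), and the 2d of them O(n²).

Outer combination. A label l, uniform over d+2 values, is XOR-ed onto the selector. For l ≠ 0 the
same label takes column 0 to row l and column l to row 0, so one label serves a transposed pair of
blocks, and label and selector value together determine the branch (`Branch.cond_unique`). An
amplitude qubit is rotated by the arccosine of the branch's signed normalization divided by the
maximum M of the three normalizations; it also removes the pairs (label, selector) that have no
branch. Hence the normalization (d+2)M (`select_apply`, `zeroBlock_lcuOp`). Every branch runs
conditionally: its condition is computed into a work qubit that controls its oracle calls, and is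
then uncomputed (`implements_condOp`).

Within a branch the factors use disjoint ancillas, so their zero blocks multiply
(`zeroBlock_onAnc_mul_of_fixes`). The exception is the damping term, which calls U and U† for
ϱ^(-1/2) on the same ancillas; between the calls a flag qubit records a nonzero ancilla, and that
suppresses the cross terms (`zeroBlock_adjoint_flagNonzero`).

Error. The difference operators are exact, so each block is perturbed only through its coefficients.
A pair of blocks at (0,l) and (l,0) has the norm of the larger one, so A consists of d+2 pieces
(`specNorm_arrow_le`), and the error is at most d+2 times the largest block error
(`specNorm_secondOrderOp_sub_le`). The gate count is arithmetic (`gate_count_le`). -/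

set_option linter.unusedSectionVars false

/-! ## Operators on registers -/

/-- Operators on the register `ι`. -/
abbrev Op (ι : Type) : Type := Matrix (Bits ι) (Bits ι) ℂ

section Embed
variable {κ ι η : Type} [Fintype κ] [DecidableEq κ] [Fintype ι] [DecidableEq ι] [Fintype η]
  [DecidableEq η]

theorem extend_comp_self (e : κ ↪ ι) (r : Bits κ) (x : Bits ι) :
    Function.extend e r x ∘ e = r :=
  funext fun k => e.injective.extend_apply r x k

theorem extend_of_agree {e : κ ↪ ι} {x y : Bits ι}
    (h : ∀ i : ι, (∀ k : κ, e k ≠ i) → x i = y i) : Function.extend e (x ∘ e) y = x := by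
  funext i
  by_cases hi : ∃ k, e k = i
  · obtain ⟨k, rfl⟩ := hi
    exact e.injective.extend_apply _ _ k
  · rw [Function.extend_apply' _ _ _ hi]
    exact (h i fun k hk => hi ⟨k, hk⟩).symm

theorem extend_self (e : κ ↪ ι) (x : Bits ι) : Function.extend e (x ∘ e) x = x :=
  extend_of_agree fun _ _ => rfl

theorem extend_off (e : κ ↪ ι) (r : Bits κ) (x : Bits ι) {i : ι} (hi : ∀ k, e k ≠ i) :
    Function.extend e r x i = x i :=
  Function.extend_apply' _ _ _ fun ⟨k, hk⟩ => hi k hk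

theorem extend_injective (e : κ ↪ ι) (x : Bits ι) :
    Function.Injective fun r : Bits κ => Function.extend e r x := fun r s h => by
  have := congrArg (fun f => f ∘ e) h
  simpa only [extend_comp_self] using this

theorem embedOp_extend_left (e : κ ↪ ι) (M : Op κ) (r : Bits κ) (x : Bits ι) :
    embedOp e M x (Function.extend e r x) = M (x ∘ e) r := by
  unfold embedOp
  rw [if_pos, extend_comp_self]
  intro i hi
  rw [extend_off e r x hi]

theorem embedOp_extend_right (e : κ ↪ ι) (M : Op κ) (r : Bits κ) (x : Bits ι) :
    embedOp e M (Function.extend e r x) x = M r (x ∘ e) := by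
  unfold embedOp
  rw [if_pos, extend_comp_self]
  intro i hi
  rw [extend_off e r x hi]

/-- Row x of an embedded operator is supported on the states got from x by overwriting the embedded
qubits, and these are parametrized injectively by r. So the matrix product collapses to a sum over
the small register. -/
theorem embedOp_mul_apply (e : κ ↪ ι) (M : Op κ) (N : Op ι) (x y : Bits ι) :
    (embedOp e M * N) x y = ∑ r, M (x ∘ e) r * N (Function.extend e r x) y := by
  rw [Matrix.mul_apply]
  symm
  apply Fintype.sum_of_injective _ (extend_injective e x)
  · intro z hz
    have : ¬ ∀ i : ι, (∀ k : κ, e k ≠ i) → x i = z i := fun h =>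
      hz ⟨z ∘ e, extend_of_agree fun i hi => (h i hi).symm⟩
    simp [embedOp, this]
  · intro r
    rw [embedOp_extend_left]

theorem mul_embedOp_apply (e : κ ↪ ι) (M : Op κ) (N : Op ι) (x y : Bits ι) :
    (N * embedOp e M) x y = ∑ r, N x (Function.extend e r y) * M r (y ∘ e) := by
  rw [Matrix.mul_apply]
  symm
  apply Fintype.sum_of_injective _ (extend_injective e y)
  · intro z hz
    have : ¬ ∀ i : ι, (∀ k : κ, e k ≠ i) → z i = y i := fun h =>
      hz ⟨z ∘ e, extend_of_agree h⟩
    simp [embedOp, this]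
  · intro r
    rw [embedOp_extend_right]

theorem embedOp_mul (e : κ ↪ ι) (M N : Op κ) :
    embedOp e (M * N) = embedOp e M * embedOp e N := by
  ext x y
  rw [embedOp_mul_apply]
  have key : ∀ r : Bits κ, (∀ i : ι, (∀ k : κ, e k ≠ i) → Function.extend e r x i = y i) ↔
      ∀ i : ι, (∀ k : κ, e k ≠ i) → x i = y i := fun r =>
    forall₂_congr fun i hi => by rw [extend_off e r x hi]
  simp only [embedOp, extend_comp_self, key]
  split_ifs
  · rw [Matrix.mul_apply]
  · simp

theorem embedOp_one (e : κ ↪ ι) : embedOp e (1 : Op κ) = 1 := by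
  ext x y
  simp only [embedOp, Matrix.one_apply]
  by_cases hxy : x = y
  · simp [hxy]
  · rw [if_neg hxy]
    split_ifs with h1 h2
    · exact absurd (by rw [← extend_of_agree h1, h2, extend_self]) hxy
    · rfl
    · rfl

theorem embedOp_conjTranspose (e : κ ↪ ι) (M : Op κ) :
    (embedOp e M).conjTranspose = embedOp e M.conjTranspose := by
  ext x y
  simp only [embedOp, Matrix.conjTranspose_apply]
  have : (∀ i : ι, (∀ k : κ, e k ≠ i) → y i = x i) ↔ ∀ i : ι, (∀ k : κ, e k ≠ i) → x i = y i :=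
    forall₂_congr fun i hi => eq_comm
  rw [if_congr this rfl rfl]
  split_ifs <;> simp

theorem embedOp_trans (e : κ ↪ ι) (f : ι ↪ η) (M : Op κ) :
    embedOp (e.trans f) M = embedOp f (embedOp e M) := by
  ext x y
  simp only [embedOp]
  by_cases h1 : ∀ i : η, (∀ k : ι, f k ≠ i) → x i = y i
  · rw [if_pos h1]
    by_cases h2 : ∀ i : ι, (∀ k : κ, e k ≠ i) → (x ∘ f) i = (y ∘ f) i
    · rw [if_pos h2, if_pos]
      · rfl
      intro i hi
      by_cases hf : ∃ k, f k = i
      · obtain ⟨k, rfl⟩ := hf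
        exact h2 k fun k' hk' => hi k' (by simp [hk'])
      · exact h1 i fun k hk => hf ⟨k, hk⟩
    · rw [if_neg h2, if_neg]
      exact fun h => h2 fun i hi => h (f i) fun k hk => hi k (f.injective hk)
  · rw [if_neg h1, if_neg]
    exact fun h => h1 fun i hi => h i fun k => hi (e k)

/-- Matrix elements of an embedded operator between states that differ only on the embedded
qubits. -/
theorem embedOp_of_agree {e : κ ↪ ι} {M : Op κ} {x y : Bits ι}
    (h : ∀ i : ι, (∀ k : κ, e k ≠ i) → x i = y i) : embedOp e M x y = M (x ∘ e) (y ∘ e) :=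
  if_pos h

theorem embedOp_of_ne {e : κ ↪ ι} {M : Op κ} {x y : Bits ι} {i : ι} (hi : ∀ k, e k ≠ i)
    (h : x i ≠ y i) : embedOp e M x y = 0 :=
  if_neg fun H => h (H i hi)

end Embed

/-! ### Controlled operators. -/

section Controlled
variable {κ ι : Type} [Fintype κ] [DecidableEq κ] [Fintype ι] [DecidableEq ι]

theorem controlled_mul (M N : Op κ) : controlled (M * N) = controlled M * controlled N := by
  ext x y
  rw [Matrix.mul_apply]
  have h : ∑ z, controlled M x z * controlled N z y =
      ∑ r : Bits κ, controlled M x (fun o => o.elim (x none) r) *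
        controlled N (fun o => o.elim (x none) r) y := by
    symm
    apply Fintype.sum_of_injective (fun (r : Bits κ) (o : Option κ) => o.elim (x none) r)
    · intro r s hrs
      funext k
      exact congrFun hrs (some k)
    · intro z hz
      have : x none ≠ z none := by
        intro hn
        apply hz
        refine ⟨z ∘ some, ?_⟩
        funext o
        cases o <;> simp [hn]
      simp [controlled, this]
    · intro r
      rfl
  rw [h]
  have hM : ∀ r : Bits κ, controlled M x (fun o => o.elim (x none) r) =
      if x none then M (x ∘ some) r else (1 : Op κ) (x ∘ some) r := fun r => if_pos rfl
  have hN : ∀ r : Bits κ, controlled N (fun o => o.elim (x none) r) y =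
      if x none = y none then (if x none then N r (y ∘ some) else (1 : Op κ) r (y ∘ some)) else 0 :=
    fun r => rfl
  simp only [hM, hN]
  simp only [controlled]
  by_cases hxy : x none = y none
  · by_cases hx : x none = true
    · simp only [if_pos hxy, if_pos hx, Matrix.mul_apply]
    · simp only [if_pos hxy, if_neg hx, ← Matrix.mul_apply, mul_one]
  · simp [hxy]

theorem controlled_one : controlled (1 : Op κ) = 1 := by
  ext x y
  simp only [controlled, ite_self]
  have : x = y ↔ x none = y none ∧ x ∘ some = y ∘ some := by
    constructor
    · rintro rfl; exact ⟨rfl, rfl⟩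
    · rintro ⟨h1, h2⟩
      funext o
      cases o with
      | none => exact h1
      | some k => exact congrFun h2 k
  simp only [Matrix.one_apply, this]
  split_ifs <;> simp_all

theorem controlled_conjTranspose (M : Op κ) :
    (controlled M).conjTranspose = controlled M.conjTranspose := by
  ext x y
  simp only [controlled, Matrix.conjTranspose_apply]
  by_cases hxy : y none = x none
  · rw [if_pos hxy, if_pos hxy.symm, hxy]
    split_ifs
    · rfl
    · rw [← Matrix.conjTranspose_apply, Matrix.conjTranspose_one]
  · rw [if_neg hxy, if_neg (Ne.symm hxy), star_zero]

theorem controlled_embedOp (e : κ ↪ ι) (M : Op κ) :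
    controlled (embedOp e M) = embedOp e.optionMap (controlled M) := by
  ext x y
  unfold controlled
  rw [← embedOp_one e]
  simp only [embedOp]
  have hx : ∀ x : Bits (Option ι), (x ∘ some) ∘ e = (x ∘ e.optionMap) ∘ some := fun x => rfl
  have hn : ∀ x : Bits (Option ι), (x ∘ e.optionMap) none = x none := fun x => rfl
  have key : (∀ i : Option ι, (∀ k : Option κ, e.optionMap k ≠ i) → x i = y i) ↔
      ∀ i : ι, (∀ k : κ, e k ≠ i) → (x ∘ some) i = (y ∘ some) i := by
    constructor
    · intro h i hi
      apply h (some i)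
      rintro (_ | k)
      · simp
      · simpa using hi k
    · rintro h (_ | i) hi
      · exact absurd rfl (hi none)
      · exact h i fun k hk => hi (some k) (by simp [hk])
  simp only [key, hn, hx]
  split_ifs <;> rfl

end Controlled

/-! ## Multiplexed one-qubit operators -/

section Mux
variable {κ ι : Type} [Fintype κ] [DecidableEq κ] [Fintype ι] [DecidableEq ι]

/-- The operator that applies the one-qubit operator `g x` to the qubit `t`, where `x` is the state
of the other qubits. -/
def mux (t : ι) (g : Bits ι → Matrix Bool Bool ℂ) : Op ι :=
  fun x y => if ∀ i, i ≠ t → x i = y i then g y (x t) (y t) else 0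

/-- `g` does not depend on the qubit `t`. -/
def Ignores {β : Type} (t : ι) (g : Bits ι → β) : Prop :=
  ∀ x b, g (Function.update x t b) = g x

theorem update_of_agree {t : ι} {x y : Bits ι} (h : ∀ i, i ≠ t → x i = y i) :
    Function.update y t (x t) = x := by
  funext i
  by_cases hi : i = t
  · subst hi; simp
  · simp [hi, h i hi]

theorem Ignores.eq_of_agree {β : Type} {t : ι} {g : Bits ι → β} (hg : Ignores t g) {x y : Bits ι}
    (h : ∀ i, i ≠ t → x i = y i) : g x = g y := by
  rw [← update_of_agree h, hg]

theorem Ignores.comp {β γ : Type} {t : ι} {g : Bits ι → β} (hg : Ignores t g) (f : β → γ) :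
    Ignores t fun x => f (g x) := fun x b => congrArg f (hg x b)

theorem ignores_const {β : Type} (t : ι) (b : β) : Ignores t fun _ : Bits ι => b :=
  fun _ _ => rfl

theorem ignores_of_dependsOn {β : Type} {t : ι} {S : Set ι} {g : Bits ι → β} (hg : DependsOn g S)
    (ht : t ∉ S) : Ignores t g := fun x b => hg fun i hi => by
  have : i ≠ t := fun h => ht (h ▸ hi)
  simp [this]

theorem mux_update_left (t : ι) (g : Bits ι → Matrix Bool Bool ℂ) (y : Bits ι) (b : Bool) :
    mux t g (Function.update y t b) y = g y b (y t) := by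
  simp only [mux]
  rw [if_pos fun i hi => by simp [hi]]
  simp

theorem update_bit_injective (t : ι) (x : Bits ι) :
    Function.Injective fun b : Bool => Function.update x t b :=
  Function.update_injective x t

theorem mul_mux_apply (t : ι) (g : Bits ι → Matrix Bool Bool ℂ) (N : Op ι) (x y : Bits ι) :
    (N * mux t g) x y = ∑ b, N x (Function.update y t b) * g y b (y t) := by
  rw [Matrix.mul_apply]
  symm
  apply Fintype.sum_of_injective _ (update_bit_injective t y)
  · intro z hz
    have : ¬ ∀ i, i ≠ t → z i = y i := fun h => hz ⟨z t, update_of_agree h⟩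
    simp [mux, this]
  · intro b
    rw [mux_update_left]

theorem mux_mul_apply {t : ι} {g : Bits ι → Matrix Bool Bool ℂ} (hg : Ignores t g) (N : Op ι)
    (x y : Bits ι) :
    (mux t g * N) x y = ∑ b, g x (x t) b * N (Function.update x t b) y := by
  rw [Matrix.mul_apply]
  symm
  apply Fintype.sum_of_injective _ (update_bit_injective t x)
  · intro z hz
    have : ¬ ∀ i, i ≠ t → x i = z i := fun h => hz ⟨z t, update_of_agree fun i hi => (h i hi).symm⟩
    simp [mux, this]
  · intro b
    simp only [mux]
    rw [if_pos fun i hi => by simp [hi], hg]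
    simp

/-- `mux` evaluates its selecting function at the column. In a product the left factor is evaluated
at the intermediate state, which may differ from the column at t; therefore only the left function
has to ignore t. -/
theorem mux_mul {t : ι} {g h : Bits ι → Matrix Bool Bool ℂ} (hg : Ignores t g) :
    mux t g * mux t h = mux t fun x => g x * h x := by
  ext x y
  rw [mul_mux_apply]
  simp only [mux]
  by_cases hxy : ∀ i, i ≠ t → x i = y i
  · rw [if_pos hxy, Matrix.mul_apply]
    apply Finset.sum_congr rfl
    intro b _
    rw [if_pos fun i hi => by simp [hi, hxy i hi], hg]
    simp
  · rw [if_neg hxy]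
    apply Finset.sum_eq_zero
    intro b _
    rw [if_neg, zero_mul]
    exact fun h => hxy fun i hi => by simpa [hi] using h i hi

theorem mux_one (t : ι) : mux t (fun _ => 1) = 1 := by
  ext x y
  simp only [mux, Matrix.one_apply]
  by_cases hxy : x = y
  · simp [hxy]
  · rw [if_neg hxy]
    split_ifs with h1 h2
    · exact absurd (by rw [← update_of_agree h1, h2]; simp) hxy
    · rfl
    · rfl

theorem mux_conjTranspose {t : ι} {g : Bits ι → Matrix Bool Bool ℂ} (hg : Ignores t g) :
    (mux t g).conjTranspose = mux t fun x => (g x).conjTranspose := by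
  ext x y
  simp only [mux, Matrix.conjTranspose_apply]
  by_cases hxy : ∀ i, i ≠ t → x i = y i
  · rw [if_pos hxy, if_pos fun i hi => (hxy i hi).symm, hg.eq_of_agree hxy]
  · rw [if_neg hxy, if_neg fun h => hxy fun i hi => (h i hi).symm, star_zero]

theorem mux_mem_unitary {t : ι} {g : Bits ι → Matrix Bool Bool ℂ} (hg : Ignores t g)
    (hu : ∀ x, g x ∈ Matrix.unitaryGroup Bool ℂ) : mux t g ∈ Matrix.unitaryGroup (Bits ι) ℂ := by
  rw [Matrix.mem_unitaryGroup_iff, Matrix.star_eq_conjTranspose, mux_conjTranspose hg, mux_mul hg]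
  have : (fun x => g x * (g x).conjTranspose) = fun _ => 1 := funext fun x =>
    Matrix.mem_unitaryGroup_iff.mp (hu x)
  rw [this, mux_one]

theorem embedOp_mux (e : κ ↪ ι) (t : κ) (g : Bits κ → Matrix Bool Bool ℂ) :
    embedOp e (mux t g) = mux (e t) fun x => g (x ∘ e) := by
  ext x y
  simp only [embedOp, mux]
  by_cases hxy : ∀ i, i ≠ e t → x i = y i
  · rw [if_pos hxy, if_pos, if_pos]
    · rfl
    · exact fun i hi => hxy (e i) fun h => hi (e.injective h)
    · exact fun i hi => hxy i fun h => hi t h.symm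
  · rw [if_neg hxy]
    split_ifs with h1 h2
    · refine absurd (fun i hi => ?_) hxy
      by_cases hf : ∃ k, e k = i
      · obtain ⟨k, rfl⟩ := hf
        exact h2 k fun h => hi (by rw [h])
      · exact h1 i fun k hk => hf ⟨k, hk⟩
    · rfl
    · rfl

theorem controlled_mux (t : κ) (g : Bits κ → Matrix Bool Bool ℂ) :
    controlled (mux t g) = mux (some t) fun x => if x none then g (x ∘ some) else 1 := by
  ext x y
  unfold controlled
  rw [← mux_one t]
  simp only [mux]
  have key : (∀ i : Option κ, i ≠ some t → x i = y i) ↔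
      x none = y none ∧ ∀ i : κ, i ≠ t → (x ∘ some) i = (y ∘ some) i := by
    constructor
    · intro h
      exact ⟨h none (by simp), fun i hi => h (some i) (by simpa using hi)⟩
    · rintro ⟨h1, h2⟩ (_ | i) hi
      · exact h1
      · exact h2 i (by simpa using hi)
  simp only [key]
  by_cases h1 : x none = y none
  · simp only [h1, true_and, if_true]
    split_ifs <;> rfl
  · simp [h1]

end Mux

/-! ## Circuits -/

section Circuits
variable {κ ι : Type} [Fintype κ] [DecidableEq κ] [Fintype ι] [DecidableEq ι]

theorem Circuit.op_nil : Circuit.op ([] : Circuit ι) = 1 := rfl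

theorem Circuit.op_cons (g : TwoQubitGate ι) (P : Circuit ι) :
    Circuit.op (g :: P) = Circuit.op P * g.op := rfl

theorem Circuit.op_append (P Q : Circuit ι) :
    Circuit.op (P ++ Q) = Circuit.op Q * Circuit.op P := by
  induction P with
  | nil => simp [Circuit.op_nil]
  | cons g P ih => rw [List.cons_append, Circuit.op_cons, Circuit.op_cons, ih, mul_assoc]

theorem TwoQubitGate.op_map (e : κ ↪ ι) (g : TwoQubitGate κ) :
    (g.map e).op = embedOp e g.op := embedOp_trans _ _ _

theorem Circuit.op_map (e : κ ↪ ι) (P : Circuit κ) :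
    Circuit.op (P.map (TwoQubitGate.map e)) = embedOp e P.op := by
  induction P with
  | nil => exact (embedOp_one e).symm
  | cons g P ih =>
    rw [List.map_cons, Circuit.op_cons, Circuit.op_cons, ih, embedOp_mul, TwoQubitGate.op_map]

theorem embedOp_mem_unitary (e : κ ↪ ι) {M : Op κ} (hM : M ∈ Matrix.unitaryGroup (Bits κ) ℂ) :
    embedOp e M ∈ Matrix.unitaryGroup (Bits ι) ℂ := by
  rw [Matrix.mem_unitaryGroup_iff, Matrix.star_eq_conjTranspose] at *
  rw [embedOp_conjTranspose, ← embedOp_mul, hM, embedOp_one]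

theorem Circuit.op_mem_unitary (P : Circuit ι) : P.op ∈ Matrix.unitaryGroup (Bits ι) ℂ := by
  induction P with
  | nil => exact one_mem _
  | cons g P ih => exact mul_mem ih (embedOp_mem_unitary _ g.unitary)

/-- The inverse gate. -/
def TwoQubitGate.inv (g : TwoQubitGate ι) : TwoQubitGate ι where
  wires := g.wires
  mat := g.mat.conjTranspose
  unitary := Unitary.star_mem g.unitary

theorem TwoQubitGate.op_inv (g : TwoQubitGate ι) : g.inv.op = g.op.conjTranspose :=
  (embedOp_conjTranspose _ _).symm

theorem Circuit.op_inv (P : Circuit ι) :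
    Circuit.op (P.map TwoQubitGate.inv).reverse = P.op.conjTranspose := by
  induction P with
  | nil => simp [Circuit.op_nil]
  | cons g P ih =>
    rw [List.map_cons, List.reverse_cons, Circuit.op_append, ih, Circuit.op_cons, Circuit.op_nil,
      one_mul, TwoQubitGate.op_inv, Circuit.op_cons, Matrix.conjTranspose_mul]

/-- `M` is the unitary of a circuit of at most `k` gates. -/
def HasCircuit (M : Op ι) (k : ℕ) : Prop := ∃ P : Circuit ι, P.op = M ∧ P.length ≤ k

theorem HasCircuit.one : HasCircuit (1 : Op ι) 0 := ⟨[], rfl, le_rfl⟩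

theorem HasCircuit.mul {M N : Op ι} {k l : ℕ} (hM : HasCircuit M k) (hN : HasCircuit N l) :
    HasCircuit (M * N) (k + l) := by
  obtain ⟨P, rfl, hP⟩ := hM
  obtain ⟨Q, rfl, hQ⟩ := hN
  exact ⟨Q ++ P, Circuit.op_append _ _, by rw [List.length_append]; omega⟩

theorem HasCircuit.mono {M : Op ι} {k l : ℕ} (hM : HasCircuit M k) (h : k ≤ l) :
    HasCircuit M l := by
  obtain ⟨P, hP, hk⟩ := hM
  exact ⟨P, hP, hk.trans h⟩

theorem HasCircuit.conjTranspose {M : Op ι} {k : ℕ} (hM : HasCircuit M k) :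
    HasCircuit M.conjTranspose k := by
  obtain ⟨P, rfl, hP⟩ := hM
  exact ⟨_, Circuit.op_inv P, by simpa using hP⟩

theorem HasCircuit.embedOp {M : Op κ} {k : ℕ} (hM : HasCircuit M k) (e : κ ↪ ι) :
    HasCircuit (embedOp e M) k := by
  obtain ⟨P, rfl, hP⟩ := hM
  exact ⟨_, Circuit.op_map e P, by simpa using hP⟩

theorem HasCircuit.mem_unitary {M : Op ι} {k : ℕ} (hM : HasCircuit M k) :
    M ∈ Matrix.unitaryGroup (Bits ι) ℂ := by
  obtain ⟨P, rfl, -⟩ := hM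
  exact P.op_mem_unitary

/-- A one-qubit unitary on `t` that depends on the qubit `c` is a two-qubit gate. -/
theorem hasCircuit_mux_pair {t c : ι} (htc : t ≠ c) {G : Bool → Matrix Bool Bool ℂ}
    (hG : ∀ b, G b ∈ Matrix.unitaryGroup Bool ℂ) :
    HasCircuit (mux t fun x => G (x c)) 1 := by
  have hig : Ignores (0 : Fin 2) fun y : Bits (Fin 2) => G (y 1) := fun x b => by simp
  let e : Fin 2 ↪ ι := ⟨![t, c], by
    intro i j h
    fin_cases i <;> fin_cases j <;> simp_all [htc.symm]⟩
  refine ⟨[⟨e, mux 0 fun y => G (y 1), mux_mem_unitary hig fun y => hG _⟩], ?_, by simp⟩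
  rw [Circuit.op_cons, Circuit.op_nil, one_mul, TwoQubitGate.op, embedOp_mux]
  rfl

end Circuits

/-! ## Uniformly controlled rotations and diagonal phases -/

/-- The rotation by the angle `θ` in the plane of `|0⟩` and `|1⟩`. -/
noncomputable def rot (θ : ℝ) : Matrix Bool Bool ℂ := fun a b =>
  if a = b then (Real.cos θ : ℂ) else if a then (Real.sin θ : ℂ) else -(Real.sin θ : ℂ)

/-- The diagonal matrix with entries `exp (iθ)` and `exp (-iθ)`. -/
noncomputable def phaseRot (θ : ℝ) : Matrix Bool Bool ℂ :=
  Matrix.diagonal fun a => Complex.exp (Complex.I * ((if a then -θ else θ : ℝ) : ℂ))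

/-- The bit flip. -/
def flipMat : Matrix Bool Bool ℂ := fun a b => if a = b then 0 else 1

theorem rot_zero : rot 0 = 1 := by
  ext a b
  cases a <;> cases b <;> simp [rot]

theorem rot_add (a b : ℝ) : rot (a + b) = rot a * rot b := by
  ext i j
  cases i <;> cases j <;>
    simp [rot, Matrix.mul_apply, Complex.cos_add, Complex.sin_add] <;> ring

theorem flip_mul_flip : flipMat * flipMat = 1 := by
  ext i j
  cases i <;> cases j <;> simp [flipMat, Matrix.mul_apply]

theorem flip_rot_flip (a : ℝ) : flipMat * rot a * flipMat = rot (-a) := by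
  ext i j
  cases i <;> cases j <;> simp [rot, flipMat, Matrix.mul_apply]

theorem rot_conjTranspose (a : ℝ) : (rot a).conjTranspose = rot (-a) := by
  ext i j
  cases i <;> cases j <;>
    simp [rot, Matrix.conjTranspose_apply, ← Complex.cos_conj, ← Complex.sin_conj]

theorem rot_mem_unitary (a : ℝ) : rot a ∈ Matrix.unitaryGroup Bool ℂ := by
  rw [Matrix.mem_unitaryGroup_iff, Matrix.star_eq_conjTranspose, rot_conjTranspose, ← rot_add,
    add_neg_cancel, rot_zero]

theorem flip_mem_unitary : flipMat ∈ Matrix.unitaryGroup Bool ℂ := by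
  rw [Matrix.mem_unitaryGroup_iff, Matrix.star_eq_conjTranspose]
  have : flipMat.conjTranspose = flipMat := by
    ext i j
    cases i <;> cases j <;> simp [flipMat, Matrix.conjTranspose_apply]
  rw [this, flip_mul_flip]

theorem phaseRot_add (a b : ℝ) : phaseRot (a + b) = phaseRot a * phaseRot b := by
  rw [phaseRot, phaseRot, phaseRot, Matrix.diagonal_mul_diagonal]
  congr 1
  funext i
  rw [← Complex.exp_add]
  cases i <;> simp <;> ring_nf

theorem phaseRot_zero : phaseRot 0 = 1 := by
  simp [phaseRot]

theorem flip_phaseRot_flip (a : ℝ) : flipMat * phaseRot a * flipMat = phaseRot (-a) := by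
  ext i j
  cases i <;> cases j <;> simp [phaseRot, flipMat, Matrix.mul_apply]

theorem phaseRot_conjTranspose (a : ℝ) : (phaseRot a).conjTranspose = phaseRot (-a) := by
  rw [phaseRot, phaseRot, Matrix.diagonal_conjTranspose]
  congr 1
  funext i
  simp only [Pi.star_apply, Complex.star_def, ← Complex.exp_conj]
  cases i <;> simp

theorem phaseRot_mem_unitary (a : ℝ) : phaseRot a ∈ Matrix.unitaryGroup Bool ℂ := by
  rw [Matrix.mem_unitaryGroup_iff, Matrix.star_eq_conjTranspose, phaseRot_conjTranspose,
    ← phaseRot_add, add_neg_cancel, phaseRot_zero]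

section
variable {κ ι : Type} [Fintype κ] [DecidableEq κ] [Fintype ι] [DecidableEq ι]

theorem dependsOn_comp_update {β : Type} {c : ι} {S : List ι} {θ : Bits ι → β}
    (h : DependsOn θ {i | i ∈ c :: S}) (b : Bool) :
    DependsOn (fun x => θ (Function.update x c b)) {i | i ∈ S} := fun x y hxy => by
  apply h
  intro i hi
  by_cases hic : i = c
  · subst hic; simp
  · simp only [Function.update_of_ne hic]
    exact hxy i (by simpa [hic] using hi)

/-- Uniformly controlled rotations, for a one-parameter group of one-qubit unitaries that is
inverted by the bit flip. -/
theorem hasCircuit_mux_of_oneParameter {G : ℝ → Matrix Bool Bool ℂ}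
    (hadd : ∀ a b, G (a + b) = G a * G b) (hflip : ∀ a, flipMat * G a * flipMat = G (-a))
    (hu : ∀ a, G a ∈ Matrix.unitaryGroup Bool ℂ) [Nontrivial ι] {t : ι} (S : List ι) (ht : t ∉ S)
    {θ : Bits ι → ℝ} (hθ : DependsOn θ {i | i ∈ S}) :
    HasCircuit (mux t fun x => G (θ x)) (3 * 2 ^ S.length - 2) := by
  induction S generalizing θ with
  | nil =>
    -- With no controls left the rotation is a one-qubit gate; an idle second wire c makes it a
    -- two-qubit gate.
    obtain ⟨c, hc⟩ := exists_ne t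
    have : (fun x => G (θ x)) = fun _ => G (θ fun _ => false) := by
      funext x
      rw [hθ (x := x) (y := fun _ => false) fun i hi => by simp at hi]
    rw [this]
    exact hasCircuit_mux_pair (G := fun _ => G (θ fun _ => false)) hc.symm fun _ => hu _
  | cons c S ih =>
    have htc : t ≠ c := fun h => ht (by simp [h])
    have htS : t ∉ S := fun h => ht (by simp [h])
    set θ₀ := fun x => θ (Function.update x c false) with hθ₀
    set θ₁ := fun x => θ (Function.update x c true) with hθ₁
    have d₀ := dependsOn_comp_update hθ false
    have d₁ := dependsOn_comp_update hθ true
    -- θ equals p + m if c is 0 and p - m if c is 1. Conjugation by a bit flip controlled on c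
    -- supplies the sign, so both remaining angles no longer depend on c.
    set p := fun x => (θ₀ x + θ₁ x) / 2 with hp
    set m := fun x => (θ₀ x - θ₁ x) / 2 with hm
    have dp : DependsOn p {i | i ∈ S} := fun x y h => by
      rw [hp]; exact congrArg₂ (fun a b => (a + b) / 2) (d₀ h) (d₁ h)
    have dm : DependsOn m {i | i ∈ S} := fun x y h => by
      rw [hm]; exact congrArg₂ (fun a b => (a - b) / 2) (d₀ h) (d₁ h)
    set X : Bits ι → Matrix Bool Bool ℂ := fun x => if x c then flipMat else 1 with hX
    have iX : Ignores t X := fun x b => by simp [hX, htc.symm]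
    have im : Ignores t fun x => G (m x) := (ignores_of_dependsOn dm (by simpa)).comp G
    have ip : Ignores t fun x => G (p x) := (ignores_of_dependsOn dp (by simpa)).comp G
    have key : mux t (fun x => G (θ x)) =
        mux t (fun x => G (p x)) * (mux t X * mux t (fun x => G (m x)) * mux t X) := by
      rw [mux_mul iX, mux_mul, mux_mul ip]
      · congr 1
        funext x
        by_cases hx : x c = true
        · have h1 : Function.update x c true = x := by rw [← hx]; simp
          have : θ x = p x + -m x := by
            simp only [hp, hm, hθ₀, hθ₁, h1]; ring
          simp only [hX, hx, if_true, hflip, this, hadd]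
        · simp only [Bool.not_eq_true] at hx
          have h1 : Function.update x c false = x := by rw [← hx]; simp
          have : θ x = p x + m x := by
            simp only [hp, hm, hθ₀, hθ₁, h1]; ring
          simp only [hX, hx, Bool.false_eq_true, if_false, one_mul, mul_one, this, hadd]
      · intro x b
        exact congrArg₂ (· * ·) (iX x b) (im x b)
    have hXc : HasCircuit (mux t X) 1 :=
      hasCircuit_mux_pair (G := fun b => if b then flipMat else 1) htc fun b => by
        cases b
        · exact one_mem _
        · exact flip_mem_unitary
    rw [key]
    -- Two recursive calls and two controlled flips: f(k+1) = 2 f(k) + 2 with f(0) = 1, so f(k) =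
    -- 3·2^k - 2.
    refine ((ih htS dp).mul ((hXc.mul (ih htS dm)).mul hXc)).mono ?_
    have : 1 ≤ 2 ^ S.length := Nat.one_le_two_pow
    rw [List.length_cons, pow_succ]
    omega

theorem hasCircuit_mux_rot [Nontrivial ι] {t : ι} (S : List ι) (ht : t ∉ S)
    {θ : Bits ι → ℝ} (hθ : DependsOn θ {i | i ∈ S}) :
    HasCircuit (mux t fun x => rot (θ x)) (3 * 2 ^ S.length) :=
  (hasCircuit_mux_of_oneParameter rot_add flip_rot_flip rot_mem_unitary S ht hθ).mono
    (Nat.sub_le _ _)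

/-- The diagonal unitary with the phases `φ`. -/
noncomputable def phaseOp (φ : Bits ι → ℝ) : Op ι :=
  Matrix.diagonal fun x => Complex.exp (Complex.I * (φ x : ℂ))

theorem phaseOp_add (φ ψ : Bits ι → ℝ) :
    phaseOp (fun x => φ x + ψ x) = phaseOp φ * phaseOp ψ := by
  rw [phaseOp, phaseOp, phaseOp, Matrix.diagonal_mul_diagonal]
  congr 1
  funext x
  rw [← Complex.exp_add]
  push_cast
  ring_nf

theorem phaseOp_zero : phaseOp (fun _ : Bits ι => 0) = 1 := by
  simp [phaseOp]

theorem mux_phaseRot {t : ι} {δ : Bits ι → ℝ} :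
    mux t (fun x => phaseRot (δ x)) = phaseOp fun x => if x t then -δ x else δ x := by
  ext x y
  simp only [mux, phaseOp, phaseRot, Matrix.diagonal_apply]
  by_cases hxy : x = y
  · subst hxy; simp
  · rw [if_neg hxy]
    split_ifs with h1 h2 h3
    · exact absurd (by rw [← update_of_agree h1, h2]; simp) hxy
    · exact absurd (by rw [← update_of_agree h1, h2]; simp) hxy
    · rfl
    · rfl

/-- Splitting off a qubit t, the phase is its mean over t plus a term that changes sign with t. The
mean depends on fewer qubits, and the second term is a uniformly controlled phase rotation of t. The
cost satisfies f(k+1) ≤ f(k) + 3·2^k, which stays below 4·2^k. -/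
theorem hasCircuit_phaseOp [Nontrivial ι] (S : List ι) {φ : Bits ι → ℝ}
    (hφ : DependsOn φ {i | i ∈ S}) : HasCircuit (phaseOp φ) (4 * 2 ^ S.length) := by
  induction S generalizing φ with
  | nil =>
    obtain ⟨t, c, hc⟩ := exists_pair_ne ι
    -- A constant phase is a scalar matrix on an arbitrary qubit.
    set z := Complex.exp (Complex.I * (φ fun _ => false : ℝ)) with hz
    have hu : z • (1 : Matrix Bool Bool ℂ) ∈ Matrix.unitaryGroup Bool ℂ := by
      rw [Matrix.mem_unitaryGroup_iff, star_smul, star_one, smul_mul_smul_comm, one_mul,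
        Complex.star_def, hz, ← Complex.exp_conj, ← Complex.exp_add]
      simp
    have : phaseOp φ = mux t fun _ => z • (1 : Matrix Bool Bool ℂ) := by
      ext x y
      have h1 : φ x = φ fun _ => false := hφ fun i hi => by simp at hi
      simp only [phaseOp, Matrix.diagonal_apply, h1, mux, Matrix.smul_apply, Matrix.one_apply]
      by_cases hxy : x = y
      · subst hxy; simp [hz]
      · rw [if_neg hxy]
        split_ifs with h1 h2
        · exact absurd (by rw [← update_of_agree h1, h2]; simp) hxy
        · simp
        · rfl
    rw [this]
    exact (hasCircuit_mux_pair (G := fun _ => z • 1) hc fun _ => hu).mono (by simp)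
  | cons t S ih =>
    by_cases htS : t ∈ S
    · refine (ih fun x y h => hφ fun i hi => h i ?_).mono
        (Nat.mul_le_mul_left _ (Nat.pow_le_pow_right (by norm_num) (by simp)))
      rcases List.mem_cons.mp hi with rfl | hi
      · exact htS
      · exact hi
    set φ₀ := fun x => φ (Function.update x t false) with hφ₀
    set φ₁ := fun x => φ (Function.update x t true) with hφ₁
    have d₀ := dependsOn_comp_update hφ false
    have d₁ := dependsOn_comp_update hφ true
    set p := fun x => (φ₀ x + φ₁ x) / 2 with hp
    set m := fun x => (φ₀ x - φ₁ x) / 2 with hm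
    have dp : DependsOn p {i | i ∈ S} := fun x y h => by
      rw [hp]; exact congrArg₂ (fun a b => (a + b) / 2) (d₀ h) (d₁ h)
    have dm : DependsOn m {i | i ∈ S} := fun x y h => by
      rw [hm]; exact congrArg₂ (fun a b => (a - b) / 2) (d₀ h) (d₁ h)
    have key : phaseOp φ = phaseOp p * mux t fun x => phaseRot (m x) := by
      rw [mux_phaseRot, ← phaseOp_add]
      congr 1
      funext x
      by_cases hx : x t = true
      · have h1 : Function.update x t true = x := by rw [← hx]; simp
        simp only [hp, hm, hφ₀, hφ₁, h1, hx, if_true]; ring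
      · simp only [Bool.not_eq_true] at hx
        have h1 : Function.update x t false = x := by rw [← hx]; simp
        simp only [hp, hm, hφ₀, hφ₁, h1, hx, Bool.false_eq_true, if_false]; ring
    rw [key]
    refine ((ih dp).mul (hasCircuit_mux_of_oneParameter phaseRot_add flip_phaseRot_flip
      phaseRot_mem_unitary S htS dm)).mono ?_
    rw [List.length_cons, pow_succ]
    omega

/-! ### Operators whose controlled version is as cheap -/

/-- `M` and its controlled version are unitaries of circuits of at most `k` gates. -/
def HasCtrlCircuit (M : Op κ) (k : ℕ) : Prop := HasCircuit M k ∧ HasCircuit (controlled M) k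

theorem HasCtrlCircuit.one : HasCtrlCircuit (1 : Op κ) 0 :=
  ⟨.one, by rw [controlled_one]; exact .one⟩

theorem HasCtrlCircuit.mul {M N : Op κ} {k l : ℕ} (hM : HasCtrlCircuit M k)
    (hN : HasCtrlCircuit N l) : HasCtrlCircuit (M * N) (k + l) :=
  ⟨hM.1.mul hN.1, by rw [controlled_mul]; exact hM.2.mul hN.2⟩

theorem HasCtrlCircuit.mono {M : Op κ} {k l : ℕ} (hM : HasCtrlCircuit M k) (h : k ≤ l) :
    HasCtrlCircuit M l :=
  ⟨hM.1.mono h, hM.2.mono h⟩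

theorem HasCtrlCircuit.conjTranspose {M : Op κ} {k : ℕ} (hM : HasCtrlCircuit M k) :
    HasCtrlCircuit M.conjTranspose k :=
  ⟨hM.1.conjTranspose, by rw [← controlled_conjTranspose]; exact hM.2.conjTranspose⟩

theorem HasCtrlCircuit.embedOp {M : Op κ} {k : ℕ} (hM : HasCtrlCircuit M k) (e : κ ↪ ι) :
    HasCtrlCircuit (embedOp e M) k :=
  ⟨hM.1.embedOp e, by rw [controlled_embedOp]; exact hM.2.embedOp _⟩

theorem dependsOn_controlled {θ : Bits κ → ℝ} {S : List κ} (hθ : DependsOn θ {i | i ∈ S}) :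
    DependsOn (fun x : Bits (Option κ) => if x none then θ (x ∘ some) else 0)
      {i | i ∈ none :: S.map some} := fun x y h => by
  have h1 : x none = y none := h none (by simp)
  have h2 : θ (x ∘ some) = θ (y ∘ some) := hθ fun i hi => h (some i) (by simpa using hi)
  simp only [h1, h2]

/-- A control is one more argument of the angle, which is set to 0 when the control is off. So
controlling costs a factor 2 and no new kind of gate. -/
theorem hasCtrlCircuit_mux_rot [Nontrivial κ] {t : κ} (S : List κ) (ht : t ∉ S)
    {θ : Bits κ → ℝ} (hθ : DependsOn θ {i | i ∈ S}) :
    HasCtrlCircuit (mux t fun x => rot (θ x)) (6 * 2 ^ S.length) := by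
  refine ⟨(hasCircuit_mux_rot S ht hθ).mono (by omega), ?_⟩
  have : (fun x : Bits (Option κ) => if x none then rot (θ (x ∘ some)) else 1) =
      fun x => rot (if x none then θ (x ∘ some) else 0) := by
    funext x
    split_ifs
    · rfl
    · rw [rot_zero]
  rw [controlled_mux, this]
  refine (hasCircuit_mux_rot (none :: S.map some) (by simpa using ht)
    (dependsOn_controlled hθ)).mono ?_
  simp only [List.length_cons, List.length_map, pow_succ]
  omega

theorem hasCtrlCircuit_phaseOp [Nontrivial κ] (S : List κ) {φ : Bits κ → ℝ}
    (hφ : DependsOn φ {i | i ∈ S}) : HasCtrlCircuit (phaseOp φ) (8 * 2 ^ S.length) := by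
  refine ⟨(hasCircuit_phaseOp S hφ).mono (by omega), ?_⟩
  have : controlled (phaseOp φ) =
      phaseOp fun x : Bits (Option κ) => if x none then φ (x ∘ some) else 0 := by
    ext x y
    unfold controlled
    rw [← phaseOp_zero]
    simp only [phaseOp, Matrix.diagonal_apply]
    have key : x = y ↔ x none = y none ∧ x ∘ some = y ∘ some := by
      constructor
      · rintro rfl; exact ⟨rfl, rfl⟩
      · rintro ⟨h1, h2⟩
        funext o
        cases o with
        | none => exact h1
        | some k => exact congrFun h2 k
    simp only [key]
    by_cases h1 : x none = y none
    · simp only [h1, true_and, if_true]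
      split_ifs <;> rfl
    · simp [h1]
  rw [this]
  refine (hasCircuit_phaseOp (none :: S.map some) (dependsOn_controlled hφ)).mono ?_
  simp only [List.length_cons, List.length_map, pow_succ]
  omega

/-! ### State preparation -/

theorem sum_bits_split (q : κ) (f : Bits κ → ℝ) :
    ∑ x, f x = ∑ x, if x q then 0 else f x + f (Function.update x q true) := by
  have hinv : Function.Involutive fun x : Bits κ => Function.update x q (!x q) := fun x => by
    simp
  have h1 : ∑ x, (if x q then f x else 0) =
      ∑ x : Bits κ, if x q then 0 else f (Function.update x q true) := by
    rw [← Equiv.sum_comp hinv.toPerm]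
    apply Finset.sum_congr rfl
    intro x _
    by_cases hx : x q = true <;> simp [Function.Involutive.coe_toPerm, hx]
  have h2 : ∀ x : Bits κ, f x = (if x q then f x else 0) + if x q then 0 else f x := fun x => by
    split_ifs <;> simp
  rw [Finset.sum_congr rfl fun x _ => h2 x, Finset.sum_add_distrib, h1, ← Finset.sum_add_distrib]
  apply Finset.sum_congr rfl
  intro x _
  split_ifs <;> ring

/-- Recursion on the qubits: replace each pair of amplitudes differing in q by its Euclidean norm,
placed at q = 0. Prepare this vector u, which is supported on fewer qubits, and then rotate q by the
polar angle of the pair. The rotation with controls S costs 6·2^|S|, so the bound doubles with each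
qubit. -/
theorem exists_prep_nonneg [Nontrivial κ] (S : List κ) (hS : S.Nodup) (v : Bits κ → ℝ)
    (hv : ∀ x, 0 ≤ v x) (hsupp : ∀ x i, i ∉ S → x i = true → v x = 0) (hnorm : ∑ x, v x ^ 2 = 1) :
    ∃ P : Op κ, HasCtrlCircuit P (6 * 2 ^ S.length) ∧ ∀ r, P r (fun _ => false) = v r := by
  induction S generalizing v with
  | nil =>
    refine ⟨1, HasCtrlCircuit.one.mono (by omega), fun r => ?_⟩
    have h0 : ∀ r : Bits κ, r ≠ (fun _ => false) → v r = 0 := fun r hr => by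
      obtain ⟨i, hi⟩ := Function.ne_iff.mp hr
      exact hsupp r i (by simp) (by simpa using hi)
    rw [Finset.sum_eq_single (fun _ => false) (fun b _ hb => by simp [h0 b hb]) (by simp)] at hnorm
    have h1 : v (fun _ => false) = 1 := by nlinarith [hv fun _ => false]
    rw [Matrix.one_apply]
    split_ifs with h
    · rw [h, h1]; simp
    · rw [h0 r h]; simp
  | cons q S ih =>
    obtain ⟨hq, hS⟩ := List.nodup_cons.mp hS
    let u : Bits κ → ℝ := fun x => if x q then 0 else
      Real.sqrt (v x ^ 2 + v (Function.update x q true) ^ 2)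
    have hu2 : ∀ x, u x ^ 2 = if x q then 0 else v x ^ 2 + v (Function.update x q true) ^ 2 :=
      fun x => by
        simp only [u]
        split_ifs
        · simp
        · rw [Real.sq_sqrt (by positivity)]
    obtain ⟨P, hP, hPv⟩ := ih hS u (fun x => by simp only [u]; split_ifs <;> positivity)
      (fun x i hi hx => by
        simp only [u]
        split_ifs with h
        · rfl
        · have hiq : i ≠ q := fun h' => h (h' ▸ hx)
          rw [hsupp x i (by simp [hi, hiq]) hx, hsupp _ i (by simp [hi, hiq]) (by simp [hiq, hx])]
          simp)
      (by rw [Finset.sum_congr rfl fun x _ => hu2 x, ← hnorm]; exact (sum_bits_split q _).symm)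
    -- Zeroing the qubits outside S makes the angle depend on S only. Nothing is lost, since v
    -- vanishes when a qubit outside q :: S is 1.
    let res : Bits κ → Bits κ := fun x i => if i ∈ S then x i else false
    -- The pair is read as a complex number, so its modulus is the merged amplitude. The value of
    -- `Complex.arg` at 0 does not matter because the modulus is then 0.
    let θ : Bits κ → ℝ := fun x => Complex.arg ⟨v (res x), v (Function.update (res x) q true)⟩
    have hθ : DependsOn θ {i | i ∈ S} := fun x y h => by
      have : res x = res y := by
        funext i
        simp only [res]
        split_ifs with hi
        · exact h i hi
        · rfl
      simp only [θ, this]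
    have iθ : Ignores q fun x => rot (θ x) := (ignores_of_dependsOn hθ (by simpa)).comp rot
    refine ⟨mux q (fun x => rot (θ x)) * P, ((hasCtrlCircuit_mux_rot S hq hθ).mul hP).mono
      (by rw [List.length_cons, pow_succ]; omega), fun r => ?_⟩
    rw [mux_mul_apply iθ, Fintype.sum_bool, hPv, hPv]
    have hu1 : u (Function.update r q true) = 0 := by simp [u]
    rw [hu1]
    by_cases hr : ∃ i, i ∉ q :: S ∧ r i = true
    · obtain ⟨i, hi, hri⟩ := hr
      have hiq : i ≠ q := fun h => hi (by simp [h])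
      rw [hsupp r i hi hri]
      have hu0 : u (Function.update r q false) = 0 := by
        simp only [u, Function.update_self, Bool.false_eq_true, if_false]
        rw [hsupp _ i hi (by simp [hiq, hri]), hsupp _ i hi (by simp [hiq, hri])]
        simp
      simp [hu0]
    · push Not at hr
      have hres : res r = Function.update r q false := by
        funext i
        by_cases hiq : i = q
        · subst hiq; simp [res, hq]
        · by_cases hi : i ∈ S
          · simp [res, hi, hiq]
          · simpa [res, hi, hiq] using (hr i (by simp [hi, hiq])).symm
      set z : ℂ := ⟨v (Function.update r q false), v (Function.update r q true)⟩ with hz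
      have hθr : θ r = Complex.arg z := by
        simp only [θ, hres, Function.update_idem, hz]
      have hu0 : u (Function.update r q false) = ‖z‖ := by
        simp only [u, Function.update_self, Bool.false_eq_true, if_false, Function.update_idem]
        rw [hz, Complex.norm_eq_sqrt_sq_add_sq]
      rw [hu0, hθr]
      have hc := Complex.norm_mul_cos_arg z
      have hs := Complex.norm_mul_sin_arg z
      by_cases hrq : r q = true
      · have h1 : Function.update r q true = r := by rw [← hrq]; simp
        have hvr : v r = z.im := by simp [hz, h1]
        have key := congrArg Complex.ofReal hs
        push_cast at key
        rw [hvr, ← key]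
        simp only [rot, hrq]
        simp only [Complex.ofReal_zero, if_true, Complex.ofReal_sin, Complex.ofReal_cos,
          reduceCtorEq, if_false]
        ring_nf
      · simp only [Bool.not_eq_true] at hrq
        have h1 : Function.update r q false = r := by rw [← hrq]; simp
        have hvr : v r = z.re := by simp [hz, h1]
        have key := congrArg Complex.ofReal hc
        push_cast at key
        rw [hvr, ← key]
        simp only [rot, hrq]
        simp only [Complex.ofReal_zero, if_true, Complex.ofReal_sin, Complex.ofReal_cos,
          reduceCtorEq, if_false]
        ring_nf

/-- State preparation with `O(2^m)` gates on `m` qubits. -/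
theorem exists_prep [Nontrivial κ] (v : Bits κ → ℂ) (hnorm : ∑ x, ‖v x‖ ^ 2 = 1) :
    ∃ P : Op κ, HasCtrlCircuit P (14 * 2 ^ Fintype.card κ) ∧ ∀ r, P r (fun _ => false) = v r := by
  obtain ⟨P, hP, hPv⟩ := exists_prep_nonneg (Finset.univ : Finset κ).toList
    (Finset.nodup_toList _) (fun x => ‖v x‖) (fun x => norm_nonneg _)
    (fun x i hi => absurd (by simp) hi) hnorm
  have hd : DependsOn (fun x => Complex.arg (v x)) {i | i ∈ (Finset.univ : Finset κ).toList} :=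
    fun x y h => by
      have : x = y := funext fun i => h i (by simp)
      rw [this]
  -- Moduli first, at 6·2^m gates, then phases as a diagonal operator, at 8·2^m.
  refine ⟨phaseOp (fun x => Complex.arg (v x)) * P,
    ((hasCtrlCircuit_phaseOp _ hd).mul hP).mono (by simp; omega), fun r => ?_⟩
  rw [phaseOp, Matrix.diagonal_mul, hPv, mul_comm, mul_comm Complex.I]
  exact Complex.norm_mul_exp_arg_mul_I (v r)

/-- State-preparation pairs for a subnormalized vector with an unused label. -/
theorem exists_prep_pair [Nontrivial κ] (c : Bits κ → ℂ) (hc : ∑ x, ‖c x‖ ≤ 1) {r₀ : Bits κ}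
    (hr₀ : c r₀ = 0) :
    ∃ PL PR : Op κ, HasCtrlCircuit PL (14 * 2 ^ Fintype.card κ) ∧
      HasCtrlCircuit PR (14 * 2 ^ Fintype.card κ) ∧
      ∀ r, star (PL r fun _ => false) * PR r (fun _ => false) = c r := by
  suffices h : ∃ vL vR : Bits κ → ℂ, ∑ x, ‖vL x‖ ^ 2 = 1 ∧ ∑ x, ‖vR x‖ ^ 2 = 1 ∧
      ∀ r, star (vL r) * vR r = c r by
    obtain ⟨vL, vR, hL, hR, h⟩ := h
    obtain ⟨PL, hPL, hL'⟩ := exists_prep vL hL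
    obtain ⟨PR, hPR, hR'⟩ := exists_prep vR hR
    exact ⟨PL, PR, hPL, hPR, fun r => by rw [hL', hR', h]⟩
  set s := ∑ x, ‖c x‖ with hs
  have hs0 : 0 ≤ s := Finset.sum_nonneg fun _ _ => norm_nonneg _
  rcases hs0.eq_or_lt with h0 | hpos
  · have hc0 : ∀ r, c r = 0 := fun r => by
      have := (Finset.sum_eq_zero_iff_of_nonneg fun x _ => norm_nonneg (c x)).mp h0.symm r
        (Finset.mem_univ r)
      simpa using this
    obtain ⟨q⟩ : Nonempty κ := inferInstance
    -- For c = 0 any two orthogonal basis states form a pair.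
    refine ⟨fun r => if r = r₀ then 1 else 0,
      fun r => if r = Function.update r₀ q (!r₀ q) then 1 else 0, ?_, ?_, fun r => ?_⟩
    · simp [apply_ite norm, ite_pow]
    · simp [apply_ite norm, ite_pow]
    · rw [hc0]
      have : Function.update r₀ q (!r₀ q) ≠ r₀ := fun h => by simpa using congrFun h q
      by_cases hr : r = r₀
      · subst hr; simp [this.symm]
      · simp [hr]
  -- The right vector √(|c|/s)·(phase of c) is normalized. The left vector √(|c| s) has squared norm
  -- s² only; its missing weight 1 - s² sits at r₀, where the right vector vanishes.
  · refine ⟨fun r => if r = r₀ then (Real.sqrt (1 - s ^ 2) : ℂ) else (Real.sqrt (‖c r‖ * s) : ℂ),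
      fun r => (Real.sqrt (‖c r‖ / s) : ℂ) * Complex.exp (Complex.arg (c r) * Complex.I),
      ?_, ?_, fun r => ?_⟩
    · have : ∀ r, ‖if r = r₀ then (Real.sqrt (1 - s ^ 2) : ℂ) else (Real.sqrt (‖c r‖ * s) : ℂ)‖ ^ 2
          = (if r = r₀ then 1 - s ^ 2 else 0) + ‖c r‖ * s := fun r => by
        split_ifs with h
        · rw [Complex.norm_real, Real.norm_eq_abs, sq_abs, Real.sq_sqrt (by nlinarith), h, hr₀]
          simp
        · rw [Complex.norm_real, Real.norm_eq_abs, sq_abs, Real.sq_sqrt (by positivity)]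
          simp
      rw [Finset.sum_congr rfl fun r _ => this r, Finset.sum_add_distrib, ← Finset.sum_mul, ← hs]
      simp
      ring
    · have : ∀ r, ‖(Real.sqrt (‖c r‖ / s) : ℂ) * Complex.exp (Complex.arg (c r) * Complex.I)‖ ^ 2
          = ‖c r‖ / s := fun r => by
        rw [norm_mul, Complex.norm_exp_ofReal_mul_I, mul_one, Complex.norm_real, Real.norm_eq_abs,
          sq_abs, Real.sq_sqrt (by positivity)]
      rw [Finset.sum_congr rfl fun r _ => this r, ← Finset.sum_div, ← hs, div_self hpos.ne']
    · by_cases h : r = r₀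
      · simp [h, hr₀]
      · simp only [if_neg h, Complex.star_def, Complex.conj_ofReal]
        rw [← mul_assoc, ← Complex.ofReal_mul, ← Real.sqrt_mul (by positivity)]
        have : ‖c r‖ * s * (‖c r‖ / s) = ‖c r‖ ^ 2 := by field_simp
        rw [this, Real.sqrt_sq (norm_nonneg _)]
        exact Complex.norm_mul_exp_arg_mul_I (c r)

end

/-! ## Clean work qubits -/

section Implements
variable {κ ι ω : Type} [Fintype κ] [DecidableEq κ] [Fintype ι] [DecidableEq ι] [Fintype ω]
  [DecidableEq ω]

/-- The isometry that adds work qubits in the state `|0…0⟩`. -/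
def addWork (κ ω : Type) [Fintype κ] [Fintype ω] [DecidableEq κ] [DecidableEq ω] :
    Matrix (Bits (κ ⊕ ω)) (Bits κ) ℂ :=
  fun x y => if x = Sum.elim y (fun _ => false) then 1 else 0

theorem mul_addWork_apply (U : Op (κ ⊕ ω)) (x : Bits (κ ⊕ ω)) (y : Bits κ) :
    (U * addWork κ ω) x y = U x (Sum.elim y fun _ => false) := by
  simp [Matrix.mul_apply, addWork]

theorem addWork_mul_apply (W : Op κ) (x : Bits κ) (z : Bits ω) (y : Bits κ) :
    (addWork κ ω * W) (Sum.elim x z) y = if z = (fun _ => false) then W x y else 0 := by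
  have h : ∀ w : Bits κ, (Sum.elim x z : Bits (κ ⊕ ω)) = Sum.elim w (fun _ => false) ↔
      x = w ∧ z = fun _ => false := fun w => Sum.elim_eq_iff
  simp only [Matrix.mul_apply, addWork, h]
  split_ifs with hz
  · simp [hz]
  · simp [hz]

/-- With J the isometry that appends |0…0⟩, implementing W is the intertwining relation UJ = JW.
Products, adjoints and unitarity follow from it by algebra. -/
theorem implements_iff {U : Op (κ ⊕ ω)} {W : Op κ} :
    Implements U W ↔ U * addWork κ ω = addWork κ ω * W := by
  constructor
  · intro h
    ext x y
    obtain ⟨a, z, rfl⟩ : ∃ a z, x = Sum.elim a z := ⟨x ∘ Sum.inl, x ∘ Sum.inr, by simp⟩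
    rw [mul_addWork_apply, addWork_mul_apply]
    split_ifs with hz
    · exact (h a z y).1 fun i => congrFun hz i
    · obtain ⟨i, hi⟩ := Function.ne_iff.mp hz
      exact (h a z y).2 ⟨i, by simpa using hi⟩
  · intro h a z y
    have := congrFun (congrFun h (Sum.elim a z)) y
    rw [mul_addWork_apply, addWork_mul_apply] at this
    rw [this]
    constructor
    · intro hz
      rw [if_pos (funext hz)]
    · rintro ⟨i, hi⟩
      rw [if_neg fun hz => by simp [hz] at hi]

theorem addWork_isometry : (addWork κ ω).conjTranspose * addWork κ ω = 1 := by
  ext x y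
  have h : (Sum.elim y (fun _ => false) : Bits (κ ⊕ ω)) = Sum.elim x (fun _ => false) ↔ x = y := by
    rw [Sum.elim_eq_iff]
    simp [eq_comm]
  simp [Matrix.mul_apply, addWork, Matrix.one_apply, Matrix.conjTranspose_apply, h]

theorem Implements.one : Implements (1 : Op (κ ⊕ ω)) (1 : Op κ) := by
  rw [implements_iff, Matrix.one_mul, Matrix.mul_one]

theorem Implements.mul {U V : Op (κ ⊕ ω)} {M N : Op κ} (hU : Implements U M)
    (hV : Implements V N) : Implements (U * V) (M * N) := by
  rw [implements_iff] at *
  rw [Matrix.mul_assoc, hV, ← Matrix.mul_assoc, hU, Matrix.mul_assoc]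

theorem Implements.mem_unitary {U : Op (κ ⊕ ω)} {W : Op κ} (h : Implements U W)
    (hU : U ∈ Matrix.unitaryGroup (Bits (κ ⊕ ω)) ℂ) : W ∈ Matrix.unitaryGroup (Bits κ) ℂ := by
  rw [implements_iff] at h
  rw [Matrix.mem_unitaryGroup_iff', Matrix.star_eq_conjTranspose] at *
  calc W.conjTranspose * W
      = W.conjTranspose * ((addWork κ ω).conjTranspose * addWork κ ω) * W := by
        rw [addWork_isometry, mul_one]
    _ = (addWork κ ω * W).conjTranspose * (addWork κ ω * W) := by
        rw [Matrix.conjTranspose_mul]; simp only [Matrix.mul_assoc]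
    _ = (addWork κ ω).conjTranspose * (U.conjTranspose * U) * addWork κ ω := by
        rw [← h, Matrix.conjTranspose_mul]; simp only [Matrix.mul_assoc]
    _ = 1 := by rw [hU, Matrix.mul_one, addWork_isometry]

/-- U†J = U†(JW)W† = U†(UJ)W† = JW†. The first equality needs WW† = 1, which W inherits from U. -/
theorem Implements.conjTranspose {U : Op (κ ⊕ ω)} {W : Op κ} (h : Implements U W)
    (hU : U ∈ Matrix.unitaryGroup (Bits (κ ⊕ ω)) ℂ) :
    Implements U.conjTranspose W.conjTranspose := by
  have hW := h.mem_unitary hU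
  rw [implements_iff] at *
  rw [Matrix.mem_unitaryGroup_iff, Matrix.star_eq_conjTranspose] at hW
  rw [Matrix.mem_unitaryGroup_iff', Matrix.star_eq_conjTranspose] at hU
  calc U.conjTranspose * addWork κ ω
      = U.conjTranspose * (addWork κ ω * W) * W.conjTranspose := by
        rw [Matrix.mul_assoc, Matrix.mul_assoc, hW, Matrix.mul_one]
    _ = (U.conjTranspose * U) * addWork κ ω * W.conjTranspose := by
        rw [← h]; simp only [Matrix.mul_assoc]
    _ = addWork κ ω * W.conjTranspose := by rw [hU, Matrix.one_mul]

theorem implements_embedOp_inl (M : Op κ) :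
    Implements (embedOp (Function.Embedding.inl : κ ↪ κ ⊕ ω) M) M := by
  intro x z y
  have key : (∀ i : κ ⊕ ω, (∀ k, (Function.Embedding.inl : κ ↪ κ ⊕ ω) k ≠ i) →
      Sum.elim x z i = Sum.elim y (fun _ => false) i) ↔ ∀ i, z i = false := by
    simp
  constructor
  · intro hz
    rw [embedOp_of_agree (key.mpr hz)]
    rfl
  · rintro ⟨i, hi⟩
    unfold embedOp
    rw [if_neg]
    rw [key]
    exact fun h => by simp [h i] at hi

theorem Implements.embed {A : Op (κ ⊕ ω)} {M : Op κ} (h : Implements A M) (e : κ ↪ ι) :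
    Implements (embedOp (e.sumMap (Function.Embedding.refl ω)) A) (embedOp e M) := by
  intro x z y
  have key : (∀ i : ι ⊕ ω, (∀ k, (e.sumMap (Function.Embedding.refl ω)) k ≠ i) →
      Sum.elim x z i = Sum.elim y (fun _ => false) i) ↔
      ∀ i : ι, (∀ k, e k ≠ i) → x i = y i := by
    constructor
    · intro H i hi
      apply H (Sum.inl i)
      rintro (k | k) <;> simp [hi]
    · rintro H (i | i) hi
      · exact H i fun k hk => hi (Sum.inl k) (by simp [hk])
      · exact absurd rfl (hi (Sum.inr i))
  have hx : ∀ (x : Bits ι) (z : Bits ω), (Sum.elim x z : Bits (ι ⊕ ω)) ∘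
      (e.sumMap (Function.Embedding.refl ω)) = Sum.elim (x ∘ e) z := fun x z => by
    funext k; cases k <;> rfl
  simp only [embedOp, key, hx]
  constructor
  · intro hz
    rw [(h _ z _).1 hz]
  · intro hz
    rw [(h _ z _).2 hz, ite_self]

/-- `M` is implemented with `w` clean work qubits by at most `k` gates. -/
def ImplBy (w : ℕ) (M : Op κ) (k : ℕ) : Prop :=
  ∃ P : Circuit (κ ⊕ Fin w), Implements P.op M ∧ P.length ≤ k

theorem ImplBy.one {w : ℕ} : ImplBy w (1 : Op κ) 0 := ⟨[], Implements.one, le_rfl⟩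

theorem ImplBy.mul {w : ℕ} {M N : Op κ} {k l : ℕ} (hM : ImplBy w M k) (hN : ImplBy w N l) :
    ImplBy w (M * N) (k + l) := by
  obtain ⟨P, hP, hk⟩ := hM
  obtain ⟨Q, hQ, hl⟩ := hN
  exact ⟨Q ++ P, by rw [Circuit.op_append]; exact hP.mul hQ, by rw [List.length_append]; omega⟩

theorem ImplBy.mono {w : ℕ} {M : Op κ} {k l : ℕ} (hM : ImplBy w M k) (h : k ≤ l) :
    ImplBy w M l := by
  obtain ⟨P, hP, hk⟩ := hM
  exact ⟨P, hP, hk.trans h⟩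

theorem ImplBy.conjTranspose {w : ℕ} {M : Op κ} {k : ℕ} (hM : ImplBy w M k) :
    ImplBy w M.conjTranspose k := by
  obtain ⟨P, hP, hk⟩ := hM
  exact ⟨(P.map TwoQubitGate.inv).reverse, by
    rw [Circuit.op_inv]; exact hP.conjTranspose P.op_mem_unitary, by simpa using hk⟩

theorem HasCircuit.implBy {w : ℕ} {M : Op κ} {k : ℕ} (hM : HasCircuit M k) : ImplBy w M k := by
  obtain ⟨P, rfl, hP⟩ := hM
  exact ⟨P.map (TwoQubitGate.map Function.Embedding.inl), by
    rw [Circuit.op_map]; exact implements_embedOp_inl _, by simpa using hP⟩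

end Implements

/-! ## Substitution of circuits for oracle calls -/

section Queries
variable {d : ℕ} {κ δ ι ω : Type} [Fintype κ] [DecidableEq κ] [Fintype δ] [DecidableEq δ]
  [Fintype ι] [DecidableEq ι] [Fintype ω] [DecidableEq ω]

theorem QueryCircuit.op_append (U : Coeff → Op κ) (V : Bool → Fin d → Op δ)
    (P Q : QueryCircuit d κ δ ι) :
    QueryCircuit.op U V (P ++ Q) = QueryCircuit.op U V Q * QueryCircuit.op U V P := by
  induction P with
  | nil => exact (mul_one _).symm
  | cons g P ih =>
    change QueryCircuit.op U V (P ++ Q) * _ = _ * (QueryCircuit.op U V P * _)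
    rw [ih, mul_assoc]

theorem QueryCircuit.op_singleton (U : Coeff → Op κ) (V : Bool → Fin d → Op δ)
    (g : Instr d κ δ ι) : QueryCircuit.op U V [g] = g.op U V := one_mul _

theorem QueryCircuit.op_gates (U : Coeff → Op κ) (V : Bool → Fin d → Op δ) (P : Circuit ι) :
    QueryCircuit.op U V (P.map Instr.gate : QueryCircuit d κ δ ι) = P.op := by
  induction P with
  | nil => rfl
  | cons g P ih =>
    change QueryCircuit.op U V (P.map Instr.gate) * _ = _
    rw [ih]
    rfl

theorem QueryCircuit.op_expand (U : Coeff → Op κ) (V : Bool → Fin d → Op δ)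
    (FU : CoeffCall → Circuit (Option κ ⊕ ω)) (FV : Bool → Fin d → Circuit (Option δ ⊕ ω))
    (hU : ∀ q, Implements (FU q).op (controlled (coeffCallOp U q)))
    (hV : ∀ fwd μ, Implements (FV fwd μ).op (controlled (V fwd μ)))
    (Q : QueryCircuit d κ δ ι) : Implements (Q.expand FU FV).op (Q.op U V) := by
  induction Q with
  | nil => exact Implements.one
  | cons g Q ih =>
    have h1 : QueryCircuit.expand FU FV (g :: Q) =
        g.expand FU FV ++ QueryCircuit.expand FU FV Q := List.flatMap_cons
    rw [h1, Circuit.op_append]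
    refine ih.mul ?_
    cases g with
    | gate g =>
      simp only [Instr.expand, Circuit.op_cons, Circuit.op_nil, one_mul, TwoQubitGate.op_map]
      exact implements_embedOp_inl _
    | coeff q e =>
      simp only [Instr.expand, Instr.op]
      have h := (hU q).embed e
      rwa [← Circuit.op_map] at h
    | diff fwd μ e =>
      simp only [Instr.expand, Instr.op]
      have h := (hV fwd μ).embed e
      rwa [← Circuit.op_map] at h

end Queries

/-! ## Linear combination of unitaries -/

section LCU
variable {κ ι : Type} [Fintype κ] [DecidableEq κ] [Fintype ι] [DecidableEq ι]

/-- The linear combination of unitaries: `M` is block diagonal with respect to the label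
register. -/
theorem lcu_apply (e : κ ↪ ι) (PL PR : Op κ) (M : Op ι)
    (hM : ∀ x y, x ∘ e ≠ y ∘ e → M x y = 0) {x y : Bits ι}
    (hx : x ∘ e = fun _ => false) (hy : y ∘ e = fun _ => false) :
    (embedOp e PL.conjTranspose * M * embedOp e PR) x y =
      ∑ r, star (PL r fun _ => false) * PR r (fun _ => false) *
        M (Function.extend e r x) (Function.extend e r y) := by
  rw [mul_assoc, embedOp_mul_apply]
  apply Finset.sum_congr rfl
  intro r _
  rw [mul_embedOp_apply, Finset.sum_eq_single r]
  · rw [hx, hy, Matrix.conjTranspose_apply]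
    ring
  · intro s _ hs
    rw [hM, zero_mul]
    rw [extend_comp_self, extend_comp_self]
    exact hs.symm
  · simp

end LCU

/-! ## Gates with many controls -/

section MultiControl
variable {κ ι : Type} [Fintype κ] [DecidableEq κ] [Fintype ι] [DecidableEq ι]

/-- The one-qubit operator `g` on `t`, controlled on the qubits `q.1` being in the states `q.2` for
all `q ∈ l`. -/
def cmux (t : ι) (l : List (ι × Bool)) (g : Matrix Bool Bool ℂ) : Op ι :=
  mux t fun x => if ∀ q ∈ l, x q.1 = q.2 then g else 1

theorem ignores_lits {t : ι} {l : List (ι × Bool)} (hl : ∀ q ∈ l, q.1 ≠ t) (x : Bits ι) (b : Bool) :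
    (∀ q ∈ l, Function.update x t b q.1 = q.2) ↔ ∀ q ∈ l, x q.1 = q.2 :=
  forall₂_congr fun q hq => by rw [Function.update_of_ne (hl q hq)]

theorem rot_half_pi_apply (a b : Bool) :
    rot (Real.pi / 2) a b = if a = b then 0 else if a then 1 else -1 := by
  simp [rot]

/-- The conjunction of the first two controls is computed into a clean work qubit w, which becomes
the first control of a gate with one control fewer, and is then uncomputed. A rotation by π/2
replaces the Toffoli gate, because it sends |0⟩ to |1⟩ without a sign and its inverse undoes this.
Each rung costs two rotations with two controls, 2·12 = 24 gates. Only columns with clean work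
qubits are claimed, which suffices for the induction. -/
theorem exists_ladder {t : ι} {g : Matrix Bool Bool ℂ} (hg : g ∈ Matrix.unitaryGroup Bool ℂ)
    (l : List (ι × Bool)) : ∀ (q₀ : ι × Bool) (ws : List ι), l.length ≤ ws.length → ws.Nodup →
    (∀ w ∈ ws, w ≠ q₀.1 ∧ w ≠ t ∧ ∀ q ∈ l, q.1 ≠ w) → q₀.1 ≠ t → (∀ q ∈ l, q.1 ≠ t) →
    ∃ P : Circuit ι, P.length ≤ 24 * l.length + 1 ∧
      ∀ x y, (∀ w ∈ ws, y w = false) → P.op x y = cmux t (q₀ :: l) g x y := by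
  induction l with
  | nil =>
    intro q₀ ws _ _ _ h₀ _
    obtain ⟨P, hP, hk⟩ := hasCircuit_mux_pair (G := fun b => if b = q₀.2 then g else 1) h₀.symm
      fun b => by
        split_ifs
        · exact hg
        · exact one_mem _
    exact ⟨P, by simpa using hk, fun x y _ => by rw [hP]; simp [cmux]⟩
  | cons l₀ l ih =>
    intro q₀ ws hlen hnd hdis h₀ hl
    obtain _ | ⟨w, ws⟩ := ws
    · simp at hlen
    obtain ⟨hw, hnd⟩ := List.nodup_cons.mp hnd
    obtain ⟨hwq, hwt, hwl⟩ := hdis w (by simp)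
    obtain ⟨P, hPk, hP⟩ := ih (w, true) ws (by simpa using hlen) hnd
      (fun w' hw' => ⟨fun h => hw (by simpa [h] using hw'), (hdis w' (by simp [hw'])).2.1,
        fun q hq => (hdis w' (by simp [hw'])).2.2 q (by simp [hq])⟩) hwt
      (fun q hq => hl q (by simp [hq]))
    have hl₀w : l₀.1 ≠ w := hwl l₀ (by simp)
    have hl₀t : l₀.1 ≠ t := hl l₀ (by simp)
    let θ : Bits ι → ℝ := fun x => if x q₀.1 = q₀.2 ∧ x l₀.1 = l₀.2 then Real.pi / 2 else 0
    have hθ : DependsOn θ {i | i ∈ [q₀.1, l₀.1]} := fun x y h => by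
      have h1 := h q₀.1 (by simp)
      have h2 := h l₀.1 (by simp)
      simp only [θ, h1, h2]
    have hθn : DependsOn (fun x => -θ x) {i | i ∈ [q₀.1, l₀.1]} := fun x y h =>
      congrArg Neg.neg (hθ h)
    have hwS : w ∉ [q₀.1, l₀.1] := by simp [hwq, hl₀w.symm]
    have : Nontrivial ι := ⟨w, t, hwt⟩
    obtain ⟨R, hR, hRk⟩ := hasCircuit_mux_rot [q₀.1, l₀.1] hwS hθ
    obtain ⟨R', hR', hRk'⟩ := hasCircuit_mux_rot [q₀.1, l₀.1] hwS hθn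
    refine ⟨R ++ P ++ R', ?_, ?_⟩
    · simp only [List.length_append, List.length_cons, List.length_nil] at *
      norm_num at hRk hRk'
      omega
    intro x y hy
    have hyw : y w = false := hy w (by simp)
    rw [Circuit.op_append, Circuit.op_append, hR, hR',
      mux_mul_apply ((ignores_of_dependsOn hθn (by simpa using hwS)).comp rot)]
    let c : Bits ι → Bool := fun x => decide (x q₀.1 = q₀.2 ∧ x l₀.1 = l₀.2)
    -- On a column with w = 0 the first rotation is classical: it writes the conjunction c y into w.
    have hcol : ∀ x', (P.op * mux w fun x => rot (θ x)) x' y =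
        P.op x' (Function.update y w (c y)) := fun x' => by
      rw [mul_mux_apply, Fintype.sum_bool, hyw]
      by_cases hc : y q₀.1 = q₀.2 ∧ y l₀.1 = l₀.2
      · simp only [θ, c, if_pos hc, rot_half_pi_apply, decide_eq_true hc]
        simp
      · simp only [θ, c, if_neg hc, rot_zero, decide_eq_false hc]
        simp
    have hclean : ∀ w' ∈ ws, Function.update y w (c y) w' = false := fun w' hw' => by
      have hne : w' ≠ w := fun h => hw (h ▸ hw')
      rw [Function.update_of_ne hne]
      exact hy w' (by simp [hw'])
    simp only [hcol, hP _ _ hclean]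
    simp only [cmux, mux]
    have hlits : (∀ q ∈ (w, true) :: l, Function.update y w (c y) q.1 = q.2) ↔
        ∀ q ∈ q₀ :: l₀ :: l, y q.1 = q.2 := by
      have hl' : ∀ q ∈ l, q.1 ≠ w := fun q hq => hwl q (by simp [hq])
      simp only [List.forall_mem_cons, Function.update_self]
      rw [ignores_lits hl' y (c y)]
      simp [c, and_assoc]
    simp only [hlits, Function.update_of_ne hwt.symm]
    -- If x and y differ off t and w, both sides vanish. Otherwise the two controls, being neither t
    -- nor w, agree in x and y, so the last rotation has the opposite angle of the first and returns
    -- w to 0.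
    by_cases hag : ∀ i, i ≠ t → i ≠ w → x i = y i
    · have hb : ∀ b : Bool, (∀ i, i ≠ t → Function.update x w b i = Function.update y w (c y) i) ↔
          b = c y := fun b => by
        constructor
        · intro h
          simpa using h w hwt
        · rintro rfl i hi
          by_cases hiw : i = w
          · subst hiw; simp
          · simp [hiw, hag i hi hiw]
      have hθxy : θ x = θ y := by
        simp only [θ, hag _ h₀ hwq.symm, hag _ hl₀t hl₀w]
      have hxy : (∀ i, i ≠ t → x i = y i) ↔ x w = false := by
        constructor
        · intro h
          rw [h w hwt, hyw]
        · intro h i hi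
          by_cases hiw : i = w
          · subst hiw; rw [h, hyw]
          · exact hag i hi hiw
      simp only [hb, hxy, hθxy]
      by_cases hc : y q₀.1 = q₀.2 ∧ y l₀.1 = l₀.2
      · have h1 : c y = true := by simp [c, hc]
        have h2 : -θ y = -(Real.pi / 2) := by simp only [θ, if_pos hc]
        rw [h1, h2, ← rot_conjTranspose]
        simp only [Matrix.conjTranspose_apply, rot_half_pi_apply, Fintype.sum_bool]
        cases x w <;> simp
      · have h1 : c y = false := by simp only [c, decide_eq_false hc]
        have h2 : -θ y = 0 := by simp only [θ, if_neg hc, neg_zero]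
        rw [h1, h2, rot_zero]
        simp only [Fintype.sum_bool, Matrix.one_apply]
        cases x w <;> simp
    · have h1 : ¬ ∀ i, i ≠ t → x i = y i := fun h => hag fun i hi _ => h i hi
      have h2 : ∀ b : Bool, ¬ ∀ i, i ≠ t → Function.update x w b i =
          Function.update y w (c y) i := fun b h => hag fun i hi hiw => by
        simpa [hiw] using h i hi
      simp [h1, h2]

theorem implBy_cmux {t : ι} {g : Matrix Bool Bool ℂ} (hg : g ∈ Matrix.unitaryGroup Bool ℂ)
    {w : ℕ} (q₀ : ι × Bool) (l : List (ι × Bool)) (hlen : l.length ≤ w)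
    (hl : ∀ q ∈ q₀ :: l, q.1 ≠ t) : ImplBy w (cmux t (q₀ :: l) g) (24 * l.length + 1) := by
  let up : ι × Bool → (ι ⊕ Fin w) × Bool := fun q => (Sum.inl q.1, q.2)
  obtain ⟨P, hPk, hP⟩ := exists_ladder (t := (Sum.inl t : ι ⊕ Fin w)) hg (l.map up) (up q₀)
    ((List.finRange w).map Sum.inr) (by simpa using hlen)
    ((List.nodup_finRange w).map Sum.inr_injective) (by simp [up])
    (by simpa [up] using hl q₀ (by simp)) (by
      simp only [List.mem_map, forall_exists_index, and_imp, forall_apply_eq_imp_iff₂, up]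
      intro q hq
      simpa using hl q (by simp [hq]))
  refine ⟨P, ?_, by simpa using hPk⟩
  have hemb : cmux (Sum.inl t : ι ⊕ Fin w) (up q₀ :: l.map up) g =
      embedOp Function.Embedding.inl (cmux t (q₀ :: l) g) := by
    rw [cmux, cmux, embedOp_mux]
    simp only [List.forall_mem_cons, List.forall_mem_map, up]
    rfl
  intro x z y
  rw [hP _ _ (by simp), hemb]
  exact implements_embedOp_inl (cmux t (q₀ :: l) g) x z y

/-- A one-qubit gate with controls. -/
structure MCGate (ι : Type) where
  target : ι
  lits : List (ι × Bool)
  mat : Matrix Bool Bool ℂ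

/-- The gate is unitary, and its controls differ from its target. -/
def MCGate.Valid (g : MCGate ι) : Prop :=
  g.mat ∈ Matrix.unitaryGroup Bool ℂ ∧ ∀ q ∈ g.lits, q.1 ≠ g.target

/-- The operator of a gate with controls. -/
def MCGate.op (g : MCGate ι) : Op ι := cmux g.target g.lits g.mat

/-- The operator of a list of gates with controls, applied from left to right. -/
def mcOp (G : List (MCGate ι)) : Op ι := G.foldr (fun g M => M * g.op) 1

/-- Add controls to a gate. -/
def MCGate.addLits (ls : List (ι × Bool)) (g : MCGate ι) : MCGate ι where
  target := g.target
  lits := ls ++ g.lits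
  mat := g.mat

theorem mcOp_nil : mcOp ([] : List (MCGate ι)) = 1 := rfl

theorem mcOp_cons (g : MCGate ι) (G : List (MCGate ι)) : mcOp (g :: G) = mcOp G * g.op := rfl

theorem mcOp_append (G H : List (MCGate ι)) : mcOp (G ++ H) = mcOp H * mcOp G := by
  induction G with
  | nil => simp [mcOp_nil]
  | cons g G ih => rw [List.cons_append, mcOp_cons, mcOp_cons, ih, mul_assoc]

/-- No gate of the list targets an added control, so the controls keep their values throughout and
the list acts either in full or not at all. Hence the condition can be read off the column y. -/
theorem mcOp_addLits (ls : List (ι × Bool)) (G : List (MCGate ι))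
    (h : ∀ g ∈ G, ∀ q ∈ ls, q.1 ≠ g.target) (x y : Bits ι) :
    mcOp (G.map (MCGate.addLits ls)) x y =
      if ∀ q ∈ ls, y q.1 = q.2 then mcOp G x y else (1 : Op ι) x y := by
  induction G generalizing y with
  | nil => rw [List.map_nil, mcOp_nil, ite_self]
  | cons g G ih =>
    have hg := h g (by simp)
    have hgate : (g.addLits ls).op = mux g.target fun z =>
        if ∀ q ∈ ls, z q.1 = q.2 then (if ∀ q ∈ g.lits, z q.1 = q.2 then g.mat else 1) else 1 := by
      rw [MCGate.op, cmux]
      congr 1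
      funext z
      have : (∀ q ∈ (g.addLits ls).lits, z q.1 = q.2) ↔
          (∀ q ∈ ls, z q.1 = q.2) ∧ ∀ q ∈ g.lits, z q.1 = q.2 := List.forall_mem_append
      rw [if_congr this rfl rfl, ite_and]
      rfl
    rw [List.map_cons, mcOp_cons, mcOp_cons, hgate, mul_mux_apply]
    have ih' := fun z => ih (fun g' hg' => h g' (by simp [hg'])) z
    by_cases hc : ∀ q ∈ ls, y q.1 = q.2
    · rw [if_pos hc, if_pos hc, MCGate.op, cmux, mul_mux_apply]
      apply Finset.sum_congr rfl
      intro b _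
      rw [ih', if_pos ((ignores_lits hg y b).mpr hc)]
    · have h1 : (1 : Op ι) x y = ((1 : Op ι) * mux g.target fun _ => 1) x y := by
        rw [mux_one, one_mul]
      rw [if_neg hc, if_neg hc, h1, mul_mux_apply]
      apply Finset.sum_congr rfl
      intro b _
      rw [ih', if_neg ((ignores_lits hg y b).not.mpr hc)]

/-- The outer control serves as the first control of the ladder, so a gate with at most m controls
of its own needs m rungs and m work qubits, and these are clean again for the next gate. -/
theorem implBy_controlled_mcOp {w m : ℕ} (G : List (MCGate ι)) (hv : ∀ g ∈ G, g.Valid)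
    (hm : ∀ g ∈ G, g.lits.length ≤ m) (hmw : m ≤ w) :
    ImplBy w (controlled (mcOp G)) (G.length * (24 * m + 1)) := by
  induction G with
  | nil => rw [mcOp_nil, controlled_one]; exact ImplBy.one.mono (by simp)
  | cons g G ih =>
    rw [mcOp_cons, controlled_mul]
    have h1 : controlled g.op = cmux (some g.target)
        ((none, true) :: g.lits.map fun q => (some q.1, q.2)) g.mat := by
      rw [MCGate.op, cmux, controlled_mux, cmux]
      congr 1
      funext x
      simp only [List.forall_mem_cons, List.forall_mem_map]
      by_cases hx : x none = true
      · simp [hx]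
      · simp [hx]
    have hk := hm g (by simp)
    have h2 : ImplBy w (controlled g.op) (24 * m + 1) := by
      rw [h1]
      refine (implBy_cmux (hv g (by simp)).1 _ _ (by simpa using hk.trans hmw) ?_).mono
        (by simpa using hk)
      simp only [List.forall_mem_cons, List.forall_mem_map]
      exact ⟨by simp, fun q hq => by simpa using (hv g (by simp)).2 q hq⟩
    refine ((ih (fun g' hg' => hv g' (by simp [hg'])) fun g' hg' => hm g' (by simp [hg'])).mul
      h2).mono (le_of_eq ?_)
    rw [List.length_cons]
    ring

end MultiControl

/-! ## Binary numbers -/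

theorem bitsVal_succ {m : ℕ} (x : Bits (Fin (m + 1))) :
    bitsVal x = (if x 0 then 1 else 0) + 2 * bitsVal fun i => x i.succ := by
  unfold bitsVal
  rw [Fin.sum_univ_succ, Finset.mul_sum]
  congr 1
  apply Finset.sum_congr rfl
  intro i _
  rw [Fin.val_succ, pow_succ]
  split_ifs <;> ring

theorem bitsVal_lt {m : ℕ} (x : Bits (Fin m)) : bitsVal x < 2 ^ m := by
  induction m with
  | zero => simp [bitsVal]
  | succ m ih =>
    have := ih fun i => x i.succ
    rw [bitsVal_succ, pow_succ]
    split_ifs <;> omega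

theorem bitsVal_injective {m : ℕ} : Function.Injective (bitsVal (m := m)) := by
  induction m with
  | zero => intro x y _; funext i; exact i.elim0
  | succ m ih =>
    intro x y h
    rw [bitsVal_succ, bitsVal_succ] at h
    have h0 : x 0 = y 0 := by
      cases hx : x 0 <;> cases hy : y 0 <;> simp [hx, hy] at h ⊢ <;> omega
    have h1 : (fun i : Fin m => x i.succ) = fun i => y i.succ := ih (by rw [h0] at h; omega)
    funext i
    refine Fin.cases h0 (fun i => congrFun h1 i) i

theorem exists_bitsVal {m : ℕ} : ∀ {v : ℕ}, v < 2 ^ m → ∃ x : Bits (Fin m), bitsVal x = v := by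
  induction m with
  | zero =>
    intro v hv
    exact ⟨fun _ => false, by simp at hv; simp [bitsVal, hv]⟩
  | succ m ih =>
    intro v hv
    obtain ⟨y, hy⟩ := ih (v := v / 2) (by rw [pow_succ] at hv; omega)
    refine ⟨Fin.cons (decide (v % 2 = 1)) y, ?_⟩
    rw [bitsVal_succ]
    simp only [Fin.cons_zero, Fin.cons_succ, hy, decide_eq_true_eq]
    split_ifs <;> omega

/-! ## Coefficient oracles -/

section Fourier
variable {d n K : ℕ}

/-- The labels with all entries at most 2K correspond one to one to the multi-indices with entries
between -K and K, because 2K+1 values fit into ⌈log₂(2K+1)⌉ bits. -/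
theorem sum_freq {E : Type*} [AddCommMonoid E] (f : (Fin d → ℤ) → E) :
    ∑ r : Bits (FourierAnc d K), (if ∀ μ, freqIndex r μ ≤ 2 * K then f (freq r) else 0) =
      ∑ k ∈ degreeBox d K, f k := by
  rw [← Finset.sum_filter]
  apply Finset.sum_bij fun (r : Bits (FourierAnc d K)) _ => (freq r : Fin d → ℤ)
  · intro r hr
    simp only [Finset.mem_filter, Finset.mem_univ, true_and] at hr
    simp only [degreeBox, Fintype.mem_piFinset, Finset.mem_Icc, freq]
    intro μ
    have := hr μ
    omega
  · intro r _ s _ h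
    have h1 : ∀ μ, (fun i => r (μ, i)) = fun i => s (μ, i) := fun μ => by
      have := congrFun h μ
      simp only [freq, freqIndex] at this
      exact bitsVal_injective (by omega)
    funext ⟨μ, i⟩
    exact congrFun (h1 μ) i
  · intro k hk
    simp only [degreeBox, Fintype.mem_piFinset, Finset.mem_Icc] at hk
    have hb : 2 * K + 1 ≤ 2 ^ Nat.clog 2 (2 * K + 1) := Nat.le_pow_clog (by norm_num) _
    have : ∀ μ, ∃ x : Bits (Fin (Nat.clog 2 (2 * K + 1))), bitsVal x = (k μ + K).toNat :=
      fun μ => exists_bitsVal (by have := hk μ; omega)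
    choose x hx using this
    have hi : ∀ μ, freqIndex (K := K) (fun q : FourierAnc d K => x q.1 q.2) μ = (k μ + K).toNat :=
      hx
    refine ⟨fun q => x q.1 q.2, ?_, ?_⟩
    · simp only [Finset.mem_filter, Finset.mem_univ, true_and]
      intro μ
      have := hk μ
      have := hi μ
      omega
    · funext μ
      have := hk μ
      have := hi μ
      simp only [freq]
      omega
  · intro r _
    rfl

theorem two_le_clog (hK : 1 ≤ K) : 2 ≤ Nat.clog 2 (2 * K + 1) := by
  by_contra h
  have h1 : 2 * K + 1 ≤ 2 ^ Nat.clog 2 (2 * K + 1) := Nat.le_pow_clog (by norm_num) _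
  have h2 : 2 ^ Nat.clog 2 (2 * K + 1) ≤ 2 ^ 1 := Nat.pow_le_pow_right (by norm_num) (by omega)
  omega

/-- 2K+1 is odd and exceeds 1, so it is not a power of two, and the value 2K+1 still fits into the
register. This is the spare label that `exists_prep_pair` requires. -/
theorem exists_unused_label (hd : 0 < d) (hK : 1 ≤ K) :
    ∃ r : Bits (FourierAnc d K), ¬ ∀ μ, freqIndex r μ ≤ 2 * K := by
  have h1 : 2 * K + 1 ≤ 2 ^ Nat.clog 2 (2 * K + 1) := Nat.le_pow_clog (by norm_num) _
  have h2 : 2 * K + 1 < 2 ^ Nat.clog 2 (2 * K + 1) := by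
    obtain ⟨b, hb⟩ : ∃ b, Nat.clog 2 (2 * K + 1) = b + 1 :=
      ⟨Nat.clog 2 (2 * K + 1) - 1, by have := two_le_clog hK; omega⟩
    have h3 : 2 ^ Nat.clog 2 (2 * K + 1) = 2 ^ b * 2 := by rw [hb, pow_succ]
    omega
  obtain ⟨x, hx⟩ := exists_bitsVal h2
  refine ⟨fun q => x q.2, fun h => ?_⟩
  have h3 : freqIndex (K := K) (fun q : FourierAnc d K => x q.2) ⟨0, hd⟩ = 2 * K + 1 := hx
  have := h ⟨0, hd⟩
  omega

theorem nontrivial_fourierAnc (hd : 0 < d) (hK : 1 ≤ K) : Nontrivial (FourierAnc d K) := by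
  have := two_le_clog hK
  exact ⟨⟨(⟨0, hd⟩, ⟨0, by omega⟩), (⟨0, hd⟩, ⟨1, by omega⟩), by simp⟩⟩

theorem hasCtrlCircuit_phaseOp_sum {ι β : Type} [Fintype ι] [DecidableEq ι] {k : ℕ}
    (s : Finset β) (φ : β → Bits ι → ℝ) (h : ∀ i ∈ s, HasCtrlCircuit (phaseOp (φ i)) k) :
    HasCtrlCircuit (phaseOp fun x => ∑ i ∈ s, φ i x) (s.card * k) := by
  classical
  induction s using Finset.induction_on with
  | empty => simpa [phaseOp_zero] using HasCtrlCircuit.one (κ := ι)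
  | insert i s hi ih =>
    have : (fun x => ∑ j ∈ insert i s, φ j x) = fun x => φ i x + ∑ j ∈ s, φ j x :=
      funext fun x => Finset.sum_insert hi
    rw [this, phaseOp_add, Finset.card_insert_of_notMem hi]
    refine ((h i (by simp)).mul (ih fun j hj => h j (by simp [hj]))).mono (le_of_eq (by ring))

theorem bitsVal_cast {m : ℕ} (x : Bits (Fin m)) :
    (bitsVal x : ℝ) = ∑ i : Fin m, if x i then (2 : ℝ) ^ (i : ℕ) else 0 := by
  unfold bitsVal
  push_cast
  rfl

/-- The two-body terms of the phase of the Fourier modes. -/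
noncomputable def modePhase (G : Grid d) (n K : ℕ)
    (q : Fin d × Fin (Nat.clog 2 (2 * K + 1)) × Fin (n / d))
    (x : Bits (Sys d n ⊕ FourierAnc d K)) : ℝ :=
  2 * Real.pi / G.period q.1 *
    ((if x (Sum.inr (q.1, q.2.1)) then (2 : ℝ) ^ (q.2.1 : ℕ) else 0) -
      K / (Nat.clog 2 (2 * K + 1) : ℕ)) *
    (G.spacing q.1 * (if x (Sum.inl (q.1, q.2.2)) then (2 : ℝ) ^ (q.2.2 : ℕ) else 0) +
      G.origin q.1 / (n / d : ℕ))

/-- k_μ is a weighted sum of digits minus K, and x_μ is a weighted sum of digits plus the origin.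
Each constant is spread evenly over the digits of its register, so the product of the two sums
expands into terms with exactly one ancilla digit and one system digit. This is where both registers
must be nonempty. -/
theorem fourierSelect_eq_phaseOp (hK : 1 ≤ K) (hm : 0 < n / d) (G : Grid d) :
    (fourierSelect G : Op (Sys d n ⊕ FourierAnc d K)) =
      phaseOp fun x => ∑ q, modePhase G n K q x := by
  unfold fourierSelect phaseOp
  congr 1
  funext x
  unfold fourierMode
  congr 1
  have hb : ((Nat.clog 2 (2 * K + 1) : ℕ) : ℝ) ≠ 0 := by
    have := two_le_clog hK
    exact_mod_cast (by omega : Nat.clog 2 (2 * K + 1) ≠ 0)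
  have hm' : ((n / d : ℕ) : ℝ) ≠ 0 := by exact_mod_cast hm.ne'
  have key : ∑ q, modePhase G n K q x = 2 * Real.pi * ∑ μ, ((freq (x ∘ Sum.inr) μ : ℤ) : ℝ) *
      G.point (x ∘ Sum.inl) μ / G.period μ := by
    rw [Fintype.sum_prod_type, Finset.mul_sum]
    apply Finset.sum_congr rfl
    intro μ _
    rw [Fintype.sum_prod_type]
    simp only [modePhase]
    simp only [← Finset.mul_sum, ← Finset.sum_mul]
    have h1 : ∑ i : Fin (Nat.clog 2 (2 * K + 1)),
        ((if x (Sum.inr (μ, i)) then (2 : ℝ) ^ (i : ℕ) else 0) - K / (Nat.clog 2 (2 * K + 1) : ℕ)) =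
        ((freq (x ∘ Sum.inr) μ : ℤ) : ℝ) := by
      rw [Finset.sum_sub_distrib]
      simp only [freq, freqIndex]
      push_cast
      rw [bitsVal_cast]
      simp only [Finset.sum_const, Finset.card_univ, Fintype.card_fin, nsmul_eq_mul,
        Function.comp_apply]
      rw [mul_div_cancel₀ _ hb]
    have h2 : ∑ j : Fin (n / d), (G.spacing μ * (if x (Sum.inl (μ, j)) then (2 : ℝ) ^ (j : ℕ) else 0)
        + G.origin μ / (n / d : ℕ)) = G.point (x ∘ Sum.inl) μ := by
      rw [Finset.sum_add_distrib, ← Finset.mul_sum]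
      simp only [Grid.point, axisIndex]
      rw [bitsVal_cast]
      simp only [Finset.sum_const, Finset.card_univ, Fintype.card_fin, nsmul_eq_mul,
        Function.comp_apply]
      rw [mul_div_cancel₀ _ hm', add_comm]
    rw [h1, h2]
    ring
  beta_reduce
  rw [key]
  push_cast
  ring

theorem hasCtrlCircuit_fourierSelect (hd : 0 < d) (hK : 1 ≤ K) (hm : 0 < n / d) (G : Grid d) :
    HasCtrlCircuit (fourierSelect G : Op (Sys d n ⊕ FourierAnc d K))
      (32 * (d * Nat.clog 2 (2 * K + 1) * (n / d))) := by
  have := nontrivial_fourierAnc hd hK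
  obtain ⟨a, b, hab⟩ := this
  have : Nontrivial (Sys d n ⊕ FourierAnc d K) := ⟨Sum.inr a, Sum.inr b, by simpa using hab⟩
  rw [fourierSelect_eq_phaseOp hK hm]
  -- Each term depends on two qubits: 8·2² = 32 gates, control included.
  refine (hasCtrlCircuit_phaseOp_sum (k := 32) _ _ fun q _ => ?_).mono ?_
  · refine (hasCtrlCircuit_phaseOp [Sum.inr (q.1, q.2.1), Sum.inl (q.1, q.2.2)]
      fun x y h => ?_).mono (by simp)
    have h1 := h (Sum.inr (q.1, q.2.1)) (by simp)
    have h2 := h (Sum.inl (q.1, q.2.2)) (by simp)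
    simp only [modePhase, h1, h2]
  · simp only [Finset.card_univ, Fintype.card_prod, Fintype.card_fin]
    exact le_of_eq (by ring)

/-- The preparation pair is taken for c/α, so the zero block is the series divided by α. The cost is
two preparations, 2·14 = 28 times the dimension of the ancilla space, plus SELECT. -/
theorem exists_coeff_oracle (hd : 0 < d) (hK : 1 ≤ K) (hm : 0 < n / d) (G : Grid d) {α : ℝ}
    (hα : 0 < α) (c : (Fin d → ℤ) → ℂ) (hc : ∑ k ∈ degreeBox d K, ‖c k‖ ≤ α) :
    ∃ U : Op (Sys d n ⊕ FourierAnc d K), IsLCUFourier G α c U ∧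
      (zeroBlock U = Matrix.diagonal fun s => fourierSeries G K c (G.point s) / (α : ℂ)) ∧
      HasCtrlCircuit U (28 * 2 ^ (d * Nat.clog 2 (2 * K + 1)) +
        32 * (d * Nat.clog 2 (2 * K + 1) * (n / d))) := by
  have := nontrivial_fourierAnc hd hK
  obtain ⟨r₀, hr₀⟩ := exists_unused_label hd hK
  have hα' : (α : ℂ) ≠ 0 := by exact_mod_cast hα.ne'
  let c' : Bits (FourierAnc d K) → ℂ := fun r =>
    (if ∀ μ, freqIndex r μ ≤ 2 * K then c (freq r) else 0) / α
  have hc' : ∑ r, ‖c' r‖ ≤ 1 := by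
    have h1 : ∀ r, ‖c' r‖ = (if ∀ μ, freqIndex r μ ≤ 2 * K then ‖c (freq r)‖ else 0) / α :=
      fun r => by
        simp only [c', norm_div, Complex.norm_real, Real.norm_eq_abs, abs_of_pos hα]
        split_ifs <;> simp
    rw [Finset.sum_congr rfl fun r _ => h1 r, ← Finset.sum_div, sum_freq fun k => ‖c k‖,
      div_le_one hα]
    exact hc
  obtain ⟨PL, PR, hPL, hPR, hP⟩ := exists_prep_pair c' hc' (r₀ := r₀)
    (by simp only [c', if_neg hr₀, zero_div])
  refine ⟨embedOp Function.Embedding.inr PL.conjTranspose * fourierSelect G *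
    embedOp Function.Embedding.inr PR, ⟨PL, hPL.1.mem_unitary, PR, hPR.1.mem_unitary, fun r => ?_,
    rfl⟩, ?_, ?_⟩
  · rw [hP]
    simp only [c']
    rw [mul_div_cancel₀ _ hα']
  · ext s t
    simp only [zeroBlock]
    rw [lcu_apply _ _ _ _ _ (by rfl) (by rfl)]
    · have hx : ∀ (r : Bits (FourierAnc d K)) (s : Bits (Sys d n)),
          Function.extend (Function.Embedding.inr : FourierAnc d K ↪ Sys d n ⊕ FourierAnc d K) r
            (Sum.elim s fun _ => false) = Sum.elim s r := fun r s => by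
        funext i
        rcases i with i | i
        · rw [extend_off]
          · rfl
          · simp
        · exact Function.Embedding.inr.injective.extend_apply _ _ i
      have hst : ∀ r : Bits (FourierAnc d K), (Sum.elim s r : Bits (Sys d n ⊕ FourierAnc d K)) =
          Sum.elim t r ↔ s = t := fun r => by
        rw [Sum.elim_eq_iff]
        simp
      simp only [hP, hx, fourierSelect, Matrix.diagonal_apply, hst]
      split_ifs with h
      · rw [fourierSeries, Finset.sum_div, ← sum_freq]
        apply Finset.sum_congr rfl
        intro r _
        simp only [c', Sum.elim_comp_inl, Sum.elim_comp_inr]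
        split_ifs
        · ring
        · simp
      · simp
    · intro x y hxy
      rw [fourierSelect, Matrix.diagonal_apply_ne]
      exact fun h => hxy (by rw [h])
  · refine (((hPL.conjTranspose.embedOp _).mul (hasCtrlCircuit_fourierSelect hd hK hm G)).mul
      (hPR.embedOp _)).mono ?_
    simp only [Fintype.card_prod, Fintype.card_fin]
    omega

end Fourier

/-! ## Spectral norm -/

section SpecNorm
open scoped Matrix.Norms.L2Operator
variable {m : Type} [Fintype m] [DecidableEq m]

theorem specNorm_eq_norm (M : Matrix m m ℂ) : specNorm M = ‖M‖ := rfl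

theorem specNorm_nonneg (M : Matrix m m ℂ) : 0 ≤ specNorm M := norm_nonneg _

theorem specNorm_zero : specNorm (0 : Matrix m m ℂ) = 0 := norm_zero (E := Matrix m m ℂ)

theorem specNorm_add_le (M N : Matrix m m ℂ) : specNorm (M + N) ≤ specNorm M + specNorm N :=
  norm_add_le M N

theorem specNorm_sum_le {β : Type*} (s : Finset β) (M : β → Matrix m m ℂ) :
    specNorm (∑ i ∈ s, M i) ≤ ∑ i ∈ s, specNorm (M i) := norm_sum_le s M

theorem specNorm_neg (M : Matrix m m ℂ) : specNorm (-M) = specNorm M := norm_neg M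

theorem specNorm_mul_le (M N : Matrix m m ℂ) : specNorm (M * N) ≤ specNorm M * specNorm N :=
  Matrix.l2_opNorm_mul M N

theorem specNorm_smul (c : ℂ) (M : Matrix m m ℂ) : specNorm (c • M) = ‖c‖ * specNorm M :=
  norm_smul c M

theorem specNorm_conjTranspose (M : Matrix m m ℂ) : specNorm M.conjTranspose = specNorm M :=
  Matrix.l2_opNorm_conjTranspose M

theorem specNorm_diagonal_le {v : m → ℂ} {c : ℝ} (hc : 0 ≤ c) (h : ∀ i, ‖v i‖ ≤ c) :
    specNorm (Matrix.diagonal v) ≤ c := by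
  rw [specNorm_eq_norm, Matrix.l2_opNorm_diagonal]
  exact (pi_norm_le_iff_of_nonneg hc).mpr h

theorem norm_toLp_sq (v : m → ℂ) : ‖WithLp.toLp 2 v‖ ^ 2 = ∑ i, ‖v i‖ ^ 2 :=
  EuclideanSpace.norm_sq_eq _

theorem specNorm_le_of_sq {M : Matrix m m ℂ} {c : ℝ} (hc : 0 ≤ c)
    (h : ∀ v : m → ℂ, ∑ i, ‖(M.mulVec v) i‖ ^ 2 ≤ c ^ 2 * ∑ i, ‖v i‖ ^ 2) : specNorm M ≤ c := by
  refine ContinuousLinearMap.opNorm_le_bound _ hc fun x => ?_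
  have h1 := h x.ofLp
  rw [← norm_toLp_sq, ← norm_toLp_sq, ← mul_pow] at h1
  exact le_of_sq_le_sq h1 (by positivity)

theorem sum_sq_mulVec_le (M : Matrix m m ℂ) (v : m → ℂ) :
    ∑ i, ‖(M.mulVec v) i‖ ^ 2 ≤ specNorm M ^ 2 * ∑ i, ‖v i‖ ^ 2 := by
  rw [← norm_toLp_sq, ← norm_toLp_sq, ← mul_pow]
  gcongr
  exact Matrix.l2_opNorm_mulVec M (WithLp.toLp 2 v)

theorem specNorm_le_one_of_mem_unitary {M : Matrix m m ℂ} (h : M ∈ Matrix.unitaryGroup m ℂ) :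
    specNorm M ≤ 1 := by
  have h1 := Matrix.l2_opNorm_conjTranspose_mul_self M
  rw [← Matrix.star_eq_conjTranspose, Matrix.mem_unitaryGroup_iff'.mp h] at h1
  have h2 : specNorm (1 : Matrix m m ℂ) ≤ 1 := by
    rw [← Matrix.diagonal_one]
    exact specNorm_diagonal_le zero_le_one fun i => by simp
  rw [specNorm_eq_norm] at *
  nlinarith [norm_nonneg M]

end SpecNorm

section ZeroBlock
variable {σ τ : Type} [Fintype σ] [DecidableEq σ] [Fintype τ] [DecidableEq τ]

/-- The zero block is a compression: padding a vector by zeros preserves its norm, and dropping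
components does not increase it. -/
theorem specNorm_zeroBlock_le (U : Op (σ ⊕ τ)) : specNorm (zeroBlock U) ≤ specNorm U := by
  refine specNorm_le_of_sq (specNorm_nonneg _) fun v => ?_
  have hinj : Function.Injective fun x : Bits σ => (Sum.elim x fun _ => false : Bits (σ ⊕ τ)) :=
    fun x y h => by simpa [Sum.elim_eq_iff] using h
  let w : Bits (σ ⊕ τ) → ℂ := fun x => if ∀ i, x (Sum.inr i) = false then v (x ∘ Sum.inl) else 0
  have hw : ∀ x : Bits σ, w (Sum.elim x fun _ => false) = v x := fun x => by simp [w]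
  have hw0 : ∀ x, x ∉ Set.range (fun x : Bits σ => (Sum.elim x fun _ => false : Bits (σ ⊕ τ))) →
      w x = 0 := fun x hx => if_neg fun h => hx ⟨x ∘ Sum.inl, by
    funext i
    rcases i with i | i
    · rfl
    · exact (h i).symm⟩
  have h1 : ∑ x, ‖v x‖ ^ 2 = ∑ x, ‖w x‖ ^ 2 :=
    Fintype.sum_of_injective _ hinj _ _ (fun x hx => by rw [hw0 x hx]; simp) fun x => by rw [hw]
  have h2 : ∀ x : Bits σ, (zeroBlock U).mulVec v x = U.mulVec w (Sum.elim x fun _ => false) :=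
    fun x => by
      simp only [Matrix.mulVec, dotProduct]
      exact Fintype.sum_of_injective _ hinj _ _ (fun x hx => by rw [hw0 x hx, mul_zero]) fun x => by
        rw [hw]; rfl
  rw [h1]
  refine le_trans ?_ (sum_sq_mulVec_le U w)
  simp only [h2]
  calc _ = ∑ x ∈ Finset.univ.map ⟨_, hinj⟩, ‖U.mulVec w x‖ ^ 2 := by
        rw [Finset.sum_map]; rfl
    _ ≤ _ := Finset.sum_le_sum_of_subset_of_nonneg (Finset.subset_univ _) fun _ _ _ => by positivity

end ZeroBlock

/-! ## Singular value decomposition of a contraction -/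

/-- Diagonalize B†B by V. The columns of C = BV are then orthogonal, with the eigenvalues as squared
norms. Normalizing the nonzero columns and completing them to an orthonormal basis gives U. The
singular values are at most 1 because C is a contraction. -/
theorem exists_svd {m : Type} [Fintype m] [DecidableEq m] (B : Matrix m m ℂ)
    (hB : specNorm B ≤ 1) :
    ∃ U ∈ Matrix.unitaryGroup m ℂ, ∃ V ∈ Matrix.unitaryGroup m ℂ, ∃ σ : m → ℝ,
      (∀ i, 0 ≤ σ i ∧ σ i ≤ 1) ∧
      B = U * Matrix.diagonal (fun i => (σ i : ℂ)) * V.conjTranspose := by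
  have hH := Matrix.isHermitian_conjTranspose_mul_self B
  set V : Matrix m m ℂ := (hH.eigenvectorUnitary : Matrix m m ℂ) with hV
  have hVu : V ∈ Matrix.unitaryGroup m ℂ := hH.eigenvectorUnitary.2
  have hV1 : V.conjTranspose * V = 1 := Matrix.mem_unitaryGroup_iff'.mp hVu
  have hV2 : V * V.conjTranspose = 1 := Matrix.mem_unitaryGroup_iff.mp hVu
  set C := B * V with hC
  have hCC : C.conjTranspose * C = Matrix.diagonal fun i => (hH.eigenvalues i : ℂ) := by
    have hs := hH.spectral_theorem
    rw [Unitary.conjStarAlgAut_apply] at hs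
    change _ = V * (Matrix.diagonal fun i => (hH.eigenvalues i : ℂ)) * V.conjTranspose at hs
    generalize (Matrix.diagonal fun i => (hH.eigenvalues i : ℂ)) = D at hs ⊢
    rw [hC, Matrix.conjTranspose_mul, Matrix.mul_assoc, ← Matrix.mul_assoc B.conjTranspose, hs,
      Matrix.mul_assoc, Matrix.mul_assoc, hV1, Matrix.mul_one, ← Matrix.mul_assoc, hV1,
      Matrix.one_mul]
  have hcol : ∀ i j, ∑ a, star (C a i) * C a j = if i = j then (hH.eigenvalues i : ℂ) else 0 :=
    fun i j => by
      have := congrFun (congrFun hCC i) j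
      rw [Matrix.mul_apply, Matrix.diagonal_apply] at this
      exact this
  have hev : ∀ i, hH.eigenvalues i = ∑ a, ‖C a i‖ ^ 2 := fun i => by
    have h := hcol i i
    rw [if_pos rfl] at h
    have : ∀ a, star (C a i) * C a i = ((‖C a i‖ ^ 2 : ℝ) : ℂ) := fun a => by
      rw [Complex.star_def, mul_comm, Complex.mul_conj, Complex.normSq_eq_norm_sq]
    rw [Finset.sum_congr rfl fun a _ => this a, ← Complex.ofReal_sum] at h
    exact_mod_cast h.symm
  have hev0 : ∀ i, 0 ≤ hH.eigenvalues i := fun i => by rw [hev]; positivity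
  have hCn : specNorm C ≤ 1 := (specNorm_mul_le B V).trans
    (mul_le_one₀ hB (specNorm_nonneg _) (specNorm_le_one_of_mem_unitary hVu))
  have hev1 : ∀ i, hH.eigenvalues i ≤ 1 := fun i => by
    have h := sum_sq_mulVec_le C (Pi.single i 1)
    have h1 : ∑ j, ‖(Pi.single i 1 : m → ℂ) j‖ ^ 2 = 1 := by
      rw [Finset.sum_eq_single i (fun j _ hj => by simp [hj]) (by simp)]
      simp
    rw [h1] at h
    simp only [Matrix.mulVec_single_one, Matrix.col_apply] at h
    rw [← hev] at h
    nlinarith [specNorm_nonneg C]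
  let σ : m → ℝ := fun i => Real.sqrt (hH.eigenvalues i)
  have hσ2 : ∀ i, (σ i : ℂ) * σ i = hH.eigenvalues i := fun i => by
    rw [← Complex.ofReal_mul, Real.mul_self_sqrt (hev0 i)]
  -- Where σ i = 0 the division yields 0; such indices are left out of the orthonormal family, and
  -- there the column of C is zero anyway.
  let v : m → EuclideanSpace ℂ m := fun i => WithLp.toLp 2 fun a => C a i / σ i
  have hon : Orthonormal ℂ (({i | σ i ≠ 0} : Set m).domRestrict v) := by
    rw [orthonormal_iff_ite]
    rintro ⟨i, hi⟩ ⟨j, hj⟩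
    have h1 : inner ℂ (v i) (v j) = (∑ a, star (C a i) * C a j) / (σ i * σ j) := by
      rw [PiLp.inner_apply, Finset.sum_div]
      apply Finset.sum_congr rfl
      intro a _
      simp only [v, RCLike.inner_apply, map_div₀, Complex.conj_ofReal, Complex.star_def]
      ring
    change inner ℂ (v i) (v j) = _
    simp only [h1, hcol, Subtype.mk.injEq]
    split_ifs with h
    · subst h
      have : (σ i : ℂ) ≠ 0 := by exact_mod_cast hi
      rw [← hσ2, div_self (mul_ne_zero this this)]
    · rw [zero_div]
  obtain ⟨b, hb⟩ := hon.exists_orthonormalBasis_extension_of_card_eq (by simp)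
  refine ⟨Matrix.of fun a i => (b i).ofLp a, ?_, V, hVu, σ, fun i => ⟨Real.sqrt_nonneg _, ?_⟩, ?_⟩
  · rw [Matrix.mem_unitaryGroup_iff']
    ext i j
    have := orthonormal_iff_ite.mp b.orthonormal i j
    rw [PiLp.inner_apply] at this
    rw [Matrix.mul_apply, Matrix.one_apply, ← this]
    apply Finset.sum_congr rfl
    intro a _
    rw [Matrix.star_apply, Matrix.of_apply, Matrix.of_apply, RCLike.inner_apply, Complex.star_def, mul_comm]
  · exact Real.sqrt_le_one.mpr (hev1 i)
  · have hfac : C = (Matrix.of fun a i => (b i).ofLp a) *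
        Matrix.diagonal (fun i => (σ i : ℂ)) := by
      ext a i
      rw [Matrix.mul_diagonal, Matrix.of_apply]
      by_cases hi : σ i = 0
      · have h0 : hH.eigenvalues i = 0 := (Real.sqrt_eq_zero (hev0 i)).mp hi
        have h1 := hev i
        rw [h0] at h1
        have h2 := (Finset.sum_eq_zero_iff_of_nonneg fun a _ => by positivity).mp h1.symm a
          (Finset.mem_univ a)
        have h3 : C a i = 0 := by simpa using h2
        rw [h3, hi]
        simp
      · have : (σ i : ℂ) ≠ 0 := by exact_mod_cast hi
        rw [hb i hi]
        simp only [v]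
        rw [div_mul_cancel₀ _ this]
    rw [← hfac, hC, Matrix.mul_assoc, hV2, Matrix.mul_one]

/-! ## Circuits of gates with many controls -/

section
variable {ι : Type} [Fintype ι] [DecidableEq ι]

theorem mcOp_mem_unitary (G : List (MCGate ι)) (hv : ∀ g ∈ G, g.Valid) :
    mcOp G ∈ Matrix.unitaryGroup (Bits ι) ℂ := by
  induction G with
  | nil => exact one_mem _
  | cons g G ih =>
    obtain ⟨h1, h2⟩ := hv g (by simp)
    refine mul_mem (ih fun g' hg' => hv g' (by simp [hg'])) (mux_mem_unitary ?_ fun x => ?_)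
    · intro x b
      simp only [ignores_lits h2]
    · split_ifs
      · exact h1
      · exact one_mem _

/-- A qubit that is never a target is conserved, so entries between states that differ in it vanish.
-/
theorem mcOp_eq_zero (G : List (MCGate ι)) {i : ι} (hi : ∀ g ∈ G, g.target ≠ i) {x y : Bits ι}
    (h : x i ≠ y i) : mcOp G x y = 0 := by
  induction G generalizing y with
  | nil =>
    rw [mcOp_nil, Matrix.one_apply_ne]
    exact fun H => h (by rw [H])
  | cons g G ih =>
    rw [mcOp_cons, MCGate.op, cmux, mul_mux_apply]
    apply Finset.sum_eq_zero
    intro b _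
    rw [ih (fun g' hg' => hi g' (by simp [hg'])), zero_mul]
    rwa [Function.update_of_ne (hi g (by simp)).symm]

/-- `M` maps the basis state `y` to the basis state `z`. -/
def SendsTo (M : Op ι) (y z : Bits ι) : Prop := ∀ x, M x y = if x = z then 1 else 0

theorem SendsTo.mul {M N : Op ι} {y z u : Bits ι} (hN : SendsTo N y z) (hM : SendsTo M z u) :
    SendsTo (M * N) y u := fun x => by
  rw [Matrix.mul_apply, Finset.sum_eq_single z]
  · rw [hN z, if_pos rfl, mul_one, hM]
  · intro b _ hb
    rw [hN b, if_neg hb, mul_zero]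
  · simp

theorem sendsTo_one (y : Bits ι) : SendsTo (1 : Op ι) y y := fun _ => Matrix.one_apply

theorem sendsTo_flip {t : ι} {l : List (ι × Bool)} (y : Bits ι) :
    SendsTo (cmux t l flipMat) y
      (if ∀ q ∈ l, y q.1 = q.2 then Function.update y t (!y t) else y) := fun x => by
  have key : ∀ b, (∀ i, i ≠ t → x i = y i) ∧ x t = b ↔ x = Function.update y t b := fun b => by
    constructor
    · rintro ⟨h, rfl⟩
      exact (update_of_agree h).symm
    · rintro rfl
      exact ⟨fun i hi => by simp [hi], by simp⟩
  unfold cmux mux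
  beta_reduce
  by_cases hl : ∀ q ∈ l, y q.1 = q.2
  · rw [if_pos hl, if_pos hl]
    by_cases h1 : ∀ i, i ≠ t → x i = y i
    · rw [if_pos h1]
      by_cases h2 : x t = !y t
      · rw [if_pos ((key _).mp ⟨h1, h2⟩), h2]
        simp [flipMat]
      · rw [if_neg fun h => h2 ((key _).mpr h).2]
        have h3 : x t = y t := by
          by_contra h
          exact h2 (Bool.eq_not_of_ne h)
        simp [flipMat, h3]
    · rw [if_neg h1, if_neg fun h => h1 ((key _).mpr h).1]
  · rw [if_neg hl, if_neg hl]
    by_cases h1 : ∀ i, i ≠ t → x i = y i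
    · rw [if_pos h1, Matrix.one_apply]
      refine if_congr ⟨fun h => ?_, fun h => by rw [h]⟩ rfl rfl
      simpa using (key _).mp ⟨h1, h⟩
    · rw [if_neg h1, if_neg fun h => h1 fun i _ => by rw [h]]

/-- The number with the given binary digits, least significant first. -/
def listVal : List ι → Bits ι → ℕ
  | [], _ => 0
  | q :: qs, x => (if x q then 1 else 0) + 2 * listVal qs x

theorem listVal_congr {qs : List ι} {x y : Bits ι} (h : ∀ q ∈ qs, x q = y q) :
    listVal qs x = listVal qs y := by
  induction qs with
  | nil => rfl
  | cons q qs ih =>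
    rw [listVal, listVal, h q (by simp), ih fun q' hq' => h q' (by simp [hq'])]

theorem listVal_inj {qs : List ι} {x y : Bits ι} (h : listVal qs x = listVal qs y) :
    ∀ q ∈ qs, x q = y q := by
  induction qs with
  | nil => simp
  | cons q qs ih =>
    rw [listVal, listVal] at h
    have h0 : x q = y q := by
      cases hx : x q <;> cases hy : y q <;> simp [hx, hy] at h ⊢ <;> omega
    rw [h0] at h
    rw [List.forall_mem_cons]
    exact ⟨h0, ih (by omega)⟩

theorem listVal_append_singleton (qs : List ι) (f : ι) (x : Bits ι) (hf : x f = false) :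
    listVal (qs ++ [f]) x = listVal qs x := by
  induction qs with
  | nil => simp [listVal, hf]
  | cons q qs ih => rw [List.cons_append, listVal, listVal, ih]

theorem listVal_eq_zero_iff (qs : List ι) (x : Bits ι) :
    listVal qs x = 0 ↔ ∀ q ∈ qs, x q = false := by
  induction qs with
  | nil => simp [listVal]
  | cons q qs ih =>
    rw [listVal, List.forall_mem_cons, ← ih]
    cases x q <;> simp

theorem listVal_add_one_eq_iff (qs : List ι) (x : Bits ι) :
    listVal qs x + 1 = 2 ^ qs.length ↔ ∀ q ∈ qs, x q = true := by
  induction qs with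
  | nil => simp [listVal]
  | cons q qs ih =>
    rw [listVal, List.forall_mem_cons, ← ih, List.length_cons, pow_succ]
    cases x q <;> simp <;> omega

theorem listVal_ofFn {m : ℕ} (f : Fin m → ι) (x : Bits ι) :
    listVal (List.ofFn f) x = bitsVal fun i => x (f i) := by
  induction m with
  | zero => simp [listVal, bitsVal]
  | succ m ih => rw [List.ofFn_succ, listVal, ih, bitsVal_succ]

/-- Subtraction of `1` modulo a power of two. -/
def decGates : List ι → List (MCGate ι)
  | [] => []
  | q :: qs => (decGates qs).map (MCGate.addLits [(q, false)]) ++ [⟨q, [], flipMat⟩]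

theorem mem_decGates {qs : List ι} (hqs : qs.Nodup) : ∀ g ∈ decGates qs,
    g.target ∈ qs ∧ g.Valid ∧ g.lits.length < qs.length := by
  induction qs with
  | nil => simp [decGates]
  | cons q qs ih =>
    obtain ⟨hq, hqs⟩ := List.nodup_cons.mp hqs
    intro g hg
    rw [decGates, List.mem_append, List.mem_map, List.mem_singleton] at hg
    rcases hg with ⟨g, hg, rfl⟩ | rfl
    · obtain ⟨h1, h2, h3⟩ := ih hqs g hg
      refine ⟨List.mem_cons_of_mem _ h1, ⟨h2.1, ?_⟩, ?_⟩
      · simp only [MCGate.addLits, List.singleton_append, List.forall_mem_cons]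
        exact ⟨fun h => hq (h ▸ h1), h2.2⟩
      · simpa [MCGate.addLits] using h3
    · exact ⟨by simp, ⟨flip_mem_unitary, by simp⟩, by simp⟩

theorem length_decGates (qs : List ι) : (decGates qs).length = qs.length := by
  induction qs with
  | nil => rfl
  | cons q qs ih => simp [decGates, ih]

/-- Subtraction with borrow: the higher digits are decremented exactly if the lowest digit is 0, and
this has to be tested before that digit is flipped. The first alternative is the wrap-around from 0
to all ones. -/
theorem sendsTo_decGates {qs : List ι} (hqs : qs.Nodup) (y : Bits ι) :
    ∃ z, SendsTo (mcOp (decGates qs)) y z ∧ (∀ i, i ∉ qs → z i = y i) ∧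
      ((listVal qs y = 0 ∧ ∀ q ∈ qs, z q = true) ∨ listVal qs z + 1 = listVal qs y) := by
  induction qs with
  | nil => exact ⟨y, sendsTo_one y, fun _ _ => rfl, Or.inl ⟨rfl, by simp⟩⟩
  | cons q qs ih =>
    obtain ⟨hq, hqs'⟩ := List.nodup_cons.mp hqs
    obtain ⟨z, hz, hzy, hval⟩ := ih hqs'
    have hlast : ∀ u : Bits ι, SendsTo (mcOp [⟨q, [], flipMat⟩]) u (Function.update u q (!u q)) :=
      fun u => by
        rw [mcOp_cons, mcOp_nil, one_mul]
        have h := sendsTo_flip (t := q) (l := []) u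
        rw [if_pos (by simp)] at h
        exact h
    have hfirst : ∀ x, mcOp ((decGates qs).map (MCGate.addLits [(q, false)])) x y =
        if y q = false then mcOp (decGates qs) x y else (1 : Op ι) x y := fun x => by
      rw [mcOp_addLits]
      · simp
      · intro g hg p hp
        rw [List.mem_singleton] at hp
        subst hp
        exact fun h => hq ((show q = g.target from h) ▸ (mem_decGates hqs' g hg).1)
    have hne : ∀ p ∈ qs, p ≠ q := fun p hp h => hq (h ▸ hp)
    rw [decGates, mcOp_append]
    by_cases hy : y q = false
    · have h1 : SendsTo (mcOp ((decGates qs).map (MCGate.addLits [(q, false)]))) y z := fun x => by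
        rw [hfirst, if_pos hy]; exact hz x
      refine ⟨_, h1.mul (hlast z), ?_, ?_⟩
      · intro i hi
        rw [List.mem_cons, not_or] at hi
        rw [Function.update_of_ne hi.1, hzy i hi.2]
      · have hzq : z q = false := by rw [hzy q hq, hy]
        have hv : listVal qs (Function.update z q (!z q)) = listVal qs z :=
          listVal_congr fun p hp => by rw [Function.update_of_ne (hne p hp)]
        rw [listVal, listVal, hv, Function.update_self, hzq, hy]
        rcases hval with ⟨h0, ha⟩ | h
        · refine Or.inl ⟨by simp [h0], ?_⟩
          rw [List.forall_mem_cons]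
          exact ⟨by simp, fun p hp => by rw [Function.update_of_ne (hne p hp), ha p hp]⟩
        · refine Or.inr ?_
          simp
          omega
    · simp only [Bool.not_eq_false] at hy
      have h1 : SendsTo (mcOp ((decGates qs).map (MCGate.addLits [(q, false)]))) y y := fun x => by
        rw [hfirst, if_neg (by simp [hy])]; exact sendsTo_one y x
      refine ⟨_, h1.mul (hlast y), ?_, Or.inr ?_⟩
      · intro i hi
        rw [List.mem_cons, not_or] at hi
        rw [Function.update_of_ne hi.1]
      · have hv : listVal qs (Function.update y q (!y q)) = listVal qs y :=
          listVal_congr fun p hp => by rw [Function.update_of_ne (hne p hp)]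
        rw [listVal, listVal, hv, Function.update_self, hy]
        simp
        omega

/-- Subtraction of `1` with an overflow qubit `f` that starts and ends in `|0⟩`. -/
theorem mcOp_decGates_apply {qs : List ι} {f : ι} (hqs : (qs ++ [f]).Nodup) {x y : Bits ι}
    (hx : x f = false) (hy : y f = false) :
    mcOp (decGates (qs ++ [f])) x y =
      if (∀ i, i ∉ qs → x i = y i) ∧ listVal qs x + 1 = listVal qs y then 1 else 0 := by
  obtain ⟨z, hz, hzy, hval⟩ := sendsTo_decGates hqs y
  rw [hz x]
  have key : x = z ↔ (∀ i, i ∉ qs → x i = y i) ∧ listVal qs x + 1 = listVal qs y := by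
    rw [listVal_append_singleton qs f y hy] at hval
    constructor
    · rintro rfl
      rw [listVal_append_singleton qs f x hx] at hval
      refine ⟨fun i hi => ?_, ?_⟩
      · by_cases hif : i = f
        · subst hif; rw [hx, hy]
        · exact hzy i (by simp [hi, hif])
      -- A wrap-around would leave the overflow qubit f at 1, contrary to x f = false. So the shift
      -- is truncated rather than cyclic.
      · rcases hval with ⟨-, h⟩ | h
        · have := h f (by simp)
          simp [hx] at this
        · exact h
    · rintro ⟨h1, h2⟩
      rcases hval with ⟨h, -⟩ | h
      · omega
      · have h3 : listVal (qs ++ [f]) x = listVal (qs ++ [f]) z := by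
          rw [listVal_append_singleton qs f x hx]; omega
        funext i
        by_cases hi : i ∈ qs ++ [f]
        · exact listVal_inj h3 i hi
        · rw [hzy i hi, h1 i fun h => hi (by simp [h])]
  simp only [key]

/-- Add the qubit `q₀` to the qubits `qs`. -/
def fanGates (q₀ : ι) (qs : List ι) : List (MCGate ι) :=
  qs.map fun q => ⟨q, [(q₀, true)], flipMat⟩

/-- The action of `fanGates` on basis states. -/
def fanMap (q₀ : ι) (qs : List ι) (y : Bits ι) : Bits ι :=
  fun i => if i ∈ qs then xor (y i) (y q₀) else y i

theorem fanMap_fanMap {q₀ : ι} {qs : List ι} (h : q₀ ∉ qs) (y : Bits ι) :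
    fanMap q₀ qs (fanMap q₀ qs y) = y := by
  funext i
  by_cases hi : i ∈ qs <;> simp [fanMap, hi, h]

theorem sendsTo_fanGates {q₀ : ι} {qs : List ι} (hqs : qs.Nodup) (h : q₀ ∉ qs) (y : Bits ι) :
    SendsTo (mcOp (fanGates q₀ qs)) y (fanMap q₀ qs y) := by
  induction qs generalizing y with
  | nil =>
    have : fanMap q₀ [] y = y := by funext i; simp [fanMap]
    rw [this]
    exact sendsTo_one y
  | cons q qs ih =>
    obtain ⟨hq, hqs⟩ := List.nodup_cons.mp hqs
    rw [List.mem_cons, not_or] at h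
    have h1 := sendsTo_flip (t := q) (l := [(q₀, true)]) y
    have h2 := h1.mul (ih hqs h.2 _)
    have h3 : fanMap q₀ qs (if ∀ p ∈ [(q₀, true)], y p.1 = p.2 then Function.update y q (!y q)
        else y) = fanMap q₀ (q :: qs) y := by
      funext i
      by_cases hi : i = q
      · subst hi
        cases hy : y q₀ <;> simp [fanMap, hq, hy]
      · cases hy : y q₀ <;> simp [fanMap, hi, hy, h.1]
    rw [h3] at h2
    exact h2

/-- The fan of CNOTs is an involution of the basis states, so conjugation by it relabels rows and
columns. -/
theorem fan_conj_apply {q₀ : ι} {qs : List ι} (hqs : qs.Nodup) (h : q₀ ∉ qs) (N : Op ι)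
    (x y : Bits ι) : (mcOp (fanGates q₀ qs) * N * mcOp (fanGates q₀ qs)) x y =
      N (fanMap q₀ qs x) (fanMap q₀ qs y) := by
  have hrow : ∀ z, mcOp (fanGates q₀ qs) x z = if z = fanMap q₀ qs x then 1 else 0 := fun z => by
    rw [sendsTo_fanGates hqs h z x]
    refine if_congr ⟨?_, ?_⟩ rfl rfl
    · rintro rfl; rw [fanMap_fanMap h]
    · rintro rfl; rw [fanMap_fanMap h]
  rw [mul_assoc, Matrix.mul_apply, Finset.sum_eq_single (fanMap q₀ qs x)]
  · rw [hrow, if_pos rfl, one_mul, Matrix.mul_apply, Finset.sum_eq_single (fanMap q₀ qs y)]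
    · rw [sendsTo_fanGates hqs h y _, if_pos rfl, mul_one]
    · intro b _ hb
      rw [sendsTo_fanGates hqs h y _, if_neg hb, mul_zero]
    · simp
  · intro b _ hb
    rw [hrow, if_neg hb, zero_mul]
  · simp

/-- Application of the contraction `U diag(σ) V†` to the qubit `q₀` when the qubits `qs` are all
in the state `|0⟩`, with the ancilla `f`. -/
noncomputable def contractionGates (q₀ : ι) (qs : List ι) (f : ι) (U V : Matrix Bool Bool ℂ)
    (σ : Bool → ℝ) : List (MCGate ι) :=
  [⟨q₀, [], V.conjTranspose⟩, ⟨f, [], rot (Real.pi / 2)⟩,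
    ⟨f, (q₀, false) :: qs.map fun q => (q, false), rot (Real.arccos (σ false) - Real.pi / 2)⟩,
    ⟨f, (q₀, true) :: qs.map fun q => (q, false), rot (Real.arccos (σ true) - Real.pi / 2)⟩,
    ⟨q₀, [], U⟩]

/-- Between V† and U the flag f is rotated by π/2 by default and by arccos σ when the qubits qs are
all 0. The amplitude for f to stay in |0⟩ is the cosine: 0 in the first case, the singular value in
the second. -/
theorem mcOp_contractionGates_apply {q₀ : ι} {qs : List ι} {f : ι} (hq₀ : q₀ ∉ qs) (hfq : f ≠ q₀)
    (hf : f ∉ qs) {U V : Matrix Bool Bool ℂ} {σ : Bool → ℝ} (hσ : ∀ b, 0 ≤ σ b ∧ σ b ≤ 1)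
    {x y : Bits ι} (hx : x f = false) (hy : y f = false) :
    mcOp (contractionGates q₀ qs f U V σ) x y =
      if (∀ i, i ≠ q₀ → x i = y i) ∧ ∀ q ∈ qs, y q = false then
        (U * Matrix.diagonal (fun i => (σ i : ℂ)) * V.conjTranspose) (x q₀) (y q₀) else 0 := by
  have hcond : ∀ (b : Bool) (z : Bits ι), (∀ q ∈ (q₀, b) :: qs.map fun q => (q, false),
      z q.1 = q.2) ↔ z q₀ = b ∧ ∀ q ∈ qs, z q = false := fun b z => by
    simp only [List.forall_mem_cons, List.forall_mem_map]
  let A : Bool → Bits ι → ℝ := fun b z =>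
    if z q₀ = b ∧ ∀ q ∈ qs, z q = false then Real.arccos (σ b) - Real.pi / 2 else 0
  -- The total angle of f. At most one of the two corrections is active, since they require
  -- different values of q₀.
  let Θ : Bits ι → ℝ := fun z => A true z + (A false z + Real.pi / 2)
  have hrot : ∀ b, cmux f ((q₀, b) :: qs.map fun q => (q, false))
      (rot (Real.arccos (σ b) - Real.pi / 2)) = mux f fun z => rot (A b z) := fun b => by
    rw [cmux]
    congr 1
    funext z
    by_cases h : z q₀ = b ∧ ∀ q ∈ qs, z q = false
    · rw [if_pos ((hcond b z).mpr h)]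
      simp only [A, if_pos h]
    · rw [if_neg ((hcond b z).not.mpr h)]
      simp only [A, if_neg h, rot_zero]
  have irot : ∀ b, Ignores f fun z => rot (A b z) := fun b z c => by
    have h1 : Function.update z f c q₀ = z q₀ := Function.update_of_ne hfq.symm _ _
    have h2 : (∀ q ∈ qs, Function.update z f c q = false) ↔ ∀ q ∈ qs, z q = false :=
      forall₂_congr fun q hq => by
        have hne : q ≠ f := fun h => hf (h ▸ hq)
        rw [Function.update_of_ne hne]
    simp only [A, h1, h2]
  have hR : cmux f ((q₀, true) :: qs.map fun q => (q, false))
        (rot (Real.arccos (σ true) - Real.pi / 2)) *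
      (cmux f ((q₀, false) :: qs.map fun q => (q, false))
        (rot (Real.arccos (σ false) - Real.pi / 2)) * cmux f [] (rot (Real.pi / 2))) =
      mux f fun z => rot (Θ z) := by
    rw [hrot, hrot, cmux, mux_mul (irot false), mux_mul (irot true)]
    congr 1
    funext z
    have h1 : (∀ q ∈ ([] : List (ι × Bool)), z q.1 = q.2) := by simp
    simp only [Θ, rot_add, if_pos h1]
  have hop : mcOp (contractionGates q₀ qs f U V σ) =
      mux q₀ (fun _ => U) * ((mux f fun z => rot (Θ z)) * mux q₀ fun _ => V.conjTranspose) := by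
    rw [← hR]
    simp only [contractionGates, mcOp_cons, mcOp_nil, MCGate.op, one_mul, mul_assoc]
    simp [cmux]
  have hcos : ∀ z : Bits ι, (∀ q ∈ qs, z q = false) → Real.cos (Θ z) = σ (z q₀) := fun z hz => by
    have h1 : -1 ≤ σ (z q₀) := by linarith [(hσ (z q₀)).1]
    have h2 : Θ z = Real.arccos (σ (z q₀)) := by
      have hA : ∀ b, A b z = if z q₀ = b then Real.arccos (σ b) - Real.pi / 2 else 0 := fun b =>
        if_congr (and_iff_left hz) rfl rfl
      simp only [Θ, hA]
      cases z q₀ <;> simp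
    rw [h2, Real.cos_arccos h1 (hσ _).2]
  have hcos0 : ∀ z : Bits ι, (¬ ∀ q ∈ qs, z q = false) → Real.cos (Θ z) = 0 := fun z hz => by
    have h2 : Θ z = Real.pi / 2 := by
      simp only [Θ, A, if_neg fun h : _ ∧ _ => hz h.2, zero_add]
    rw [h2, Real.cos_pi_div_two]
  rw [hop, mux_mul_apply (ignores_const _ _)]
  have hent : ∀ b b' : Bool, mux f (fun z => rot (Θ z)) (Function.update x q₀ b)
      (Function.update y q₀ b') =
      if b = b' ∧ (∀ i, i ≠ q₀ → x i = y i) ∧ ∀ q ∈ qs, y q = false then (σ b : ℂ) else 0 := by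
    intro b b'
    have h1 : (∀ i, i ≠ f → Function.update x q₀ b i = Function.update y q₀ b' i) ↔
        b = b' ∧ ∀ i, i ≠ q₀ → x i = y i := by
      constructor
      · intro h
        refine ⟨by simpa using h q₀ hfq.symm, fun i hi => ?_⟩
        by_cases hif : i = f
        · subst hif; rw [hx, hy]
        · simpa [hi] using h i hif
      · rintro ⟨rfl, h⟩ i _
        by_cases hi : i = q₀
        · subst hi; simp
        · simp [hi, h i hi]
    have h2 : (∀ q ∈ qs, Function.update y q₀ b' q = false) ↔ ∀ q ∈ qs, y q = false :=
      forall₂_congr fun q hq => by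
        have hne : q ≠ q₀ := fun h => hq₀ (h ▸ hq)
        rw [Function.update_of_ne hne]
    simp only [mux, h1, Function.update_of_ne hfq, hx, hy]
    by_cases hbb : b = b' ∧ ∀ i, i ≠ q₀ → x i = y i
    · rw [if_pos hbb]
      have h3 : rot (Θ (Function.update y q₀ b')) false false =
          (Real.cos (Θ (Function.update y q₀ b')) : ℂ) := by simp [rot]
      rw [h3]
      by_cases hq : ∀ q ∈ qs, y q = false
      · rw [hcos _ (h2.mpr hq), if_pos ⟨hbb.1, hbb.2, hq⟩, Function.update_self, hbb.1]
      · rw [hcos0 _ (h2.not.mpr hq), if_neg fun h => hq h.2.2, Complex.ofReal_zero]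
    · rw [if_neg hbb, if_neg fun h => hbb ⟨h.1, h.2.1⟩]
  simp only [mul_mux_apply, hent]
  by_cases hall : (∀ i, i ≠ q₀ → x i = y i) ∧ ∀ q ∈ qs, y q = false
  · rw [if_pos hall, Matrix.mul_assoc, Matrix.mul_apply]
    apply Finset.sum_congr rfl
    intro b _
    congr 1
    rw [Matrix.diagonal_mul, Finset.sum_eq_single b]
    · rw [if_pos ⟨rfl, hall⟩]
    · intro b' _ hb'
      rw [if_neg fun h => hb' h.1.symm, zero_mul]
    · simp
  · rw [if_neg hall]
    apply Finset.sum_eq_zero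
    intro b _
    rw [Finset.sum_eq_zero, mul_zero]
    intro b' _
    rw [if_neg fun h => hall h.2, zero_mul]

/-- Application of a contraction to the span of `|0…0⟩` and `|1…1⟩`. -/
noncomputable def cornerGates (q₀ : ι) (qs : List ι) (f : ι) (U V : Matrix Bool Bool ℂ)
    (σ : Bool → ℝ) : List (MCGate ι) :=
  fanGates q₀ qs ++ (contractionGates q₀ qs f U V σ ++ fanGates q₀ qs)

/-- CNOTs from q₀ to the other digits send |0…0⟩ and |1…1⟩ to the states with qs = 0, and q₀ tells
which of the two it was. A contraction of q₀ conditioned on qs = 0 thus becomes a matrix acting on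
the first and the last grid point. -/
theorem mcOp_cornerGates_apply {q₀ : ι} {qs : List ι} {f : ι} (hqs : qs.Nodup) (hq₀ : q₀ ∉ qs)
    (hfq : f ≠ q₀) (hf : f ∉ qs) {U V : Matrix Bool Bool ℂ} {σ : Bool → ℝ}
    (hσ : ∀ b, 0 ≤ σ b ∧ σ b ≤ 1) {x y : Bits ι} (hx : x f = false) (hy : y f = false) :
    mcOp (cornerGates q₀ qs f U V σ) x y =
      if (∀ i, i ∉ q₀ :: qs → x i = y i) ∧ (∀ q ∈ qs, x q = x q₀) ∧ ∀ q ∈ qs, y q = y q₀ then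
        (U * Matrix.diagonal (fun i => (σ i : ℂ)) * V.conjTranspose) (x q₀) (y q₀) else 0 := by
  have hff : ∀ x : Bits ι, x f = false → fanMap q₀ qs x f = false := fun x h => by
    simp [fanMap, hf, h]
  rw [cornerGates, mcOp_append, mcOp_append, fan_conj_apply hqs hq₀,
    mcOp_contractionGates_apply hq₀ hfq hf hσ (hff x hx) (hff y hy)]
  have h0 : ∀ x : Bits ι, fanMap q₀ qs x q₀ = x q₀ := fun x => by simp [fanMap, hq₀]
  rw [h0, h0]
  refine if_congr ?_ rfl rfl
  have hz : ∀ x : Bits ι, (∀ q ∈ qs, fanMap q₀ qs x q = false) ↔ ∀ q ∈ qs, x q = x q₀ := fun x =>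
    forall₂_congr fun q hq => by simp [fanMap, hq]
  rw [hz]
  constructor
  · rintro ⟨h1, h2⟩
    have h2' := (hz y).mpr h2
    refine ⟨fun i hi => ?_, (hz x).mp fun q hq => ?_, h2⟩
    · rw [List.mem_cons, not_or] at hi
      simpa [fanMap, hi.2] using h1 i hi.1
    · rw [h1 q fun h => hq₀ (h ▸ hq), h2' q hq]
  · rintro ⟨h1, h2, h3⟩
    refine ⟨fun i hi => ?_, h3⟩
    by_cases hiq : i ∈ qs
    · rw [(hz x).mpr h2 i hiq, (hz y).mpr h3 i hiq]
    · simpa [fanMap, hiq] using h1 i (by simp [hi, hiq])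

theorem mem_cornerGates {q₀ : ι} {qs : List ι} {f : ι} (hq₀ : q₀ ∉ qs)
    (hfq : f ≠ q₀) (hf : f ∉ qs) {U V : Matrix Bool Bool ℂ} {σ : Bool → ℝ}
    (hU : U ∈ Matrix.unitaryGroup Bool ℂ) (hV : V ∈ Matrix.unitaryGroup Bool ℂ) :
    ∀ g ∈ cornerGates q₀ qs f U V σ, g.target ∈ f :: q₀ :: qs ∧ g.Valid ∧
      g.lits.length ≤ qs.length + 1 := by
  have hfan : ∀ g ∈ fanGates q₀ qs, g.target ∈ f :: q₀ :: qs ∧ g.Valid ∧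
      g.lits.length ≤ qs.length + 1 := by
    simp only [fanGates, List.forall_mem_map]
    intro q hq
    refine ⟨by simp [hq], ⟨flip_mem_unitary, ?_⟩, by simp⟩
    simp only [List.mem_singleton, forall_eq]
    exact fun h => hq₀ (h ▸ hq)
  have hl : ∀ b, ∀ p ∈ (q₀, b) :: qs.map fun q => (q, false), p.1 ≠ f := fun b => by
    simp only [List.forall_mem_cons, List.forall_mem_map]
    exact ⟨hfq.symm, fun q hq h => hf (h ▸ hq)⟩
  intro g hg
  rw [cornerGates, List.mem_append, List.mem_append] at hg
  rcases hg with hg | hg | hg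
  · exact hfan g hg
  · simp only [contractionGates, List.mem_cons, List.not_mem_nil, or_false] at hg
    rcases hg with rfl | rfl | rfl | rfl | rfl
    · exact ⟨by simp, ⟨Unitary.star_mem hV, by simp⟩, by simp⟩
    · exact ⟨by simp, ⟨rot_mem_unitary _, by simp⟩, by simp⟩
    · exact ⟨by simp, ⟨rot_mem_unitary _, hl false⟩, by simp⟩
    · exact ⟨by simp, ⟨rot_mem_unitary _, hl true⟩, by simp⟩
    · exact ⟨by simp, ⟨hU, by simp⟩, by simp⟩
  · exact hfan g hg

theorem length_cornerGates {q₀ : ι} {qs : List ι} {f : ι} {U V : Matrix Bool Bool ℂ}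
    {σ : Bool → ℝ} : (cornerGates q₀ qs f U V σ).length = 2 * qs.length + 5 := by
  simp [cornerGates, fanGates, contractionGates]
  omega

end

/-! ## Difference operators -/

section
variable {ι : Type} [Fintype ι] [DecidableEq ι]

theorem mul_apply_of_left {A B : Op ι} {x y : Bits ι} (h : ∀ z, B z y ≠ 0 → A x z = (1 : Op ι) x z) :
    (A * B) x y = B x y := by
  rw [Matrix.mul_apply, Finset.sum_eq_single x]
  · by_cases hB : B x y = 0
    · rw [hB, mul_zero]
    · rw [h x hB, Matrix.one_apply_eq, one_mul]
  · intro z _ hz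
    by_cases hB : B z y = 0
    · rw [hB, mul_zero]
    · rw [h z hB, Matrix.one_apply_ne hz.symm, zero_mul]
  · simp

theorem mul_apply_of_right {A B : Op ι} {x y : Bits ι} (h : ∀ z, B z y = (1 : Op ι) z y) :
    (A * B) x y = A x y := by
  rw [Matrix.mul_apply]
  simp only [h]
  rw [← Matrix.mul_apply, mul_one]

/-- A linear combination of the truncated shift, the identity and a corner matrix along the binary
digits `q₀ :: qs`. -/
theorem exists_stencil {q₀ : ι} {qs : List ι} {f : ι} (hnd : (q₀ :: qs ++ [f]).Nodup)
    (lab : Fin 2 ↪ ι) (hlab : ∀ j, lab j ∉ q₀ :: qs ++ [f]) (w : Fin 3 → ℂ)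
    (hw : ‖w 0‖ + ‖w 1‖ + ‖w 2‖ ≤ 1) (B : Matrix Bool Bool ℂ) (hB : specNorm B ≤ 1) :
    ∃ T : Op ι, T ∈ Matrix.unitaryGroup (Bits ι) ℂ ∧
      ImplBy (qs.length + 4) (controlled T)
        (112 + (3 * qs.length + 7) * (24 * (qs.length + 4) + 1)) ∧
      ∀ x y, x f = false → y f = false → (∀ j, x (lab j) = false) → (∀ j, y (lab j) = false) →
        T x y = if ∀ i, i ∉ q₀ :: qs → x i = y i then
          w 0 * (if listVal (q₀ :: qs) x + 1 = listVal (q₀ :: qs) y then 1 else 0) +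
          w 1 * (if listVal (q₀ :: qs) x = listVal (q₀ :: qs) y then 1 else 0) +
          w 2 * (if (∀ q ∈ qs, x q = x q₀) ∧ ∀ q ∈ qs, y q = y q₀ then B (x q₀) (y q₀) else 0)
        else 0 := by
  have hnd' : (q₀ :: (qs ++ [f])).Nodup := hnd
  obtain ⟨h1, h2⟩ := List.nodup_cons.mp hnd'
  have hq₀ : q₀ ∉ qs := fun h => h1 (by simp [h])
  have hfq : f ≠ q₀ := fun h => h1 (by simp [h])
  have hqs : qs.Nodup := (List.nodup_append.mp h2).1
  have hf : f ∉ qs := fun h => (List.nodup_append.mp h2).2.2 f h f (by simp) rfl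
  obtain ⟨U, hU, V, hV, σ, hσ, rfl⟩ := exists_svd B hB
  -- Labels (r 0, r 1): 00 is the shift, 01 the corner, 10 the identity. 11 stays free as the spare
  -- label of `exists_prep_pair`.
  let c : Bits (Fin 2) → ℂ := fun r =>
    if r 0 then (if r 1 then 0 else w 1) else if r 1 then w 2 else w 0
  have hsum : ∀ {E : Type} [AddCommMonoid E] (F : Bits (Fin 2) → E),
      ∑ r, F r = F ![true, true] + F ![true, false] + (F ![false, true] + F ![false, false]) :=
    fun F => by
      rw [← Equiv.sum_comp (finTwoArrowEquiv Bool).symm, Fintype.sum_prod_type]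
      simp [finTwoArrowEquiv]
  have hc : ∑ r, ‖c r‖ ≤ 1 := by
    rw [hsum]
    simp [c]
    linarith
  obtain ⟨PL, PR, hPL, hPR, hP⟩ := exists_prep_pair c hc (r₀ := ![true, true]) (by simp [c])
  -- Shift and corner are controlled on different labels, so for a given label at most one of them
  -- acts and both can use the same qubit f. On the label of the identity neither acts.
  let Lc : List (ι × Bool) := [(lab 0, false), (lab 1, true)]
  let Ld : List (ι × Bool) := [(lab 0, false), (lab 1, false)]
  let Gc := cornerGates q₀ qs f U V σ
  let Gd := decGates (q₀ :: qs ++ [f])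
  have hGc : ∀ g ∈ Gc, g.target ∈ q₀ :: qs ++ [f] ∧ g.Valid ∧ g.lits.length ≤ qs.length + 1 :=
    fun g hg => by
      obtain ⟨a, b, c⟩ := mem_cornerGates hq₀ hfq hf hU hV g hg
      refine ⟨?_, b, c⟩
      simp only [List.mem_cons, List.mem_append, List.not_mem_nil] at a ⊢
      tauto
  have hGd : ∀ g ∈ Gd, g.target ∈ q₀ :: qs ++ [f] ∧ g.Valid ∧ g.lits.length ≤ qs.length + 1 :=
    fun g hg => by
      obtain ⟨a, b, c⟩ := mem_decGates hnd g hg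
      refine ⟨a, b, ?_⟩
      simp at c
      omega
  have hadd : ∀ (b : Bool) (G : List (MCGate ι)), (∀ g ∈ G, g.target ∈ q₀ :: qs ++ [f] ∧ g.Valid ∧
      g.lits.length ≤ qs.length + 1) →
      ∀ g ∈ G.map (MCGate.addLits [(lab 0, false), (lab 1, b)]),
        g.target ∈ q₀ :: qs ++ [f] ∧ g.Valid ∧ g.lits.length ≤ qs.length + 4 := fun b G hG => by
    simp only [List.forall_mem_map]
    intro g hg
    obtain ⟨a, b, c⟩ := hG g hg
    refine ⟨a, ⟨b.1, ?_⟩, ?_⟩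
    · simp only [MCGate.addLits, List.cons_append, List.nil_append, List.forall_mem_cons]
      exact ⟨fun h => hlab 0 (h ▸ a), fun h => hlab 1 (h ▸ a), b.2⟩
    · simp [MCGate.addLits]
      omega
  have hG : ∀ g ∈ Gc.map (MCGate.addLits Lc) ++ Gd.map (MCGate.addLits Ld),
      g.target ∈ q₀ :: qs ++ [f] ∧ g.Valid ∧ g.lits.length ≤ qs.length + 4 := fun g hg => by
    rcases List.mem_append.mp hg with hg | hg
    · exact hadd _ _ hGc g hg
    · exact hadd _ _ hGd g hg
  set M := mcOp (Gc.map (MCGate.addLits Lc) ++ Gd.map (MCGate.addLits Ld)) with hM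
  refine ⟨embedOp lab PL.conjTranspose * M * embedOp lab PR, ?_, ?_, ?_⟩
  · exact mul_mem (mul_mem (hPL.conjTranspose.embedOp lab).1.mem_unitary
      (mcOp_mem_unitary _ fun g hg => (hG g hg).2.1)) (hPR.embedOp lab).1.mem_unitary
  · rw [controlled_mul, controlled_mul]
    -- 112 = 2·14·2² for the two preparations. The lists have 2|qs| + 5 and |qs| + 2 gates.
    refine ((((hPL.conjTranspose.embedOp lab).2.implBy).mul (implBy_controlled_mcOp _
      (fun g hg => (hG g hg).2.1) (fun g hg => (hG g hg).2.2) le_rfl)).mul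
      ((hPR.embedOp lab).2.implBy)).mono (le_of_eq ?_)
    simp only [List.length_append, List.length_map, Gc, Gd, length_cornerGates, length_decGates,
      List.length_cons, List.length_nil, Fintype.card_fin]
    ring
  · intro x y hx hy hxl hyl
    rw [lcu_apply]
    rotate_left
    · intro x y hxy
      obtain ⟨j, hj⟩ := Function.ne_iff.mp hxy
      exact mcOp_eq_zero _ (i := lab j) (fun g hg h => hlab j (h ▸ (hG g hg).1)) hj
    · exact funext hxl
    · exact funext hyl
    simp only [hP]
    have hoff : ∀ (r : Bits (Fin 2)) (x : Bits ι), ∀ i ∈ q₀ :: qs ++ [f],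
        Function.extend lab r x i = x i := fun r x i hi =>
      extend_off lab r x fun k hk => hlab k (hk ▸ hi)
    have hon : ∀ (r : Bits (Fin 2)) (x : Bits ι) (j : Fin 2),
        Function.extend lab r x (lab j) = r j := fun r x j => lab.injective.extend_apply r x j
    have hval : ∀ (r : Bits (Fin 2)) (x : Bits ι), listVal (q₀ :: qs) (Function.extend lab r x) =
        listVal (q₀ :: qs) x := fun r x => listVal_congr fun q hq => hoff r x q
          (List.mem_append_left _ hq)
    have hag : ∀ r : Bits (Fin 2), (∀ i, i ∉ q₀ :: qs → Function.extend lab r x i =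
        Function.extend lab r y i) ↔ ∀ i, i ∉ q₀ :: qs → x i = y i := fun r => by
      refine forall₂_congr fun i _ => ?_
      by_cases hi : ∃ j, lab j = i
      · obtain ⟨j, rfl⟩ := hi
        simp [hon, hxl, hyl]
      · push Not at hi
        rw [extend_off lab r x hi, extend_off lab r y hi]
    have hMD : ∀ u v, mcOp (Gd.map (MCGate.addLits Ld)) u v =
        if v (lab 0) = false ∧ v (lab 1) = false then mcOp Gd u v else (1 : Op ι) u v :=
      fun u v => by
        rw [mcOp_addLits]
        · simp [Ld]
        · intro g hg q hq h
          simp only [Ld, List.mem_cons, List.not_mem_nil, or_false] at hq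
          rcases hq with rfl | rfl
          · exact hlab 0 ((show lab 0 = g.target from h) ▸ (hGd g hg).1)
          · exact hlab 1 ((show lab 1 = g.target from h) ▸ (hGd g hg).1)
    have hMC : ∀ u v, mcOp (Gc.map (MCGate.addLits Lc)) u v =
        if v (lab 0) = false ∧ v (lab 1) = true then mcOp Gc u v else (1 : Op ι) u v :=
      fun u v => by
        rw [mcOp_addLits]
        · simp [Lc]
        · intro g hg q hq h
          simp only [Lc, List.mem_cons, List.not_mem_nil, or_false] at hq
          rcases hq with rfl | rfl
          · exact hlab 0 ((show lab 0 = g.target from h) ▸ (hGc g hg).1)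
          · exact hlab 1 ((show lab 1 = g.target from h) ▸ (hGc g hg).1)
    have hlabC : ∀ u v, mcOp (Gc.map (MCGate.addLits Lc)) u v ≠ 0 → ∀ j, u (lab j) = v (lab j) :=
      fun u v h j => by
        by_contra hne
        exact h (mcOp_eq_zero _ (i := lab j) (fun g hg h' => hlab j (h' ▸ (hadd _ _ hGc g hg).1)) hne)
    have hff : ∀ (r : Bits (Fin 2)) (x : Bits ι), x f = false →
        Function.extend lab r x f = false := fun r x h => by rw [hoff r x f (by simp), h]
    rw [hsum, hM, mcOp_append]
    have eD : ∀ r : Bits (Fin 2), r 0 = false → r 1 = false →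
        (mcOp (Gd.map (MCGate.addLits Ld)) * mcOp (Gc.map (MCGate.addLits Lc)))
          (Function.extend lab r x) (Function.extend lab r y) =
        if (∀ i, i ∉ q₀ :: qs → x i = y i) ∧
          listVal (q₀ :: qs) x + 1 = listVal (q₀ :: qs) y then 1 else 0 := fun r h0 h1 => by
      rw [mul_apply_of_right, hMD, if_pos (by simp [hon, h0, h1]),
        mcOp_decGates_apply hnd (hff r x hx) (hff r y hy)]
      · simp only [hag, hval]
      · intro z
        rw [hMC, if_neg (by simp [hon, h1])]
    have eC : ∀ r : Bits (Fin 2), r 0 = false → r 1 = true →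
        (mcOp (Gd.map (MCGate.addLits Ld)) * mcOp (Gc.map (MCGate.addLits Lc)))
          (Function.extend lab r x) (Function.extend lab r y) =
        if (∀ i, i ∉ q₀ :: qs → x i = y i) ∧ (∀ q ∈ qs, x q = x q₀) ∧ ∀ q ∈ qs, y q = y q₀ then
          (U * Matrix.diagonal (fun i => (σ i : ℂ)) * V.conjTranspose) (x q₀) (y q₀) else 0 :=
      fun r h0 h1 => by
        rw [mul_apply_of_left, hMC, if_pos (by simp [hon, h0, h1]),
          mcOp_cornerGates_apply hqs hq₀ hfq hf hσ (hff r x hx) (hff r y hy)]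
        · have hq : ∀ x : Bits ι, (∀ q ∈ qs, Function.extend lab r x q =
              Function.extend lab r x q₀) ↔ ∀ q ∈ qs, x q = x q₀ := fun x =>
            forall₂_congr fun q hq => by
              rw [hoff r x q (by simp [hq]), hoff r x q₀ (by simp)]
          rw [if_congr (and_congr (hag r) (and_congr (hq x) (hq y))) rfl rfl,
            hoff r x q₀ (by simp), hoff r y q₀ (by simp)]
        · intro z hz
          have := hlabC _ _ hz 1
          rw [hon, h1] at this
          rw [hMD, if_neg (by simp [this])]
    have eI : ∀ r : Bits (Fin 2), r 0 = true →
        (mcOp (Gd.map (MCGate.addLits Ld)) * mcOp (Gc.map (MCGate.addLits Lc)))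
          (Function.extend lab r x) (Function.extend lab r y) =
        if (∀ i, i ∉ q₀ :: qs → x i = y i) ∧ listVal (q₀ :: qs) x = listVal (q₀ :: qs) y
          then 1 else 0 := fun r h0 => by
      rw [mul_apply_of_right, hMD, if_neg (by simp [hon, h0]), Matrix.one_apply]
      · refine if_congr ?_ rfl rfl
        constructor
        · intro h
          exact ⟨(hag r).mp fun i _ => by rw [h], by rw [← hval r x, h, hval]⟩
        · rintro ⟨h3, h4⟩
          funext i
          by_cases hi : i ∈ q₀ :: qs
          · rw [hoff r x i (List.mem_append_left _ hi), hoff r y i (List.mem_append_left _ hi)]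
            exact listVal_inj h4 i hi
          · exact (hag r).mpr h3 i hi
      · intro z
        rw [hMC, if_neg (by simp [hon, h0])]
    rw [eI ![true, true] (by simp), eI ![true, false] (by simp),
      eC ![false, true] (by simp) (by simp), eD ![false, false] (by simp) (by simp)]
    by_cases hall : ∀ i, i ∉ q₀ :: qs → x i = y i
    · simp only [if_pos hall, and_iff_right hall]
      simp [c]
      ring
    · rw [if_neg fun h => hall h.1, if_neg fun h => hall h.1, if_neg fun h => hall h.1, if_neg hall]
      simp

end

theorem cornerEntry_conjTranspose (N : ℕ) (B : Matrix Bool Bool ℂ) (i j : ℕ) :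
    star (cornerEntry N B.conjTranspose j i) = cornerEntry N B i j := by
  unfold cornerEntry
  by_cases h : (i = 0 ∨ i + 1 = N) ∧ (j = 0 ∨ j + 1 = N)
  · rw [if_pos h, if_pos h.symm, Matrix.conjTranspose_apply, star_star]
  · rw [if_neg h, if_neg fun h' => h h'.symm, star_zero]

section Stencil
variable {d n : ℕ}

/-- The digits of the coordinate μ carry the stencil. The three ancillas are the qubit f, used both
for overflow and as the flag of the contraction, and the two label qubits. -/
theorem exists_axis_stencil (hm : 0 < n / d) (μ : Fin d) (w : Fin 3 → ℂ)
    (hw : ‖w 0‖ + ‖w 1‖ + ‖w 2‖ ≤ 1) (B : Matrix Bool Bool ℂ) (hB : specNorm B ≤ 1) :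
    ∃ T : Op (Sys d n ⊕ Fin 3), T ∈ Matrix.unitaryGroup _ ℂ ∧
      ImplBy (n / d + 3) (controlled T) (2000 * (n / d) ^ 2) ∧
      zeroBlock T = axisOp μ fun i j => w 0 * (if i + 1 = j then 1 else 0) +
        w 1 * (if i = j then 1 else 0) + w 2 * cornerEntry (2 ^ (n / d)) B i j := by
  obtain ⟨m, hm'⟩ : ∃ m, n / d = m + 1 := ⟨n / d - 1, by omega⟩
  let b : Fin (n / d) → Sys d n ⊕ Fin 3 := fun i => Sum.inl (μ, i)
  have hb : Function.Injective b := fun i j h => by simpa [b] using h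
  let q₀ : Sys d n ⊕ Fin 3 := Sum.inl (μ, ⟨0, hm⟩)
  let qs : List (Sys d n ⊕ Fin 3) := List.ofFn fun i : Fin m => b ⟨i + 1, by omega⟩
  have hlist : q₀ :: qs = List.ofFn b := by
    rw [List.ofFn_congr hm', List.ofFn_succ]
    rfl
  have hlen : qs.length = m := by simp [qs]
  let f : Sys d n ⊕ Fin 3 := Sum.inr 0
  let lab : Fin 2 ↪ Sys d n ⊕ Fin 3 := ⟨fun j => Sum.inr j.succ, fun i j h => by simpa using h⟩
  have hmem : ∀ i, i ∈ q₀ :: qs ↔ ∃ j, b j = i := fun i => by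
    rw [hlist, List.mem_ofFn]
  have hnd : (q₀ :: qs ++ [f]).Nodup := by
    rw [List.nodup_append]
    refine ⟨by rw [hlist]; exact List.nodup_ofFn.mpr hb, by simp, ?_⟩
    intro a ha c hc h
    rw [List.mem_singleton] at hc
    obtain ⟨j, rfl⟩ := (hmem a).mp ha
    rw [hc] at h
    simp [b, f] at h
  have hlab : ∀ j, lab j ∉ q₀ :: qs ++ [f] := fun j h => by
    rw [List.mem_append, hmem, List.mem_singleton] at h
    rcases h with ⟨k, hk⟩ | h
    · simp [b, lab] at hk
    · exact Fin.succ_ne_zero j (Sum.inr.inj h)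
  obtain ⟨T, hT, hTi, hTe⟩ := exists_stencil hnd lab hlab w hw B hB
  refine ⟨T, hT, ?_, ?_⟩
  · rw [hlen] at hTi
    have hk : ∀ m : ℕ, 112 + (3 * m + 7) * (24 * (m + 4) + 1) ≤ 2000 * (m + 1) ^ 2 :=
      fun m => by nlinarith only [sq_nonneg m, Nat.zero_le m]
    have h := hTi.mono (l := 2000 * (n / d) ^ 2) ((hk m).trans_eq (by rw [hm']))
    rwa [show m + 4 = n / d + 3 by omega] at h
  · ext s t
    unfold zeroBlock axisOp
    rw [hTe _ _ rfl rfl (fun _ => rfl) fun _ => rfl]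
    have hv : ∀ s : Bits (Sys d n), listVal (q₀ :: qs) (Sum.elim s fun _ => false) = axisIndex s μ :=
      fun s => by
        rw [hlist, listVal_ofFn]
        rfl
    have hag : (∀ i, i ∉ q₀ :: qs → (Sum.elim s (fun _ => false) : Bits (Sys d n ⊕ Fin 3)) i =
        (Sum.elim t (fun _ => false) : Bits (Sys d n ⊕ Fin 3)) i) ↔
        ∀ ν i, ν ≠ μ → s (ν, i) = t (ν, i) := by
      constructor
      · intro h ν i hν
        refine h (Sum.inl (ν, i)) fun hi => ?_
        obtain ⟨j, hj⟩ := (hmem _).mp hi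
        simp only [b, Sum.inl.injEq, Prod.mk.injEq] at hj
        exact hν hj.1.symm
      · rintro h (⟨ν, i⟩ | i) hi
        · refine h ν i fun hν => hi ((hmem _).mpr ⟨i, ?_⟩)
          simp [b, hν]
        · rfl
    -- A grid index is the first or the last one exactly if all its binary digits equal the lowest
    -- digit.
    have hlast : ∀ s : Bits (Sys d n), (∀ q ∈ qs, (Sum.elim s fun _ => false :
          Bits (Sys d n ⊕ Fin 3)) q = (Sum.elim s fun _ => false : Bits (Sys d n ⊕ Fin 3)) q₀) ↔
        axisIndex s μ = 0 ∨ axisIndex s μ + 1 = 2 ^ (n / d) := fun s => by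
      have hl : 2 ^ (n / d) = 2 ^ (q₀ :: qs).length := by rw [List.length_cons, hlen, hm']
      rw [hl, ← hv s, listVal_eq_zero_iff, listVal_add_one_eq_iff]
      simp only [List.forall_mem_cons]
      cases (Sum.elim s fun _ => false : Bits (Sys d n ⊕ Fin 3)) q₀ <;> simp
    have hbit : ∀ s : Bits (Sys d n), (axisIndex s μ = 0 ∨ axisIndex s μ + 1 = 2 ^ (n / d)) →
        (Sum.elim s fun _ => false : Bits (Sys d n ⊕ Fin 3)) q₀ = decide (axisIndex s μ ≠ 0) :=
      fun s hs => by
        have h := (hlast s).mpr hs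
        rw [← hv s]
        have h0 := listVal_eq_zero_iff (q₀ :: qs) (Sum.elim s fun _ => false)
        rw [List.forall_mem_cons] at h0
        cases hq : (Sum.elim s fun _ => false : Bits (Sys d n ⊕ Fin 3)) q₀
        · have : listVal (q₀ :: qs) (Sum.elim s fun _ => false) = 0 :=
            h0.mpr ⟨hq, fun q hq' => by rw [h q hq', hq]⟩
          simp [this]
        · have : listVal (q₀ :: qs) (Sum.elim s fun _ => false) ≠ 0 := fun h' => by
            have := (h0.mp h').1
            rw [hq] at this
            simp at this
          simp [this]
    by_cases hst : ∀ ν i, ν ≠ μ → s (ν, i) = t (ν, i)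
    · rw [if_pos (hag.mpr hst), if_pos hst, hv, hv]
      congr 2
      unfold cornerEntry
      by_cases hc : (axisIndex s μ = 0 ∨ axisIndex s μ + 1 = 2 ^ (n / d)) ∧
          (axisIndex t μ = 0 ∨ axisIndex t μ + 1 = 2 ^ (n / d))
      · rw [if_pos hc, if_pos ⟨(hlast s).mpr hc.1, (hlast t).mpr hc.2⟩, hbit s hc.1, hbit t hc.2]
      · rw [if_neg hc, if_neg fun h => hc ⟨(hlast s).mp h.1, (hlast t).mp h.2⟩]
    · rw [if_neg fun h => hst (hag.mp h), if_neg hst]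

/-- The three weights are ±w with w = 1/(α_D h); the hypothesis α_D ≥ 3/h is exactly 3w ≤ 1. -/
theorem exists_diff_oracle (hm : 0 < n / d) (G : Grid d) (B : Bool → Fin d → Matrix Bool Bool ℂ)
    (hB : ∀ fwd μ, specNorm (B fwd μ) ≤ 1) {αD : ℝ} (hαD : ∀ μ, 3 / G.spacing μ ≤ αD) (fwd : Bool)
    (μ : Fin d) :
    ∃ V : Op (Sys d n ⊕ Fin 3), V ∈ Matrix.unitaryGroup _ ℂ ∧
      (diffOp G B fwd μ = (αD : ℂ) • zeroBlock V) ∧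
      ImplBy (n / d + 3) (controlled V) (2000 * (n / d) ^ 2) := by
  have hh := G.spacing_pos μ
  have h3 : 0 < 3 / G.spacing μ := by positivity
  have hα : 0 < αD := h3.trans_le (hαD μ)
  set w : ℝ := 1 / (αD * G.spacing μ) with hw
  have hw0 : 0 < w := by positivity
  have hw3 : 3 * w ≤ 1 := by
    have := hαD μ
    rw [div_le_iff₀ hh] at this
    rw [hw, mul_one_div, div_le_one (by positivity)]
    exact this
  have hwn : ‖(w : ℂ)‖ = w := by rw [Complex.norm_real, Real.norm_eq_abs, abs_of_pos hw0]
  have hαw : (αD : ℂ) * w = 1 / G.spacing μ := by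
    have h1 : (αD : ℂ) ≠ 0 := by exact_mod_cast hα.ne'
    have h2 : (G.spacing μ : ℂ) ≠ 0 := by exact_mod_cast hh.ne'
    rw [hw]
    push_cast
    field_simp
  cases fwd with
  | true =>
    obtain ⟨T, hT, hTi, hTz⟩ := exists_axis_stencil (n := n) hm μ ![(w : ℂ), -w, w]
      (by simp [hwn, -Complex.norm_real]; linarith) (B true μ) (hB true μ)
    refine ⟨T, hT, ?_, hTi⟩
    rw [hTz]
    ext s t
    simp only [diffOp, axisOp, Matrix.smul_apply, smul_eq_mul, if_true, forwardEntry]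
    by_cases h : ∀ ν i, ν ≠ μ → s (ν, i) = t (ν, i)
    · rw [if_pos h, if_pos h, if_congr (eq_comm (a := axisIndex t μ)) rfl rfl,
        if_congr (eq_comm (a := axisIndex t μ)) rfl rfl, div_eq_mul_one_div, ← hαw]
      simp only [Matrix.cons_val]
      ring
    · rw [if_neg h, if_neg h, mul_zero]
  | false =>
    -- The backward shift is the transpose of the forward one, so the backward difference is
    -- obtained as the adjoint of a stencil with corner B†.
    obtain ⟨T, hT, hTi, hTz⟩ := exists_axis_stencil (n := n) hm μ ![-(w : ℂ), w, w]
      (by simp [hwn, -Complex.norm_real]; linarith) (B false μ).conjTranspose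
      (by rw [specNorm_conjTranspose]; exact hB false μ)
    refine ⟨T.conjTranspose, Unitary.star_mem hT, ?_, ?_⟩
    · ext s t
      have hz : zeroBlock T.conjTranspose s t = star (zeroBlock T t s) := rfl
      rw [Matrix.smul_apply, hz, hTz]
      simp only [diffOp, axisOp, smul_eq_mul, Bool.false_eq_true, if_false, backwardEntry]
      have hst : (∀ ν i, ν ≠ μ → t (ν, i) = s (ν, i)) ↔ ∀ ν i, ν ≠ μ → s (ν, i) = t (ν, i) :=
        forall₃_congr fun _ _ _ => eq_comm
      rw [if_congr hst rfl rfl]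
      by_cases h : ∀ ν i, ν ≠ μ → s (ν, i) = t (ν, i)
      · rw [if_pos h, if_pos h, ← cornerEntry_conjTranspose,
          if_congr (eq_comm (a := axisIndex s μ) (b := axisIndex t μ + 1)) rfl rfl, div_eq_mul_one_div, ← hαw]
        simp only [Matrix.cons_val, star_add, star_mul', star_neg, apply_ite star, star_one,
          star_zero, RCLike.star_def, Complex.conj_ofReal]
        simp only [← RCLike.star_def]
        ring
      · rw [if_neg h, if_neg h, star_zero, mul_zero]
    · rw [← controlled_conjTranspose]
      exact hTi.conjTranspose

end Stencil

/-! ### Operators applied on a condition. -/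

section Conditional
variable {κ ι : Type} [Fintype κ] [DecidableEq κ] [Fintype ι] [DecidableEq ι]

/-- `N` applied on condition `c`, the identity otherwise. -/
def condOp (c : Bits κ → Bool) (N : Op κ) : Op κ :=
  fun x y => if c y then N x y else (1 : Op κ) x y

/-- The embedding under which the control qubit is a single work qubit. -/
def workCtrl (κ : Type) : Option κ ↪ κ ⊕ Fin 1 where
  toFun o := o.elim (Sum.inr 0) Sum.inl
  inj' := by
    rintro (_ | i) (_ | j) h <;> simp_all

/-- Rotation of the work qubit to `|1⟩` on condition `c`. -/
noncomputable def condRot (c : Bits κ → Bool) : Op (κ ⊕ Fin 1) :=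
  mux (Sum.inr 0) fun x => rot (if c (x ∘ Sum.inl) then Real.pi / 2 else 0)

theorem ignores_work {β : Type} (f : Bits κ → β) :
    Ignores (Sum.inr (0 : Fin 1)) fun x : Bits (κ ⊕ Fin 1) => f (x ∘ Sum.inl) := by
  intro x b
  refine congrArg f (funext fun i => ?_)
  simp

theorem embedOp_workCtrl_apply (N : Op κ) (x y : Bits κ) (a b : Bool) :
    embedOp (workCtrl κ) (controlled N) (Sum.elim x fun _ => a) (Sum.elim y fun _ => b) =
      if a = b then (if a then N x y else (1 : Op κ) x y) else 0 := by
  rw [embedOp_of_agree]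
  · rfl
  · rintro (i | i) h
    · exact absurd rfl (h (some i))
    · exact absurd (congrArg Sum.inr (Subsingleton.elim _ _)) (h none)

theorem update_work (x : Bits κ) (a b : Bool) :
    Function.update (Sum.elim x fun _ : Fin 1 => a) (Sum.inr 0) b = Sum.elim x fun _ => b := by
  funext i
  rcases i with i | i
  · simp
  · rw [Subsingleton.elim i 0]
    simp

/-- The condition is computed into a clean work qubit, which controls N, and is then uncomputed. The
work qubit returns to |0⟩ because N connects only states with the same value of c. -/
theorem implements_condOp {c : Bits κ → Bool} {N : Op κ} (hN : ∀ x y, N x y ≠ 0 → c x = c y) :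
    Implements ((condRot c).conjTranspose * (embedOp (workCtrl κ) (controlled N) * condRot c))
      (condOp c N) := by
  have key : ∀ x y a, ((condRot c).conjTranspose * (embedOp (workCtrl κ) (controlled N) *
      condRot c)) (Sum.elim x fun _ => a) (Sum.elim y fun _ => false) =
      if a then 0 else condOp c N x y := by
    intro x y a
    have hig := ignores_work (κ := κ) fun x => rot (if c x then Real.pi / 2 else 0)
    rw [condRot, mux_conjTranspose hig, mux_mul_apply (hig.comp _)]
    simp only [mul_mux_apply, Fintype.sum_bool, update_work, embedOp_workCtrl_apply]
    by_cases h : N x y = 0 ∧ x ≠ y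
    · have h1 : (1 : Op κ) x y = 0 := Matrix.one_apply_ne h.2
      simp [h.1, h1, condOp]
    · have hc : c x = c y := by
        by_cases hxy : x = y
        · rw [hxy]
        · exact hN x y fun h0 => h ⟨h0, hxy⟩
      have e : ∀ z : Bits κ, ∀ a, (Sum.elim z fun _ : Fin 1 => a) ∘ Sum.inl = z :=
        fun _ _ => rfl
      simp only [e, hc, condOp, Sum.elim_inr, Matrix.conjTranspose_apply]
      cases c y <;> cases a <;> simp [rot_half_pi_apply, rot_zero]
  intro x z y
  have hz : z = fun _ => z 0 := funext fun i => by rw [Subsingleton.elim i 0]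
  rw [hz, key]
  constructor
  · intro h
    simp [h 0]
  · rintro ⟨i, hi⟩
    simp [hi]


/-- Operators applied one after the other, each on its own condition. -/
def condProd {I : Type} (c : I → Bits κ → Bool) (N : I → Op κ) : List I → Op κ
  | [] => 1
  | i :: l => condProd c N l * condOp (c i) (N i)

section
variable {I : Type} {c : I → Bits κ → Bool} {N : I → Op κ}

theorem condProd_of_none {l : List I} {y : Bits κ} (h : ∀ i ∈ l, c i y = false) (x : Bits κ) :
    condProd c N l x y = (1 : Op κ) x y := by
  induction l generalizing x with
  | nil => rfl
  | cons i l ih =>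
    rw [condProd, mul_apply_of_right, ih fun j hj => h j (List.mem_cons_of_mem _ hj)]
    intro z
    rw [condOp, h i List.mem_cons_self]
    rfl

/-- Every operator preserves all conditions, and at most one condition holds. So the factors before
and after the i-th act as the identity. -/
theorem condProd_of_mem (hN : ∀ i j x y, N i x y ≠ 0 → c j x = c j y)
    (hdisj : ∀ i j y, c i y = true → c j y = true → i = j) {l : List I} (hl : l.Nodup) {i : I}
    (hi : i ∈ l) {y : Bits κ} (hy : c i y = true) (x : Bits κ) :
    condProd c N l x y = N i x y := by
  induction l with
  | nil => simp at hi
  | cons j l ih =>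
    rw [condProd]
    rw [List.nodup_cons] at hl
    by_cases hj : j = i
    · subst hj
      have e : ∀ z, condOp (c j) (N j) z y = N j z y := fun z => by rw [condOp, if_pos hy]
      rw [mul_apply_of_left, e]
      intro z hz
      rw [e] at hz
      refine condProd_of_none (fun k hk => ?_) x
      by_contra hck
      rw [Bool.not_eq_false, hN j k z y hz] at hck
      exact hl.1 (hdisj _ _ _ hy hck ▸ hk)
    · rw [mul_apply_of_right, ih hl.2 ((List.mem_cons.mp hi).resolve_left (Ne.symm hj))]
      intro z
      rw [condOp, if_neg]
      exact fun h => hj (hdisj _ _ _ h hy)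

end

end Conditional

/-! ### Zero blocks of products of block-encodings. -/

section Blocks
variable {σ τ T κ ι : Type} [Fintype σ] [DecidableEq σ] [Fintype τ] [DecidableEq τ]
  [Fintype T] [DecidableEq T] [Fintype κ] [DecidableEq κ] [Fintype ι] [DecidableEq ι]

/-- An operator on `σ ⊕ τ` on a larger ancilla register. -/
def onAnc (F : τ ↪ T) (A : Op (σ ⊕ τ)) : Op (σ ⊕ T) :=
  embedOp ((Function.Embedding.refl σ).sumMap F) A

theorem onAnc_eq_zero {F : τ ↪ T} {A : Op (σ ⊕ τ)} {x y : Bits (σ ⊕ T)} {k : T}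
    (hk : ∀ j, F j ≠ k) (h : x (Sum.inr k) ≠ y (Sum.inr k)) : onAnc F A x y = 0 := by
  refine embedOp_of_ne (i := Sum.inr k) ?_ h
  rintro (j | j) hj
  · simp at hj
  · exact hk j (Sum.inr.inj hj)

/-- In the sum over intermediate states of the ancillas F of A, only |0…0⟩ survives. N' is allowed
to differ from N by a device that suppresses the other terms. -/
theorem zeroBlock_onAnc_mul (F : τ ↪ T) (A : Op (σ ⊕ τ)) {N N' : Op (σ ⊕ T)}
    (h : ∀ (r : Bits τ) (s t : Bits σ),
      N' (Sum.elim s (Function.extend F r fun _ => false)) (Sum.elim t fun _ => false) =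
        if r = fun _ => false then N (Sum.elim s fun _ => false) (Sum.elim t fun _ => false)
          else 0) :
    zeroBlock (onAnc F A * N') = zeroBlock A * zeroBlock N := by
  ext s t
  rw [Matrix.mul_apply]
  simp only [zeroBlock, onAnc]
  rw [embedOp_mul_apply, ← (Equiv.sumArrowEquivProdArrow σ τ Bool).symm.sum_comp,
    Fintype.sum_prod_type]
  refine Finset.sum_congr rfl fun u _ => ?_
  have e : ∀ r : Bits τ, Function.extend ((Function.Embedding.refl σ).sumMap F)
      ((Equiv.sumArrowEquivProdArrow σ τ Bool).symm (u, r)) (Sum.elim s fun _ => false) =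
      Sum.elim u (Function.extend F r fun _ => false) := fun r => by
    funext i
    rcases i with i | i
    · exact ((Function.Embedding.refl σ).sumMap F).injective.extend_apply _ _ (Sum.inl i)
    · by_cases hi : ∃ j, F j = i
      · obtain ⟨j, rfl⟩ := hi
        rw [Sum.elim_inr, F.injective.extend_apply]
        exact ((Function.Embedding.refl σ).sumMap F).injective.extend_apply _ _ (Sum.inr j)
      · push Not at hi
        rw [Sum.elim_inr, extend_off F r _ hi, extend_off]
        · rfl
        · rintro (k | k) hk
          · simp at hk
          · exact hi k (Sum.inr.inj hk)
  simp only [e, h]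
  rw [Finset.sum_eq_single fun _ => false]
  · rw [if_pos rfl]
    congr 2
    funext i
    rcases i with i | i <;> rfl
  · intro r _ hr
    rw [if_neg hr, mul_zero]
  · simp

/-- If N conserves the ancillas of A, these are still |0…0⟩ when A is applied, so no cross terms
arise. -/
theorem zeroBlock_onAnc_mul_of_fixes (F : τ ↪ T) (A : Op (σ ⊕ τ)) {N : Op (σ ⊕ T)}
    (h : ∀ x y k, x (Sum.inr (F k)) ≠ y (Sum.inr (F k)) → N x y = 0) :
    zeroBlock (onAnc F A * N) = zeroBlock A * zeroBlock N := by
  refine zeroBlock_onAnc_mul F A fun r s t => ?_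
  by_cases hr : r = fun _ => false
  · rw [if_pos hr, hr]
    congr 2
    funext i
    by_cases hi : ∃ j, F j = i
    · obtain ⟨j, rfl⟩ := hi
      rw [F.injective.extend_apply]
    · push Not at hi
      rw [extend_off F _ _ hi]
  · rw [if_neg hr]
    obtain ⟨k, hk⟩ := Function.ne_iff.mp hr
    refine h _ _ k ?_
    rw [Sum.elim_inr, Sum.elim_inr, F.injective.extend_apply]
    exact hk

theorem zeroBlock_one : zeroBlock (1 : Op (σ ⊕ τ)) = 1 := by
  ext s t
  unfold zeroBlock
  rw [Matrix.one_apply, Matrix.one_apply]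
  refine if_congr ⟨fun h => ?_, fun h => by rw [h]⟩ rfl rfl
  exact funext fun i => congrFun h (Sum.inl i)

theorem zeroBlock_onAnc (F : τ ↪ T) (A : Op (σ ⊕ τ)) : zeroBlock (onAnc F A) = zeroBlock A := by
  have h := zeroBlock_onAnc_mul_of_fixes F A (N := 1) fun x y k hk =>
    Matrix.one_apply_ne fun h => hk (by rw [h])
  rwa [mul_one, zeroBlock_one, Matrix.mul_one] at h

theorem zeroBlock_conjTranspose (A : Op (σ ⊕ τ)) :
    zeroBlock A.conjTranspose = (zeroBlock A).conjTranspose := rfl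

/-- Rotation of the qubit `t` to `|1⟩` unless all qubits of `F` are in `|0⟩`. -/
noncomputable def flagNonzero (F : τ ↪ T) (t : T) : Op (σ ⊕ T) :=
  mux (Sum.inr t) fun x => rot (if ∀ k, x (Sum.inr (F k)) = false then 0 else Real.pi / 2)

/-- A and B share their ancillas, so AB alone would collect intermediate states with nonzero
ancillas. These rotate the flag t to |1⟩, A does not touch t, and so they do not contribute to the
zero block. -/
theorem zeroBlock_adjoint_flagNonzero (F : τ ↪ T) {t : T} (ht : ∀ k, F k ≠ t) (A B : Op (σ ⊕ τ)) :
    zeroBlock (onAnc F A * (flagNonzero F t * onAnc F B)) = zeroBlock A * zeroBlock B := by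
  rw [zeroBlock_onAnc_mul F A (N := onAnc F B), zeroBlock_onAnc]
  intro r s u
  have hig : Ignores (Sum.inr t : σ ⊕ T) fun x : Bits (σ ⊕ T) =>
      rot (if ∀ k, x (Sum.inr (F k)) = false then 0 else Real.pi / 2) := by
    intro x b
    refine congrArg rot (if_congr (forall_congr' fun k => ?_) rfl rfl)
    rw [Function.update_of_ne]
    exact fun h => ht k (Sum.inr.inj h)
  rw [flagNonzero, mux_mul_apply hig, Fintype.sum_bool, onAnc_eq_zero ht (by simp), mul_zero,
    zero_add]
  have e0 : (Sum.elim s (Function.extend F r fun _ => false) : Bits (σ ⊕ T)) (Sum.inr t) = false := by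
    rw [Sum.elim_inr, extend_off F _ _ ht]
  have eu : Function.update (Sum.elim s (Function.extend F r fun _ => false) : Bits (σ ⊕ T))
      (Sum.inr t) false = Sum.elim s (Function.extend F r fun _ => false) :=
    Function.update_eq_self_iff.mpr e0.symm
  rw [e0, eu]
  simp only [Sum.elim_inr, F.injective.extend_apply]
  by_cases hr : r = fun _ => false
  · rw [if_pos fun k => congrFun hr k, if_pos hr, rot_zero, Matrix.one_apply_eq, one_mul]
    congr 2
    rw [hr]
    funext i
    by_cases hi : ∃ j, F j = i
    · obtain ⟨j, rfl⟩ := hi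
      rw [F.injective.extend_apply]
    · push Not at hi
      rw [extend_off F _ _ hi]
  · rw [if_neg fun h => hr (funext h), if_neg hr, rot_half_pi_apply, if_pos rfl, zero_mul]

theorem hasCtrlCircuit_flagNonzero [Nontrivial (σ ⊕ T)] (F : τ ↪ T) {t : T} (ht : ∀ k, F k ≠ t) :
    HasCtrlCircuit (flagNonzero (σ := σ) F t) (6 * 2 ^ Fintype.card τ) := by
  unfold flagNonzero
  have h := hasCtrlCircuit_mux_rot (κ := σ ⊕ T) (t := Sum.inr t)
    ((Finset.univ : Finset τ).toList.map fun k => Sum.inr (F k)) (by simpa using ht)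
    (θ := fun x => if ∀ k, x (Sum.inr (F k)) = false then 0 else Real.pi / 2) (by
      intro x y hxy
      refine if_congr (forall_congr' fun k => ?_) rfl rfl
      rw [hxy (Sum.inr (F k)) (by simp)])
  simpa using h

theorem flagNonzero_eq_zero {F : τ ↪ T} {t k : T} (hk : k ≠ t) {x y : Bits (σ ⊕ T)}
    (h : x (Sum.inr k) ≠ y (Sum.inr k)) : flagNonzero F t x y = 0 := by
  unfold flagNonzero mux
  rw [if_neg]
  exact fun h' => h (h' _ (by simpa using hk))

end Blocks

/-! ### Bitwise addition of one register to another. -/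

section Permutation
variable {ι : Type} [Fintype ι] [DecidableEq ι]

/-- The permutation matrix of an involution of the basis states. -/
def permOp (π : Bits ι → Bits ι) : Op ι := fun x y => if π x = y then 1 else 0

theorem permOp_mul_apply (π : Bits ι → Bits ι) (N : Op ι) (x y : Bits ι) :
    (permOp π * N) x y = N (π x) y := by
  rw [Matrix.mul_apply]
  simp [permOp]

/-- Add the qubits `q.1` to the qubits `q.2`, modulo 2. -/
def addBits (l : List (ι × ι)) (x : Bits ι) : Bits ι :=
  l.foldl (fun x q => Function.update x q.2 (xor (x q.2) (x q.1))) x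

theorem hasCircuit_addBits (l : List (ι × ι)) (hl : ∀ q ∈ l, q.1 ≠ q.2) :
    HasCircuit (permOp (addBits l)) l.length := by
  induction l with
  | nil =>
    have : permOp (addBits []) = (1 : Op ι) := by
      ext x y
      rw [Matrix.one_apply]
      rfl
    rw [this]
    exact HasCircuit.one
  | cons q l ih =>
    have h1 := hasCircuit_mux_pair (hl q List.mem_cons_self).symm
      (G := fun b => if b then flipMat else 1) (fun b => by
        cases b
        · exact one_mem _
        · exact flip_mem_unitary)
    have h2 := h1.mul (ih fun r hr => hl r (List.mem_cons_of_mem _ hr))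
    have e : permOp (addBits (q :: l)) =
        mux q.2 (fun x => if x q.1 then flipMat else 1) * permOp (addBits l) := by
      ext x y
      rw [mux_mul_apply]
      · have e : permOp (addBits (q :: l)) x y =
            permOp (addBits l) (Function.update x q.2 (xor (x q.2) (x q.1))) y := rfl
        rw [e, Fintype.sum_bool]
        cases hx1 : x q.1 <;> cases hx2 : x q.2 <;> simp [flipMat]
      · intro x b
        beta_reduce
        rw [Function.update_of_ne (hl q List.mem_cons_self)]
    rw [e]
    exact h2.mono (by simp [add_comm])

theorem addBits_apply_of_notMem {l : List (ι × ι)} {i : ι} (hi : ∀ q ∈ l, q.2 ≠ i) (x : Bits ι) :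
    addBits l x i = x i := by
  induction l generalizing x with
  | nil => rfl
  | cons q l ih =>
    have := ih (fun r hr => hi r (List.mem_cons_of_mem _ hr))
      (Function.update x q.2 (xor (x q.2) (x q.1)))
    rw [Function.update_of_ne (hi q List.mem_cons_self).symm] at this
    exact this

theorem addBits_apply {l : List (ι × ι)} (hl : (l.map Prod.snd).Nodup)
    (hd : ∀ q ∈ l, ∀ r ∈ l, q.1 ≠ r.2) {q : ι × ι} (hq : q ∈ l) (x : Bits ι) :
    addBits l x q.2 = xor (x q.2) (x q.1) := by
  induction l generalizing x with
  | nil => simp at hq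
  | cons p l ih =>
    rw [List.map_cons, List.nodup_cons] at hl
    have e : addBits (p :: l) x = addBits l (Function.update x p.2 (xor (x p.2) (x p.1))) := rfl
    rw [e]
    rcases List.mem_cons.mp hq with rfl | hq'
    · rw [addBits_apply_of_notMem, Function.update_self]
      exact fun r hr h => hl.1 (List.mem_map.mpr ⟨r, hr, h⟩)
    · rw [ih hl.2 (fun r hr s hs => hd r (List.mem_cons_of_mem _ hr) s (List.mem_cons_of_mem _ hs))
        hq', Function.update_of_ne, Function.update_of_ne]
      · exact hd q hq p List.mem_cons_self
      · exact fun h => hl.1 (List.mem_map.mpr ⟨q, hq', h⟩)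

end Permutation

/-! ### Sums over the label register and the uniform superposition. -/

section Labels

theorem sum_bitsVal {m : ℕ} {E : Type} [AddCommMonoid E] (f : ℕ → E) :
    ∑ r : Bits (Fin m), f (bitsVal r) = ∑ l ∈ Finset.range (2 ^ m), f l := by
  refine Finset.sum_bij (fun r _ => bitsVal r) (fun r _ => Finset.mem_range.mpr (bitsVal_lt r))
    (fun r _ s _ h => bitsVal_injective h) (fun l hl => ?_) fun _ _ => rfl
  obtain ⟨r, hr⟩ := exists_bitsVal (Finset.mem_range.mp hl)
  exact ⟨r, Finset.mem_univ _, hr⟩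

theorem bitsVal_zero {m : ℕ} : bitsVal (fun _ : Fin m => false) = 0 := by
  simp [bitsVal]

theorem bitsVal_eq_zero_iff {m : ℕ} {r : Bits (Fin m)} : bitsVal r = 0 ↔ ∀ j, r j = false :=
  ⟨fun h => congrFun (bitsVal_injective (h.trans bitsVal_zero.symm)), fun h => by
    rw [funext h]; exact bitsVal_zero⟩

theorem sum_label {m l : ℕ} (P : Bits (Fin m) → Prop) [DecidablePred P] (c : ℂ)
    {r₀ : Bits (Fin m)} (hr₀ : bitsVal r₀ = l) :
    ∑ r : Bits (Fin m), (if bitsVal r = l ∧ P r then c else 0) = if P r₀ then c else 0 := by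
  rw [Finset.sum_eq_single r₀]
  · simp [hr₀]
  · intro r _ hr
    rw [if_neg fun h => hr (bitsVal_injective (h.1.trans hr₀.symm))]
  · simp

/-- The selector changes from v to u = v xor l. For v = l this forces u = 0, so label l yields the
block (0, l); `sum_label_col` is the transposed case. -/
theorem sum_label_row {m l : ℕ} (hl : l < 2 ^ m) (u v : Bits (Fin m)) (c : ℂ) :
    ∑ r : Bits (Fin m), (if bitsVal r = l ∧ bitsVal v = l ∧ ∀ j, xor (u j) (r j) = v j
      then c else 0) = if bitsVal u = 0 ∧ bitsVal v = l then c else 0 := by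
  obtain ⟨r₀, hr₀⟩ := exists_bitsVal hl
  rw [sum_label _ c hr₀]
  refine if_congr ⟨fun h => ⟨?_, h.1⟩, fun h => ⟨h.2, ?_⟩⟩ rfl rfl
  · rw [bitsVal_eq_zero_iff]
    intro j
    have h1 := h.2 j
    rw [bitsVal_injective (h.1.trans hr₀.symm)] at h1
    revert h1
    cases u j <;> cases r₀ j <;> simp
  · intro j
    rw [bitsVal_eq_zero_iff.mp h.1 j, bitsVal_injective (h.2.trans hr₀.symm), Bool.false_xor]

theorem sum_label_col {m l : ℕ} (hl : l < 2 ^ m) (u v : Bits (Fin m)) (c : ℂ) :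
    ∑ r : Bits (Fin m), (if bitsVal r = l ∧ bitsVal v = 0 ∧ ∀ j, xor (u j) (r j) = v j
      then c else 0) = if bitsVal u = l ∧ bitsVal v = 0 then c else 0 := by
  obtain ⟨r₀, hr₀⟩ := exists_bitsVal hl
  rw [sum_label _ c hr₀]
  refine if_congr ⟨fun h => ⟨?_, h.1⟩, fun h => ⟨h.2, ?_⟩⟩ rfl rfl
  · rw [← hr₀]
    congr 1
    funext j
    have h1 := h.2 j
    rw [bitsVal_eq_zero_iff.mp h.1 j] at h1
    revert h1
    cases u j <;> cases r₀ j <;> simp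
  · intro j
    rw [bitsVal_eq_zero_iff.mp h.2 j, bitsVal_injective (h.1.trans hr₀.symm), Bool.xor_self]

theorem exists_uniform_prep {m N : ℕ} [Nontrivial (Fin m)] (hN : 0 < N) (hNm : N ≤ 2 ^ m) :
    ∃ P : Op (Fin m), HasCtrlCircuit P (14 * 2 ^ m) ∧ ∀ r,
      star (P r fun _ => false) * P r (fun _ => false) =
        if bitsVal r < N then 1 / (N : ℂ) else 0 := by
  have hN' : (0 : ℝ) < N := by exact_mod_cast hN
  obtain ⟨P, hP, hPr⟩ := exists_prep (κ := Fin m)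
    (fun r => if bitsVal r < N then ((1 / Real.sqrt N : ℝ) : ℂ) else 0) (by
      have := sum_bitsVal (m := m) fun l =>
        ‖(if l < N then ((1 / Real.sqrt N : ℝ) : ℂ) else 0)‖ ^ 2
      rw [this, ← Finset.sum_subset (Finset.range_subset_range.mpr hNm)]
      · rw [Finset.sum_congr rfl fun l hl => by rw [if_pos (Finset.mem_range.mp hl)]]
        rw [Finset.sum_const, Finset.card_range, Complex.norm_real, Real.norm_eq_abs, sq_abs,
          div_pow, Real.sq_sqrt hN'.le, nsmul_eq_mul]
        field_simp
      · intro l _ hl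
        rw [if_neg fun h => hl (Finset.mem_range.mpr h)]
        simp)
  refine ⟨P, by simpa using hP, fun r => ?_⟩
  rw [hPr]
  split_ifs
  · rw [RCLike.star_def, Complex.conj_ofReal, ← Complex.ofReal_mul, div_mul_div_comm,
      Real.mul_self_sqrt hN'.le]
    simp
  · simp

end Labels

/-! ### Oracle uses and lengths of expanded circuits. -/

section QueryCounts
variable {d : ℕ} {κ δ ι ω : Type}

theorem QueryCircuit.coeffUses_append (P Q : QueryCircuit d κ δ ι) (q : CoeffCall) :
    QueryCircuit.coeffUses (P ++ Q) q = P.coeffUses q + Q.coeffUses q := List.countP_append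

theorem QueryCircuit.diffUses_append (P Q : QueryCircuit d κ δ ι) (fwd : Bool) (μ : Fin d) :
    QueryCircuit.diffUses (P ++ Q) fwd μ = P.diffUses fwd μ + Q.diffUses fwd μ :=
  List.countP_append

theorem QueryCircuit.coeffUses_gates (P : Circuit ι) (q : CoeffCall) :
    QueryCircuit.coeffUses (P.map Instr.gate : QueryCircuit d κ δ ι) q = 0 := by
  simp [QueryCircuit.coeffUses, List.countP_eq_zero]

theorem QueryCircuit.diffUses_gates (P : Circuit ι) (fwd : Bool) (μ : Fin d) :
    QueryCircuit.diffUses (P.map Instr.gate : QueryCircuit d κ δ ι) fwd μ = 0 := by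
  simp [QueryCircuit.diffUses, List.countP_eq_zero]

open Classical in
theorem QueryCircuit.coeffUses_coeff (p q : CoeffCall) (e : Option κ ↪ ι) :
    QueryCircuit.coeffUses ([Instr.coeff p e] : QueryCircuit d κ δ ι) q = if p = q then 1 else 0 := by
  by_cases h : p = q
  · subst h
    simp [QueryCircuit.coeffUses]
  · simp [QueryCircuit.coeffUses, h]

theorem QueryCircuit.coeffUses_diff (fwd : Bool) (μ : Fin d) (q : CoeffCall) (e : Option δ ↪ ι) :
    QueryCircuit.coeffUses ([Instr.diff fwd μ e] : QueryCircuit d κ δ ι) q = 0 := by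
  simp [QueryCircuit.coeffUses]

theorem QueryCircuit.diffUses_coeff (fwd : Bool) (μ : Fin d) (q : CoeffCall) (e : Option κ ↪ ι) :
    QueryCircuit.diffUses ([Instr.coeff q e] : QueryCircuit d κ δ ι) fwd μ = 0 := by
  simp [QueryCircuit.diffUses]

theorem QueryCircuit.diffUses_diff (fwd fwd' : Bool) (μ μ' : Fin d) (e : Option δ ↪ ι) :
    QueryCircuit.diffUses ([Instr.diff fwd' μ' e] : QueryCircuit d κ δ ι) fwd μ =
      if fwd' = fwd ∧ μ' = μ then 1 else 0 := by
  by_cases h : fwd' = fwd ∧ μ' = μ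
  · obtain ⟨rfl, rfl⟩ := h
    simp [QueryCircuit.diffUses]
  · rw [if_neg h]
    simp only [not_and] at h
    simpa [QueryCircuit.diffUses] using h

theorem QueryCircuit.coeffUses_flatMap {I : Type} [Fintype I] (f : I → QueryCircuit d κ δ ι)
    (q : CoeffCall) :
    QueryCircuit.coeffUses ((Finset.univ : Finset I).toList.flatMap f) q =
      ∑ i, (f i).coeffUses q := by
  rw [QueryCircuit.coeffUses, List.countP_flatMap, ← Finset.sum_map_toList]
  rfl

theorem QueryCircuit.diffUses_flatMap {I : Type} [Fintype I] (f : I → QueryCircuit d κ δ ι)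
    (fwd : Bool) (μ : Fin d) :
    QueryCircuit.diffUses ((Finset.univ : Finset I).toList.flatMap f) fwd μ =
      ∑ i, (f i).diffUses fwd μ := by
  rw [QueryCircuit.diffUses, List.countP_flatMap, ← Finset.sum_map_toList]
  rfl

variable (FU : CoeffCall → Circuit (Option κ ⊕ ω)) (FV : Bool → Fin d → Circuit (Option δ ⊕ ω))

theorem QueryCircuit.expand_append (P Q : QueryCircuit d κ δ ι) :
    QueryCircuit.expand FU FV (P ++ Q) = P.expand FU FV ++ Q.expand FU FV := List.flatMap_append

theorem QueryCircuit.length_expand_gates (P : Circuit ι) :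
    (QueryCircuit.expand FU FV (P.map Instr.gate : QueryCircuit d κ δ ι)).length = P.length := by
  simp [QueryCircuit.expand, List.length_flatMap, Instr.expand, Function.comp_def]

theorem QueryCircuit.length_expand_coeff (q : CoeffCall) (e : Option κ ↪ ι) :
    (QueryCircuit.expand FU FV ([Instr.coeff q e] : QueryCircuit d κ δ ι)).length =
      (FU q).length := by
  simp [QueryCircuit.expand, Instr.expand]

theorem QueryCircuit.length_expand_diff (fwd : Bool) (μ : Fin d) (e : Option δ ↪ ι) :
    (QueryCircuit.expand FU FV ([Instr.diff fwd μ e] : QueryCircuit d κ δ ι)).length =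
      (FV fwd μ).length := by
  simp [QueryCircuit.expand, Instr.expand]

theorem QueryCircuit.length_expand_flatMap_le {I : Type} [Fintype I]
    (f : I → QueryCircuit d κ δ ι) {k : ℕ} (h : ∀ i, ((f i).expand FU FV).length ≤ k) :
    (QueryCircuit.expand FU FV ((Finset.univ : Finset I).toList.flatMap f)).length ≤
      Fintype.card I * k := by
  have e : QueryCircuit.expand FU FV ((Finset.univ : Finset I).toList.flatMap f) =
      (Finset.univ : Finset I).toList.flatMap fun i => (f i).expand FU FV := by
    simp only [QueryCircuit.expand, List.flatMap_assoc]
  rw [e, List.length_flatMap, Finset.sum_map_toList]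
  calc ∑ i, ((f i).expand FU FV).length ≤ ∑ _i : I, k := Finset.sum_le_sum fun i _ => h i
    _ = Fintype.card I * k := by simp

end QueryCounts

/-! ### Unitarity of circuits with oracle calls, and sequences of conditional branches. -/

section
variable {d : ℕ} {κ δ ι : Type} [Fintype κ] [DecidableEq κ] [Fintype δ] [DecidableEq δ]
  [Fintype ι] [DecidableEq ι]

theorem controlled_mem_unitary {M : Op κ} (hM : M ∈ Matrix.unitaryGroup (Bits κ) ℂ) :
    controlled M ∈ Matrix.unitaryGroup (Bits (Option κ)) ℂ := by
  rw [Matrix.mem_unitaryGroup_iff, Matrix.star_eq_conjTranspose] at hM ⊢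
  rw [controlled_conjTranspose, ← controlled_mul, hM, controlled_one]

theorem QueryCircuit.op_mem_unitary {U : Coeff → Op κ} {V : Bool → Fin d → Op δ}
    (hU : ∀ g, U g ∈ Matrix.unitaryGroup (Bits κ) ℂ)
    (hV : ∀ fwd μ, V fwd μ ∈ Matrix.unitaryGroup (Bits δ) ℂ) (Q : QueryCircuit d κ δ ι) :
    Q.op U V ∈ Matrix.unitaryGroup (Bits ι) ℂ := by
  induction Q with
  | nil => exact one_mem _
  | cons g Q ih =>
    refine mul_mem ih ?_
    cases g with
    | gate g => exact embedOp_mem_unitary _ g.unitary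
    | coeff q e =>
      refine embedOp_mem_unitary _ (controlled_mem_unitary ?_)
      cases q with
      | direct g => exact hU g
      | adjInvSqrtRho => exact Unitary.star_mem (hU _)
    | diff fwd μ e => exact embedOp_mem_unitary _ (controlled_mem_unitary (hV fwd μ))

theorem QueryCircuit.op_flatMap_implements {ω I : Type} [Fintype ω] [DecidableEq ω]
    {U : Coeff → Op κ} {V : Bool → Fin d → Op δ} (f : I → QueryCircuit d κ δ (ι ⊕ ω))
    {c : I → Bits ι → Bool} {N : I → Op ι}
    (h : ∀ i, Implements ((f i).op U V) (condOp (c i) (N i))) (l : List I) :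
    Implements (QueryCircuit.op U V (l.flatMap f)) (condProd c N l) := by
  induction l with
  | nil => exact Implements.one
  | cons i l ih =>
    rw [List.flatMap_cons, QueryCircuit.op_append]
    exact ih.mul (h i)

end

/-! ### The branches of the second-order operator. -/

/-- The branches of the linear combination: `inl false` is the damping term, `inl true` is the
mass term, `inr (fwd, μ)` is a difference operator. -/
abbrev Branch (d : ℕ) : Type := Bool ⊕ (Bool × Fin d)

/-- The labels `l` and the selector values `s` for which a branch is executed. -/
def Branch.cond {d : ℕ} : Branch d → ℕ → ℕ → Bool
  | .inl false, l, s => decide (l = 0 ∧ s = 0)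
  | .inl true, l, s => decide (l = d + 1 ∧ (s = 0 ∨ s = d + 1))
  | .inr (true, μ), l, s => decide (l = μ + 1 ∧ s = μ + 1)
  | .inr (false, μ), l, s => decide (l = μ + 1 ∧ s = 0)

/-- Label μ+1 serves the backward difference at selector 0 and the forward difference at selector
μ+1. Since the selector tells them apart, d+2 labels suffice for all 2d+3 blocks. -/
theorem Branch.cond_unique {d : ℕ} : ∀ (i j : Branch d) {l s : ℕ}, i.cond l s = true →
    j.cond l s = true → i = j := by
  rintro ((_ | _) | ⟨_ | _, μ⟩) ((_ | _) | ⟨_ | _, ν⟩) l s <;>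
    simp only [Branch.cond, decide_eq_true_eq] <;> intro h h' <;>
    first | trivial | omega | (obtain rfl : μ = ν := Fin.ext (by omega); rfl)

theorem Branch.cond_lt {d : ℕ} : ∀ (i : Branch d) {l s : ℕ}, i.cond l s = true → l < d + 2 := by
  rintro ((_ | _) | ⟨_ | _, μ⟩) l s <;> simp only [Branch.cond, decide_eq_true_eq] <;> intro h <;>
    omega

/-- The signed amplitudes of the branches. -/
def Branch.amp {d : ℕ} (aζ aγ aD : ℝ) : Branch d → ℕ → ℝ
  | .inl false, _ => aζ
  | .inl true, s => if s = 0 then -aγ else aγ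
  | .inr _, _ => -aD

/-- The amplitude with label `l` and selector value `s`. -/
def labelAmp (d : ℕ) (aζ aγ aD : ℝ) (l s : ℕ) : ℝ :=
  ∑ i : Branch d, if i.cond l s then i.amp aζ aγ aD s else 0

theorem labelAmp_of_cond {d : ℕ} (aζ aγ aD : ℝ) {l s : ℕ} {i : Branch d}
    (h : i.cond l s = true) : labelAmp d aζ aγ aD l s = i.amp aζ aγ aD s := by
  rw [labelAmp, Finset.sum_eq_single i, if_pos h]
  · intro j _ hj
    rw [if_neg fun h' => hj (j.cond_unique i h' h)]
  · simp

theorem labelAmp_of_none {d : ℕ} (aζ aγ aD : ℝ) {l s : ℕ}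
    (h : ∀ i : Branch d, i.cond l s = false) : labelAmp d aζ aγ aD l s = 0 :=
  Finset.sum_eq_zero fun i _ => by rw [if_neg (by rw [h i]; exact Bool.false_ne_true)]

theorem abs_labelAmp_le {d : ℕ} {aζ aγ aD : ℝ} (hζ : |aζ| ≤ 1) (hγ : |aγ| ≤ 1) (hD : |aD| ≤ 1)
    (l s : ℕ) : |labelAmp d aζ aγ aD l s| ≤ 1 := by
  by_cases h : ∃ i : Branch d, i.cond l s = true
  · obtain ⟨i, hi⟩ := h
    rw [labelAmp_of_cond aζ aγ aD hi]
    rcases i with (_ | _) | i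
    · exact hζ
    · simp only [Branch.amp]
      split_ifs
      · rwa [abs_neg]
      · exact hγ
    · simpa [Branch.amp] using hD
  · push Not at h
    rw [labelAmp_of_none aζ aγ aD fun i => Bool.eq_false_of_not_eq_true (h i)]
    simp

/-- The ancillas of the two coefficient oracles and of the difference oracle. -/
abbrev BodyAnc (d K : ℕ) : Type := FourierAnc d K ⊕ (FourierAnc d K ⊕ Fin 3)

/-- The system qubits with the ancillas of the oracles. -/
abbrev Body (d n K : ℕ) : Type := Sys d n ⊕ BodyAnc d K

/-- The register of the block-encoding. -/
abbrev Reg (d n a : ℕ) : Type := (Sel d ⊕ Sys d n) ⊕ Fin a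

section Body
variable {d n K : ℕ}

abbrev firstAnc (d K : ℕ) : FourierAnc d K ↪ BodyAnc d K := Function.Embedding.inl

abbrev secondAnc (d K : ℕ) : FourierAnc d K ↪ BodyAnc d K :=
  Function.Embedding.inl.trans Function.Embedding.inr

abbrev diffAnc (d K : ℕ) : Fin 3 ↪ BodyAnc d K :=
  Function.Embedding.inr.trans Function.Embedding.inr

variable (U : Coeff → Op (Sys d n ⊕ FourierAnc d K)) (V : Bool → Fin d → Op (Sys d n ⊕ Fin 3))

/-- The operators of the branches. -/
noncomputable def Branch.bodyOp : Branch d → Op (Body d n K)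
  -- The difference ancillas are idle in this branch, so one of them can hold the flag.
  | .inl false => onAnc (secondAnc d K) (U .zeta) *
      (onAnc (firstAnc d K) (U .invSqrtRho).conjTranspose *
        (flagNonzero (firstAnc d K) (diffAnc d K 0) * onAnc (firstAnc d K) (U .invSqrtRho)))
  | .inl true => onAnc (firstAnc d K) (U .invSqrtRho) * onAnc (secondAnc d K) (U .sqrtGamma)
  | .inr (true, μ) => onAnc (firstAnc d K) (U .invSqrtRho) *
      (onAnc (diffAnc d K) (V true μ) * onAnc (secondAnc d K) (U .sqrtKappa))
  | .inr (false, μ) => onAnc (secondAnc d K) (U .sqrtKappa) *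
      (onAnc (diffAnc d K) (V false μ) * onAnc (firstAnc d K) (U .invSqrtRho))

/-- The operators on the system that are block-encoded by the branches. -/
def Branch.block : Branch d → Op (Sys d n)
  | .inl false => zeroBlock (U .zeta) *
      ((zeroBlock (U .invSqrtRho)).conjTranspose * zeroBlock (U .invSqrtRho))
  | .inl true => zeroBlock (U .invSqrtRho) * zeroBlock (U .sqrtGamma)
  | .inr (true, μ) => zeroBlock (U .invSqrtRho) * (zeroBlock (V true μ) * zeroBlock (U .sqrtKappa))
  | .inr (false, μ) =>
      zeroBlock (U .sqrtKappa) * (zeroBlock (V false μ) * zeroBlock (U .invSqrtRho))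

theorem mul_eq_zero_of_fixes {ι : Type} [Fintype ι] [DecidableEq ι] {i : ι} {M N : Op ι}
    (hM : ∀ x y, x i ≠ y i → M x y = 0) (hN : ∀ x y, x i ≠ y i → N x y = 0) :
    ∀ x y, x i ≠ y i → (M * N) x y = 0 := by
  intro x y h
  rw [Matrix.mul_apply]
  refine Finset.sum_eq_zero fun z _ => ?_
  by_cases hz : x i = z i
  · rw [hN z y (hz ▸ h), mul_zero]
  · rw [hM x z hz, zero_mul]

/-- In each product the first factor to the left uses ancillas that the remaining factors conserve,
so zero blocks multiply. The reuse of the first register in the damping branch is covered by the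
flag. -/
theorem Branch.zeroBlock_bodyOp (i : Branch d) : zeroBlock (i.bodyOp U V) = i.block U V := by
  have h21 : ∀ (A : Op (Sys d n ⊕ FourierAnc d K)) (k : FourierAnc d K), ∀ x y : Bits (Body d n K),
      x (Sum.inr (secondAnc d K k)) ≠ y (Sum.inr (secondAnc d K k)) →
        onAnc (firstAnc d K) A x y = 0 := fun A k x y =>
    onAnc_eq_zero fun j => by simp
  have h12 : ∀ (A : Op (Sys d n ⊕ FourierAnc d K)) (k : FourierAnc d K), ∀ x y : Bits (Body d n K),
      x (Sum.inr (firstAnc d K k)) ≠ y (Sum.inr (firstAnc d K k)) →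
        onAnc (secondAnc d K) A x y = 0 := fun A k x y =>
    onAnc_eq_zero fun j => by simp
  have h1D : ∀ (A : Op (Sys d n ⊕ Fin 3)) (k : FourierAnc d K), ∀ x y : Bits (Body d n K),
      x (Sum.inr (firstAnc d K k)) ≠ y (Sum.inr (firstAnc d K k)) →
        onAnc (diffAnc d K) A x y = 0 := fun A k x y =>
    onAnc_eq_zero fun j => by simp
  have h2D : ∀ (A : Op (Sys d n ⊕ Fin 3)) (k : FourierAnc d K), ∀ x y : Bits (Body d n K),
      x (Sum.inr (secondAnc d K k)) ≠ y (Sum.inr (secondAnc d K k)) →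
        onAnc (diffAnc d K) A x y = 0 := fun A k x y =>
    onAnc_eq_zero fun j => by simp
  have hD1 : ∀ (A : Op (Sys d n ⊕ FourierAnc d K)) (k : Fin 3), ∀ x y : Bits (Body d n K),
      x (Sum.inr (diffAnc d K k)) ≠ y (Sum.inr (diffAnc d K k)) →
        onAnc (firstAnc d K) A x y = 0 := fun A k x y =>
    onAnc_eq_zero fun j => by simp
  have hD2 : ∀ (A : Op (Sys d n ⊕ FourierAnc d K)) (k : Fin 3), ∀ x y : Bits (Body d n K),
      x (Sum.inr (diffAnc d K k)) ≠ y (Sum.inr (diffAnc d K k)) →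
        onAnc (secondAnc d K) A x y = 0 := fun A k x y =>
    onAnc_eq_zero fun j => by simp
  rcases i with (_ | _) | ⟨_ | _, μ⟩ <;> simp only [Branch.bodyOp, Branch.block]
  · rw [zeroBlock_onAnc_mul_of_fixes, zeroBlock_adjoint_flagNonzero _ (by simp),
      zeroBlock_conjTranspose]
    exact fun x y k => mul_eq_zero_of_fixes (h21 _ k) (mul_eq_zero_of_fixes
      (fun x y h => flagNonzero_eq_zero (by simp) h) (h21 _ k)) x y
  · rw [zeroBlock_onAnc_mul_of_fixes, zeroBlock_onAnc]
    exact fun x y k => h12 _ k x y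
  · rw [zeroBlock_onAnc_mul_of_fixes, zeroBlock_onAnc_mul_of_fixes, zeroBlock_onAnc]
    · exact fun x y k => hD1 _ k x y
    · exact fun x y k => mul_eq_zero_of_fixes (h2D _ k) (h21 _ k) x y
  · rw [zeroBlock_onAnc_mul_of_fixes, zeroBlock_onAnc_mul_of_fixes, zeroBlock_onAnc]
    · exact fun x y k => hD2 _ k x y
    · exact fun x y k => mul_eq_zero_of_fixes (h1D _ k) (h12 _ k) x y

end Body

/-! ### Layout of the register and the oracle calls of the branches. -/

section Register
variable {d n K a : ℕ} (E : (Sel d ⊕ Fin 1) ⊕ BodyAnc d K ≃ Fin a)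

/-- The position of the body in the register. -/
def bodyEmb : Body d n K ↪ Reg d n a where
  toFun := Sum.elim (fun s => Sum.inl (Sum.inr s)) fun t => Sum.inr (E (Sum.inr t))
  inj' := by
    rintro (i | i) (j | j) h <;> simp_all

/-- The position of the label register. -/
def labEmb : Sel d ↪ Reg d n a where
  toFun j := Sum.inr (E (Sum.inl (Sum.inl j)))
  inj' := fun i j h => by simpa using h

theorem bodyEmb_inl (s : Sys d n) : (bodyEmb E (Sum.inl s) : Reg d n a) = Sum.inl (Sum.inr s) := rfl

theorem bodyEmb_inr (t : BodyAnc d K) :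
    (bodyEmb E (Sum.inr t) : Reg d n a) = Sum.inr (E (Sum.inr t)) := rfl

theorem labEmb_apply (j : Sel d) : (labEmb E j : Reg d n a) = Sum.inr (E (Sum.inl (Sum.inl j))) :=
  rfl

/-- The position of the selector register. -/
def selEmb (d n a : ℕ) : Sel d ↪ Reg d n a :=
  Function.Embedding.inl.trans Function.Embedding.inl

/-- The position of the ancilla qubit for the amplitudes. -/
def ampQubit : Reg d n a := Sum.inr (E (Sum.inl (Sum.inr 0)))

theorem reg_cases (i : Reg d n a) : (∃ b, bodyEmb E b = i) ∨ (∃ j, labEmb E j = i) ∨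
    (∃ j, selEmb d n a j = i) ∨ i = ampQubit E := by
  rcases i with (i | i) | i
  · exact Or.inr (Or.inr (Or.inl ⟨i, rfl⟩))
  · exact Or.inl ⟨Sum.inl i, rfl⟩
  · obtain ⟨(j | j) | j, rfl⟩ := E.surjective i
    · exact Or.inr (Or.inl ⟨j, rfl⟩)
    · exact Or.inr (Or.inr (Or.inr (by rw [ampQubit, Subsingleton.elim j 0])))
    · exact Or.inl ⟨Sum.inr j, rfl⟩

theorem bodyEmb_ne_labEmb (b : Body d n K) (j : Sel d) : bodyEmb E b ≠ (labEmb E j : Reg d n a) := by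
  rcases b with b | b <;> simp [bodyEmb_inl, bodyEmb_inr, labEmb_apply]

theorem bodyEmb_ne_selEmb (b : Body d n K) (j : Sel d) : bodyEmb E b ≠ selEmb d n a j := by
  rcases b with b | b <;> simp [bodyEmb_inl, bodyEmb_inr, selEmb]

theorem bodyEmb_ne_ampQubit (b : Body d n K) : bodyEmb E b ≠ (ampQubit E : Reg d n a) := by
  rcases b with b | b <;> simp [bodyEmb_inl, bodyEmb_inr, ampQubit]

theorem labEmb_ne_selEmb (i j : Sel d) : labEmb E i ≠ selEmb d n a j := by
  simp [labEmb_apply, selEmb]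

theorem labEmb_ne_ampQubit (i : Sel d) : labEmb E i ≠ (ampQubit E : Reg d n a) := by
  simp [labEmb_apply, ampQubit]

theorem selEmb_ne_ampQubit (i : Sel d) : selEmb d n a i ≠ ampQubit E := by
  simp [ampQubit, selEmb]

/-- A function of the label and of the selector value. -/
def onLabels {β : Type} (f : ℕ → ℕ → β) (x : Bits (Reg d n a)) : β :=
  f (bitsVal (x ∘ labEmb E)) (bitsVal (x ∘ selEmb d n a))

/-- The qubits of the label and of the selector. -/
noncomputable def labelQubits : List (Reg d n a) :=
  (Finset.univ : Finset (Sel d)).toList.map (labEmb E) ++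
    (Finset.univ : Finset (Sel d)).toList.map (selEmb d n a)

theorem length_labelQubits :
    (labelQubits E : List (Reg d n a)).length = 2 * Nat.clog 2 (d + 2) := by
  simp [labelQubits]
  ring

theorem dependsOn_onLabels {β : Type} (f : ℕ → ℕ → β) :
    DependsOn (onLabels (n := n) E f) {i | i ∈ labelQubits E} := by
  intro x y h
  have h1 : x ∘ labEmb E = y ∘ labEmb E := funext fun j => h _ (by simp [labelQubits])
  have h2 : x ∘ selEmb d n a = y ∘ selEmb d n a := funext fun j => h _ (by simp [labelQubits])
  rw [onLabels, onLabels, h1, h2]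

theorem ampQubit_notMem : (ampQubit E : Reg d n a) ∉ labelQubits E := by
  simp [labelQubits, labEmb_ne_ampQubit, selEmb_ne_ampQubit]

/-- The controlled version of an operator of the body. -/
def ctrlBody (M : Op (Body d n K)) : Op (Reg d n a ⊕ Fin 1) :=
  embedOp (workCtrl _) (controlled (embedOp (bodyEmb E) M))

theorem ctrlBody_mul (M N : Op (Body d n K)) :
    (ctrlBody E (M * N) : Op (Reg d n a ⊕ Fin 1)) = ctrlBody E M * ctrlBody E N := by
  rw [ctrlBody, embedOp_mul, controlled_mul, embedOp_mul]
  rfl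

/-- The qubits of a controlled oracle call. -/
def callEmb {τ : Type} (F : τ ↪ BodyAnc d K) : Option (Sys d n ⊕ τ) ↪ Reg d n a ⊕ Fin 1 :=
  (((Function.Embedding.refl _).sumMap F).trans (bodyEmb E)).optionMap.trans (workCtrl _)

theorem embedOp_callEmb {τ : Type} [Fintype τ] [DecidableEq τ] (F : τ ↪ BodyAnc d K)
    (A : Op (Sys d n ⊕ τ)) :
    embedOp (callEmb E F) (controlled A) = (ctrlBody E (onAnc F A) : Op (Reg d n a ⊕ Fin 1)) := by
  rw [callEmb, embedOp_trans, ← controlled_embedOp, embedOp_trans]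
  rfl

/-- The controlled oracle calls of a branch. -/
def Branch.calls (NZ : Circuit (Reg d n a ⊕ Fin 1)) : Branch d →
    QueryCircuit d (Sys d n ⊕ FourierAnc d K) (Sys d n ⊕ Fin 3) (Reg d n a ⊕ Fin 1)
  | .inl false => [.coeff (.direct .invSqrtRho) (callEmb E (firstAnc d K))] ++ (NZ.map Instr.gate ++
      ([.coeff .adjInvSqrtRho (callEmb E (firstAnc d K))] ++
        [.coeff (.direct .zeta) (callEmb E (secondAnc d K))]))
  | .inl true => [.coeff (.direct .sqrtGamma) (callEmb E (secondAnc d K))] ++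
      [.coeff (.direct .invSqrtRho) (callEmb E (firstAnc d K))]
  | .inr (true, μ) => [.coeff (.direct .sqrtKappa) (callEmb E (secondAnc d K))] ++
      ([.diff true μ (callEmb E (diffAnc d K))] ++
        [.coeff (.direct .invSqrtRho) (callEmb E (firstAnc d K))])
  | .inr (false, μ) => [.coeff (.direct .invSqrtRho) (callEmb E (firstAnc d K))] ++
      ([.diff false μ (callEmb E (diffAnc d K))] ++
        [.coeff (.direct .sqrtKappa) (callEmb E (secondAnc d K))])

theorem Branch.op_calls (U : Coeff → Op (Sys d n ⊕ FourierAnc d K))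
    (V : Bool → Fin d → Op (Sys d n ⊕ Fin 3)) {NZ : Circuit (Reg d n a ⊕ Fin 1)}
    (hNZ : NZ.op = ctrlBody E (flagNonzero (firstAnc d K) (diffAnc d K 0))) (i : Branch d) :
    (Branch.calls E NZ i).op U V = ctrlBody E (i.bodyOp U V) := by
  rcases i with (_ | _) | ⟨_ | _, μ⟩ <;>
    simp only [Branch.calls, Branch.bodyOp, QueryCircuit.op_append, QueryCircuit.op_singleton,
      QueryCircuit.op_gates, Instr.op, hNZ, embedOp_callEmb, coeffCallOp, ctrlBody_mul, mul_assoc]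

variable (NZ : Circuit (Reg d n a ⊕ Fin 1))

/-- 2d+2 uses for ϱ^(-1/2): one for each of the 2d difference operators, one for the mass term and
one for the damping term, which also makes the single adjoint call. The mass term is called once
although it fills two blocks, as both carry the same label. -/
theorem Branch.coeffUses_calls (q : CoeffCall) :
    ∑ i : Branch d, (Branch.calls (n := n) E NZ i).coeffUses q = match q with
      | .direct .invSqrtRho => 2 * d + 2
      | .adjInvSqrtRho => 1
      | .direct .sqrtKappa => 2 * d
      | .direct .zeta => 1
      | .direct .sqrtGamma => 1 := by
  simp only [Fintype.sum_sum_type, Fintype.sum_prod_type, Fintype.sum_bool, Branch.calls,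
    QueryCircuit.coeffUses_append, QueryCircuit.coeffUses_gates, QueryCircuit.coeffUses_coeff,
    QueryCircuit.coeffUses_diff]
  rcases q with (_ | _ | _ | _) | _ <;> simp <;> ring

theorem Branch.diffUses_calls (fwd : Bool) (μ : Fin d) :
    ∑ i : Branch d, (Branch.calls (n := n) E NZ i).diffUses fwd μ = 1 := by
  simp only [Fintype.sum_sum_type, Fintype.sum_prod_type, Fintype.sum_bool, Branch.calls,
    QueryCircuit.diffUses_append, QueryCircuit.diffUses_gates, QueryCircuit.diffUses_coeff,
    QueryCircuit.diffUses_diff]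
  cases fwd <;> simp

theorem Branch.length_expand_calls {ω : Type} (FU : CoeffCall → Circuit (Option _ ⊕ ω))
    (FV : Bool → Fin d → Circuit (Option _ ⊕ ω)) {kU kV : ℕ} (hU : ∀ q, (FU q).length ≤ kU)
    (hV : ∀ fwd μ, (FV fwd μ).length ≤ kV) (i : Branch d) :
    ((Branch.calls (n := n) E NZ i).expand FU FV).length ≤ 3 * kU + kV + NZ.length := by
  rcases i with (_ | _) | ⟨_ | _, μ⟩ <;>
    simp only [Branch.calls, QueryCircuit.expand_append, List.length_append,
      QueryCircuit.length_expand_gates, QueryCircuit.length_expand_coeff,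
      QueryCircuit.length_expand_diff]
  · have := hU (.direct .invSqrtRho)
    have := hU .adjInvSqrtRho
    have := hU (.direct .zeta)
    omega
  · have := hU (.direct .invSqrtRho)
    have := hU (.direct .sqrtGamma)
    omega
  · have := hU (.direct .invSqrtRho)
    have := hU (.direct .sqrtKappa)
    have := hV false μ
    omega
  · have := hU (.direct .invSqrtRho)
    have := hU (.direct .sqrtKappa)
    have := hV true μ
    omega

end Register

/-! ### Conserved qubits. -/

section Fixes
variable {ι κ : Type} [Fintype ι] [DecidableEq ι] [Fintype κ] [DecidableEq κ]

theorem condProd_eq_zero {I : Type} {c : I → Bits κ → Bool} {N : I → Op κ} {k : κ}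
    (h : ∀ i x y, x k ≠ y k → N i x y = 0) (l : List I) :
    ∀ x y, x k ≠ y k → condProd c N l x y = 0 := by
  induction l with
  | nil => exact fun x y hxy => Matrix.one_apply_ne fun h => hxy (by rw [h])
  | cons i l ih =>
    refine mul_eq_zero_of_fixes ih fun x y hxy => ?_
    rw [condOp]
    split_ifs
    · exact h i x y hxy
    · exact Matrix.one_apply_ne fun h => hxy (by rw [h])

theorem mux_eq_zero {t k : ι} (hk : k ≠ t) (g : Bits ι → Matrix Bool Bool ℂ) {x y : Bits ι}
    (h : x k ≠ y k) : mux t g x y = 0 := by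
  unfold mux
  rw [if_neg fun h' => h (h' k hk)]

end Fixes

/-! ### The linear combination of the branches. -/

section Register
variable {d n K a : ℕ} (E : (Sel d ⊕ Fin 1) ⊕ BodyAnc d K ≃ Fin a)

/-- The operator adding the label to the selector. -/
noncomputable def addLabel : List (Reg d n a × Reg d n a) :=
  (Finset.univ : Finset (Sel d)).toList.map fun j => (labEmb E j, selEmb d n a j)

theorem addBits_addLabel_selEmb (x : Bits (Reg d n a)) (j : Sel d) :
    addBits (addLabel E) x (selEmb d n a j) = xor (x (selEmb d n a j)) (x (labEmb E j)) := by
  refine addBits_apply (l := addLabel E) (q := (labEmb E j, selEmb d n a j)) ?_ ?_ ?_ x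
  · rw [addLabel, List.map_map]
    exact (Finset.nodup_toList _).map (selEmb d n a).injective
  · simp [addLabel, labEmb_ne_selEmb]
  · simp [addLabel]

theorem addBits_addLabel_of_ne (x : Bits (Reg d n a)) {i : Reg d n a}
    (hi : ∀ j, selEmb d n a j ≠ i) : addBits (addLabel E) x i = x i :=
  addBits_apply_of_notMem (by simpa [addLabel] using hi) x

theorem hasCircuit_addLabel : HasCircuit (permOp (addBits (addLabel (n := n) E)))
    (Nat.clog 2 (d + 2)) := by
  have h := hasCircuit_addBits (addLabel (n := n) E) (by simp [addLabel, labEmb_ne_selEmb])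
  simpa [addLabel] using h

variable (U : Coeff → Op (Sys d n ⊕ FourierAnc d K)) (V : Bool → Fin d → Op (Sys d n ⊕ Fin 3))
  (aζ aγ aD : ℝ)

/-- The branches, each on its labels. -/
noncomputable def selectBranch : Op (Reg d n a) :=
  condProd (fun i : Branch d => onLabels E i.cond)
    (fun i => embedOp (bodyEmb E) (i.bodyOp U V)) (Finset.univ : Finset (Branch d)).toList

/-- The rotation of the ancilla qubit for the amplitudes. -/
noncomputable def ampRot : Op (Reg d n a) :=
  mux (ampQubit E) fun x => rot (onLabels E (fun l s => Real.arccos (labelAmp d aζ aγ aD l s)) x)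

theorem embedOp_bodyEmb_eq_zero (M : Op (Body d n K)) {k : Reg d n a} (hk : ∀ b, bodyEmb E b ≠ k)
    (x y : Bits (Reg d n a)) (h : x k ≠ y k) : embedOp (bodyEmb E) M x y = 0 :=
  embedOp_of_ne hk h

theorem onLabels_eq_of_ne_zero {β : Type} (f : ℕ → ℕ → β) {M : Op (Body d n K)}
    {x y : Bits (Reg d n a)} (h : embedOp (bodyEmb E) M x y ≠ 0) :
    onLabels E f x = onLabels E f y := by
  refine dependsOn_onLabels E f fun k hk => ?_
  by_contra hxy
  refine h (embedOp_bodyEmb_eq_zero E M (fun b hb => ?_) x y hxy)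
  subst hb
  simp only [labelQubits, Set.mem_ofPred_eq, List.mem_append, List.mem_map, Finset.mem_toList,
    Finset.mem_univ, true_and] at hk
  rcases hk with ⟨j, hj⟩ | ⟨j, hj⟩
  · exact bodyEmb_ne_labEmb E b j hj.symm
  · exact bodyEmb_ne_selEmb E b j hj.symm

/-- The amplitude qubit, started and ended in |0⟩, contributes the cosine of its angle, which is the
signed amplitude. The branch picked by label and selector acts on the body only, and afterwards the
label is added to the selector. -/
theorem select_apply (hζ : |aζ| ≤ 1) (hγ : |aγ| ≤ 1) (hD : |aD| ≤ 1) {u v : Bits (Reg d n a)}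
    (hu : u (ampQubit E) = false) (hv : v (ampQubit E) = false)
    (huv : ∀ j, u (labEmb E j) = v (labEmb E j)) :
    (permOp (addBits (addLabel E)) * (selectBranch E U V * ampRot E aζ aγ aD) :
        Op (Reg d n a)) u v =
      ∑ i : Branch d, if onLabels E i.cond v = true ∧
          ∀ j, xor (u (selEmb d n a j)) (v (labEmb E j)) = v (selEmb d n a j) then
        (i.amp aζ aγ aD (bitsVal (v ∘ selEmb d n a)) : ℂ) *
          i.bodyOp U V (u ∘ bodyEmb E) (v ∘ bodyEmb E) else 0 := by
  have hamp : addBits (addLabel E) u (ampQubit E) = false := by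
    rw [addBits_addLabel_of_ne E u (selEmb_ne_ampQubit E), hu]
  rw [permOp_mul_apply, ampRot, mul_mux_apply, Fintype.sum_bool]
  rw [selectBranch, condProd_eq_zero (k := ampQubit E) (fun i x y h =>
    embedOp_bodyEmb_eq_zero E _ (bodyEmb_ne_ampQubit E) x y h) _ _ _ (by simp [hamp]), zero_mul,
    zero_add, Function.update_eq_self_iff.mpr hv.symm, hv]
  have hcos : rot (onLabels E (fun l s => Real.arccos (labelAmp d aζ aγ aD l s)) v) false false =
      ((onLabels E (labelAmp d aζ aγ aD) v : ℝ) : ℂ) := by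
    have hb := abs_le.mp (abs_labelAmp_le (d := d) hζ hγ hD (bitsVal (v ∘ labEmb E))
      (bitsVal (v ∘ selEmb d n a)))
    simp only [rot, onLabels]
    simp [Real.cos_arccos hb.1 hb.2]
  rw [hcos]
  by_cases h : ∃ i : Branch d, onLabels E i.cond v = true
  · obtain ⟨i, hi⟩ := h
    rw [condProd_of_mem (c := fun i : Branch d => onLabels E i.cond)
      (fun i j x y h => onLabels_eq_of_ne_zero E _ h)
      (fun i j y hi hj => Branch.cond_unique i j hi hj) (Finset.nodup_toList _)
      (Finset.mem_toList.mpr (Finset.mem_univ i)) hi, Finset.sum_eq_single i]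
    · have hl : onLabels E (labelAmp d aζ aγ aD) v = i.amp aζ aγ aD (bitsVal (v ∘ selEmb d n a)) :=
        labelAmp_of_cond aζ aγ aD hi
      rw [hl]
      by_cases hx : ∀ j, xor (u (selEmb d n a j)) (v (labEmb E j)) = v (selEmb d n a j)
      · rw [if_pos ⟨hi, hx⟩, embedOp_of_agree, mul_comm]
        · congr 2
          funext b
          exact addBits_addLabel_of_ne E u fun j => (bodyEmb_ne_selEmb E b j).symm
        · intro k hk
          rcases reg_cases E k with ⟨b, hb⟩ | ⟨j, rfl⟩ | ⟨j, rfl⟩ | rfl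
          · exact absurd hb (hk b)
          · rw [addBits_addLabel_of_ne E u fun i => (labEmb_ne_selEmb E j i).symm, huv]
          · rw [addBits_addLabel_selEmb, huv, hx]
          · rw [hamp, hv]
      · rw [if_neg fun h => hx h.2]
        push Not at hx
        obtain ⟨j, hj⟩ := hx
        rw [embedOp_bodyEmb_eq_zero E _ (fun b => bodyEmb_ne_selEmb E b j), zero_mul]
        rwa [addBits_addLabel_selEmb, huv]
    · intro j _ hj
      rw [if_neg fun h => hj (Branch.cond_unique j i h.1 hi)]
    · simp
  -- Without a branch the angle is arccos 0 = π/2, so the identity that would otherwise be applied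
  -- is projected out.
  · push Not at h
    have hl : onLabels E (labelAmp d aζ aγ aD) v = 0 :=
      labelAmp_of_none aζ aγ aD fun i => Bool.eq_false_of_not_eq_true (h i)
    rw [hl, Complex.ofReal_zero, mul_zero]
    refine (Finset.sum_eq_zero fun i _ => ?_).symm
    rw [if_neg fun h' => h i h'.1]

/-- The block-encoding. -/
noncomputable def lcuOp (P : Op (Sel d)) : Op (Reg d n a) :=
  embedOp (labEmb E) P.conjTranspose *
    (permOp (addBits (addLabel E)) * (selectBranch E U V * ampRot E aζ aγ aD)) *
    embedOp (labEmb E) P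

/-- Every used label has weight 1/(d+2), which the prefactor cancels. The labels from d+2 on have
weight 0 and no branch. -/
theorem zeroBlock_lcuOp_apply (hζ : |aζ| ≤ 1) (hγ : |aγ| ≤ 1) (hD : |aD| ≤ 1) {P : Op (Sel d)}
    (hP : ∀ r, star (P r fun _ => false) * P r (fun _ => false) =
        if bitsVal r < d + 2 then 1 / ((d + 2 : ℕ) : ℂ) else 0) (x y : Bits (Sel d ⊕ Sys d n)) :
    ((d + 2 : ℕ) : ℂ) * zeroBlock (lcuOp E U V aζ aγ aD P) x y =
      ∑ i : Branch d, ∑ r : Bits (Sel d), if i.cond (bitsVal r) (bitsVal (y ∘ Sum.inl)) = true ∧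
          ∀ j, xor (x (Sum.inl j)) (r j) = y (Sum.inl j) then
        (i.amp aζ aγ aD (bitsVal (y ∘ Sum.inl)) : ℂ) *
          i.block U V (x ∘ Sum.inr) (y ∘ Sum.inr) else 0 := by
  have hd : ((d + 2 : ℕ) : ℂ) ≠ 0 := by exact_mod_cast (by omega : d + 2 ≠ 0)
  unfold zeroBlock lcuOp
  rw [lcu_apply _ _ _ _ _ rfl rfl, Finset.mul_sum, Finset.sum_comm]
  · refine Finset.sum_congr rfl fun r _ => ?_
    have hlab : ∀ (z : Bits (Reg d n a)) j, Function.extend (labEmb E) r z (labEmb E j) = r j :=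
      fun z j => (labEmb E).injective.extend_apply _ _ _
    have hsel : ∀ (z : Bits (Reg d n a)) j, Function.extend (labEmb E) r z (selEmb d n a j) =
        z (selEmb d n a j) := fun z j => extend_off _ _ _ fun i => labEmb_ne_selEmb E i j
    have hbody : ∀ (z : Bits (Sel d ⊕ Sys d n)), Function.extend (labEmb E) r
        (Sum.elim z fun _ => false) ∘ bodyEmb E = Sum.elim (z ∘ Sum.inr) fun _ => false := by
      intro z
      funext b
      rw [Function.comp_apply, extend_off _ _ _ fun i => (bodyEmb_ne_labEmb E b i).symm]
      rcases b with b | b <;> rfl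
    have hampq : ∀ (z : Bits (Sel d ⊕ Sys d n)), Function.extend (labEmb E) r
        (Sum.elim z fun _ => false) (ampQubit E) = false := fun z =>
      extend_off _ _ _ fun i => labEmb_ne_ampQubit E i
    have h1 : Function.extend (labEmb E) r (Sum.elim y fun _ => false) ∘ labEmb E = r :=
      extend_comp_self _ _ _
    have h2 : Function.extend (labEmb E) r (Sum.elim y fun _ => false) ∘ selEmb d n a =
        y ∘ Sum.inl := funext fun j => hsel _ j
    rw [hP, select_apply E U V aζ aγ aD hζ hγ hD (hampq x) (hampq y) fun j => by rw [hlab, hlab],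
      Finset.mul_sum, Finset.mul_sum]
    refine Finset.sum_congr rfl fun i _ => ?_
    simp only [onLabels, h1, h2, hbody, hlab, hsel]
    have e1 : ∀ (z : Bits (Sel d ⊕ Sys d n)) j, (Sum.elim z fun _ => false : Bits (Reg d n a))
      (selEmb d n a j) = z (Sum.inl j) := fun _ _ => rfl
    simp only [e1]
    by_cases h : i.cond (bitsVal r) (bitsVal (y ∘ Sum.inl)) = true ∧
        ∀ j, xor (x (Sum.inl j)) (r j) = y (Sum.inl j)
    · rw [if_pos h, if_pos h, if_pos (i.cond_lt h.1), ← Branch.zeroBlock_bodyOp, ← mul_assoc,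
        mul_one_div_cancel hd, one_mul]
      rfl
    · rw [if_neg h, if_neg h, mul_zero, mul_zero]
  · intro x y hxy
    obtain ⟨j, hj⟩ := Function.ne_iff.mp hxy
    rw [permOp_mul_apply]
    refine mul_eq_zero_of_fixes (i := labEmb E j) ?_ ?_ _ _ ?_
    · exact condProd_eq_zero (fun i x y h => embedOp_bodyEmb_eq_zero E _
        (fun b => bodyEmb_ne_labEmb E b j) x y h) _
    · exact fun x y h => mux_eq_zero (labEmb_ne_ampQubit E j) _ h
    · rw [addBits_addLabel_of_ne E x fun i => (labEmb_ne_selEmb E j i).symm]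
      exact hj

/-- For each branch the label sum leaves the single block that the XOR condition permits. The mass
branch gives two, (0, d+1) and (d+1, 0), with the opposite signs built into its amplitude. -/
theorem zeroBlock_lcuOp (hζ : |aζ| ≤ 1) (hγ : |aγ| ≤ 1) (hD : |aD| ≤ 1) {P : Op (Sel d)}
    (hP : ∀ r, star (P r fun _ => false) * P r (fun _ => false) =
        if bitsVal r < d + 2 then 1 / ((d + 2 : ℕ) : ℂ) else 0) :
    ((d + 2 : ℕ) : ℂ) • zeroBlock (lcuOp E U V aζ aγ aD P) =
      selBlock 0 0 ((aζ : ℂ) • Branch.block U V (.inl false))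
      - ∑ μ : Fin d, selBlock 0 (μ + 1) ((aD : ℂ) • Branch.block U V (.inr (true, μ)))
      + selBlock 0 (d + 1) ((aγ : ℂ) • Branch.block U V (.inl true))
      - ∑ μ : Fin d, selBlock (μ + 1) 0 ((aD : ℂ) • Branch.block U V (.inr (false, μ)))
      - selBlock (d + 1) 0 ((aγ : ℂ) • Branch.block U V (.inl true)) := by
  have hpow : d + 2 ≤ 2 ^ Nat.clog 2 (d + 2) := Nat.le_pow_clog (by norm_num) _
  ext x y
  rw [Matrix.smul_apply, smul_eq_mul, zeroBlock_lcuOp_apply E U V aζ aγ aD hζ hγ hD hP]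
  set u : Bits (Sel d) := x ∘ Sum.inl with hu
  set v : Bits (Sel d) := y ∘ Sum.inl with hv
  have hx : ∀ j, x (Sum.inl j) = u j := fun _ => rfl
  have hy : ∀ j, y (Sum.inl j) = v j := fun _ => rfl
  simp only [hx, hy]
  rw [Fintype.sum_sum_type, Fintype.sum_prod_type, Fintype.sum_bool, Fintype.sum_bool]
  simp only [Matrix.sub_apply, Matrix.add_apply, Matrix.sum_apply, selBlock, ← hu, ← hv,
    Matrix.smul_apply, smul_eq_mul]
  have hζs : ∑ r : Bits (Sel d), (if Branch.cond (d := d) (.inl false) (bitsVal r) (bitsVal v) =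
      true ∧ ∀ j, xor (u j) (r j) = v j then ((Branch.amp (d := d) aζ aγ aD (.inl false)
        (bitsVal v) : ℝ) : ℂ) * Branch.block U V (.inl false) (x ∘ Sum.inr) (y ∘ Sum.inr) else 0) =
      if bitsVal u = 0 ∧ bitsVal v = 0 then
        (aζ : ℂ) * Branch.block U V (.inl false) (x ∘ Sum.inr) (y ∘ Sum.inr) else 0 := by
    simp only [Branch.cond, Branch.amp, decide_eq_true_eq, and_assoc]
    exact sum_label_col (by omega) u v _
  have hDf : ∀ μ : Fin d, ∑ r : Bits (Sel d), (if Branch.cond (.inr (true, μ)) (bitsVal r)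
      (bitsVal v) = true ∧ ∀ j, xor (u j) (r j) = v j then ((Branch.amp aζ aγ aD (.inr (true, μ))
        (bitsVal v) : ℝ) : ℂ) * Branch.block U V (.inr (true, μ)) (x ∘ Sum.inr) (y ∘ Sum.inr)
        else 0) =
      -if bitsVal u = 0 ∧ bitsVal v = μ + 1 then
        (aD : ℂ) * Branch.block U V (.inr (true, μ)) (x ∘ Sum.inr) (y ∘ Sum.inr) else 0 := by
    intro μ
    simp only [Branch.cond, Branch.amp, decide_eq_true_eq, and_assoc]
    rw [sum_label_row (by omega) u v]
    split_ifs <;> simp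
  have hDb : ∀ μ : Fin d, ∑ r : Bits (Sel d), (if Branch.cond (.inr (false, μ)) (bitsVal r)
      (bitsVal v) = true ∧ ∀ j, xor (u j) (r j) = v j then ((Branch.amp aζ aγ aD (.inr (false, μ))
        (bitsVal v) : ℝ) : ℂ) * Branch.block U V (.inr (false, μ)) (x ∘ Sum.inr) (y ∘ Sum.inr)
        else 0) =
      -if bitsVal u = μ + 1 ∧ bitsVal v = 0 then
        (aD : ℂ) * Branch.block U V (.inr (false, μ)) (x ∘ Sum.inr) (y ∘ Sum.inr) else 0 := by
    intro μ
    simp only [Branch.cond, Branch.amp, decide_eq_true_eq, and_assoc]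
    rw [sum_label_col (by omega) u v]
    split_ifs <;> simp
  have hγs : ∑ r : Bits (Sel d), (if Branch.cond (d := d) (.inl true) (bitsVal r) (bitsVal v) =
      true ∧ ∀ j, xor (u j) (r j) = v j then ((Branch.amp (d := d) aζ aγ aD (.inl true)
        (bitsVal v) : ℝ) : ℂ) * Branch.block U V (.inl true) (x ∘ Sum.inr) (y ∘ Sum.inr) else 0) =
      (if bitsVal u = 0 ∧ bitsVal v = d + 1 then
        (aγ : ℂ) * Branch.block U V (.inl true) (x ∘ Sum.inr) (y ∘ Sum.inr) else 0) -
      if bitsVal u = d + 1 ∧ bitsVal v = 0 then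
        (aγ : ℂ) * Branch.block U V (.inl true) (x ∘ Sum.inr) (y ∘ Sum.inr) else 0 := by
    simp only [Branch.cond, Branch.amp, decide_eq_true_eq]
    rw [← sum_label_row (by omega) u v, ← sum_label_col (by omega) u v, ← Finset.sum_sub_distrib]
    refine Finset.sum_congr rfl fun r _ => ?_
    by_cases h1 : bitsVal r = d + 1 ∧ ∀ j, xor (u j) (r j) = v j
    · by_cases h2 : bitsVal v = 0
      · simp [h1.1, h1.2, h2]
      · by_cases h3 : bitsVal v = d + 1
        · simp [h1.1, h1.2, h3]
        · simp [h2, h3]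
    · rw [if_neg fun h => h1 ⟨h.1.1, h.2⟩, if_neg fun h => h1 ⟨h.1, h.2.2⟩,
        if_neg fun h => h1 ⟨h.1, h.2.2⟩, sub_zero]
  rw [hζs, hγs, Finset.sum_congr rfl fun μ _ => hDf μ, Finset.sum_congr rfl fun μ _ => hDb μ,
    Finset.sum_neg_distrib, Finset.sum_neg_distrib]
  ring

end Register

/-! ### The circuit of the block-encoding. -/

section Circuit
variable {d n K a : ℕ} (E : (Sel d ⊕ Fin 1) ⊕ BodyAnc d K ≃ Fin a)

theorem nontrivial_sel (hd : 0 < d) : Nontrivial (Sel d) :=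
  Fin.nontrivial_iff_two_le.mpr ((Nat.lt_clog_iff_pow_lt (by norm_num)).mpr (by omega))

theorem HasCircuit.exists_work {M : Op (Reg d n a)} {k : ℕ} (h : HasCircuit M k) :
    ∃ P : Circuit (Reg d n a ⊕ Fin 1), Implements P.op M ∧ P.length ≤ k := by
  obtain ⟨P, hP, hk⟩ := h
  refine ⟨P.map (TwoQubitGate.map Function.Embedding.inl), ?_, by simpa using hk⟩
  rw [Circuit.op_map, hP]
  exact implements_embedOp_inl M

theorem exists_cond_circuit [Nontrivial (Sel d)] (f : ℕ → ℕ → Bool) :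
    HasCircuit (condRot (onLabels (n := n) E f)) (3 * 2 ^ (2 * Nat.clog 2 (d + 2))) := by
  have : Nontrivial (Reg d n a ⊕ Fin 1) :=
    ⟨Sum.inr 0, Sum.inl (ampQubit E), by simp⟩
  have h := hasCircuit_mux_rot (ι := Reg d n a ⊕ Fin 1) (t := Sum.inr 0)
    ((labelQubits E).map Sum.inl) (by simp)
    (θ := fun x => if onLabels E f (x ∘ Sum.inl) then Real.pi / 2 else 0) (by
      intro x y hxy
      have := dependsOn_onLabels E f (x := x ∘ Sum.inl) (y := y ∘ Sum.inl) fun i hi =>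
        hxy _ (List.mem_map_of_mem hi)
      beta_reduce
      rw [this])
  rwa [List.length_map, length_labelQubits] at h

theorem hasCircuit_ampRot [Nontrivial (Sel d)] (aζ aγ aD : ℝ) :
    HasCircuit (ampRot (n := n) E aζ aγ aD) (3 * 2 ^ (2 * Nat.clog 2 (d + 2))) := by
  have : Nontrivial (Reg d n a) := (selEmb d n a).injective.nontrivial
  have h := hasCircuit_mux_rot (labelQubits (n := n) E) (ampQubit_notMem E)
    (dependsOn_onLabels E fun l s => Real.arccos (labelAmp d aζ aγ aD l s))
  rwa [length_labelQubits] at h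

/-- The oracles may be arbitrary unitaries here: their zero blocks enter only through
`Branch.block`, and the length bound holds for whatever circuits are substituted for them. -/
theorem exists_second_order_circuit (hd : 0 < d)
    (ha : Fintype.card ((Sel d ⊕ Fin 1) ⊕ BodyAnc d K) = a)
    {U : Coeff → Op (Sys d n ⊕ FourierAnc d K)} {V : Bool → Fin d → Op (Sys d n ⊕ Fin 3)}
    (hU : ∀ g, U g ∈ Matrix.unitaryGroup _ ℂ) (hV : ∀ fwd μ, V fwd μ ∈ Matrix.unitaryGroup _ ℂ)
    {aζ aγ aD : ℝ} (hζ : |aζ| ≤ 1) (hγ : |aγ| ≤ 1) (hD : |aD| ≤ 1) :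
    ∃ (Q : QueryCircuit d (Sys d n ⊕ FourierAnc d K) (Sys d n ⊕ Fin 3) (Reg d n a ⊕ Fin 1))
      (W : Op (Reg d n a)),
      Q.coeffUses (.direct .invSqrtRho) = 2 * d + 2 ∧
      Q.coeffUses .adjInvSqrtRho = 1 ∧
      Q.coeffUses (.direct .sqrtKappa) = 2 * d ∧
      Q.coeffUses (.direct .zeta) = 1 ∧
      Q.coeffUses (.direct .sqrtGamma) = 1 ∧
      (∀ fwd μ, Q.diffUses fwd μ = 1) ∧
      Implements (Q.op U V) W ∧ W ∈ Matrix.unitaryGroup _ ℂ ∧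
      ((d + 2 : ℕ) : ℂ) • zeroBlock W =
        selBlock 0 0 ((aζ : ℂ) • Branch.block U V (.inl false))
        - ∑ μ : Fin d, selBlock 0 (μ + 1) ((aD : ℂ) • Branch.block U V (.inr (true, μ)))
        + selBlock 0 (d + 1) ((aγ : ℂ) • Branch.block U V (.inl true))
        - ∑ μ : Fin d, selBlock (μ + 1) 0 ((aD : ℂ) • Branch.block U V (.inr (false, μ)))
        - selBlock (d + 1) 0 ((aγ : ℂ) • Branch.block U V (.inl true)) ∧
      ∀ {w' : ℕ} (FU : CoeffCall → Circuit (Option (Sys d n ⊕ FourierAnc d K) ⊕ Fin w'))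
        (FV : Bool → Fin d → Circuit (Option (Sys d n ⊕ Fin 3) ⊕ Fin w')) (kU kV : ℕ),
        (∀ q, (FU q).length ≤ kU) → (∀ fwd μ, (FV fwd μ).length ≤ kV) →
        (Q.expand FU FV).length ≤ 28 * 2 ^ Nat.clog 2 (d + 2) +
          3 * 2 ^ (2 * Nat.clog 2 (d + 2)) + Nat.clog 2 (d + 2) +
          (2 * d + 2) * (6 * 2 ^ (2 * Nat.clog 2 (d + 2)) + 3 * kU + kV +
            6 * 2 ^ (d * Nat.clog 2 (2 * K + 1))) := by
  have := nontrivial_sel hd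
  -- Any bijection will do: zero blocks set all ancillas to |0⟩ and do not depend on their order.
  let E := Fintype.equivFinOfCardEq ha
  obtain ⟨P, hP, hP0⟩ := exists_uniform_prep (m := Nat.clog 2 (d + 2)) (N := d + 2) (by omega)
    (Nat.le_pow_clog (by norm_num) _)
  obtain ⟨CP, hCP, hCPl⟩ := (hP.embedOp (labEmb (n := n) E)).1.exists_work
  obtain ⟨CP', hCP', hCPl'⟩ := (hP.conjTranspose.embedOp (labEmb (n := n) E)).1.exists_work
  obtain ⟨CX, hCX, hCXl⟩ := (hasCircuit_addLabel (n := n) E).exists_work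
  obtain ⟨CA, hCA, hCAl⟩ := (hasCircuit_ampRot (n := n) E aζ aγ aD).exists_work
  have hR : ∀ i : Branch d, HasCircuit (condRot (onLabels (n := n) E i.cond))
    (3 * 2 ^ (2 * Nat.clog 2 (d + 2))) := fun i => exists_cond_circuit E _
  have hR' := fun i : Branch d => (hR i).conjTranspose
  choose R hRo hRl using hR
  choose R' hRo' hRl' using hR'
  have : Nontrivial (Body d n K) := ⟨Sum.inr (diffAnc d K 0), Sum.inr (diffAnc d K 1), by simp⟩
  obtain ⟨NZ, hNZ, hNZl⟩ : HasCircuit (ctrlBody (n := n) E (flagNonzero (firstAnc d K)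
      (diffAnc d K 0))) (6 * 2 ^ (d * Nat.clog 2 (2 * K + 1))) := by
    have h := hasCtrlCircuit_flagNonzero (σ := Sys d n) (firstAnc d K) (t := diffAnc d K 0)
      (by simp)
    have h2 := (h.embedOp (bodyEmb (a := a) E)).2.embedOp (workCtrl _)
    rwa [Fintype.card_prod, Fintype.card_fin, Fintype.card_fin] at h2
  let br : Branch d → QueryCircuit d (Sys d n ⊕ FourierAnc d K) (Sys d n ⊕ Fin 3)
    (Reg d n a ⊕ Fin 1) := fun i =>
      (R i).map Instr.gate ++ (Branch.calls E NZ i ++ (R' i).map Instr.gate)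
  have hbr : ∀ i, Implements ((br i).op U V)
      (condOp (onLabels E i.cond) (embedOp (bodyEmb E) (i.bodyOp U V))) := fun i => by
    simp only [br, QueryCircuit.op_append, QueryCircuit.op_gates, Branch.op_calls E U V hNZ i,
      hRo, hRo', mul_assoc]
    exact implements_condOp fun x y h => onLabels_eq_of_ne_zero E _ h
  -- In the order of application: label preparation, amplitude rotation, branches, addition of the
  -- label to the selector, inverse preparation.
  let Q : QueryCircuit d (Sys d n ⊕ FourierAnc d K) (Sys d n ⊕ Fin 3) (Reg d n a ⊕ Fin 1) :=
    CP.map Instr.gate ++ (CA.map Instr.gate ++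
      ((Finset.univ : Finset (Branch d)).toList.flatMap br ++
        (CX.map Instr.gate ++ CP'.map Instr.gate)))
  have hc : ∀ q, Q.coeffUses q = ∑ i : Branch d, (Branch.calls (n := n) E NZ i).coeffUses q := by
    intro q
    simp only [Q, br, QueryCircuit.coeffUses_append, QueryCircuit.coeffUses_gates,
      QueryCircuit.coeffUses_flatMap, zero_add, add_zero]
  have hd' : ∀ fwd μ, Q.diffUses fwd μ =
      ∑ i : Branch d, (Branch.calls (n := n) E NZ i).diffUses fwd μ := by
    intro fwd μ
    simp only [Q, br, QueryCircuit.diffUses_append, QueryCircuit.diffUses_gates,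
      QueryCircuit.diffUses_flatMap, zero_add, add_zero]
  have hQ : Implements (Q.op U V) (lcuOp E U V aζ aγ aD P) := by
    simp only [Q, QueryCircuit.op_append, QueryCircuit.op_gates]
    have h := ((hCP'.mul hCX).mul (QueryCircuit.op_flatMap_implements br hbr
      (Finset.univ : Finset (Branch d)).toList)).mul (hCA.mul hCP)
    have e : lcuOp E U V aζ aγ aD P = embedOp (labEmb (n := n) E) P.conjTranspose *
        permOp (addBits (addLabel E)) * selectBranch E U V *
          (ampRot E aζ aγ aD * embedOp (labEmb E) P) := by
      simp only [lcuOp, mul_assoc]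
    rw [e]
    simpa only [selectBranch, mul_assoc] using h
  refine ⟨Q, lcuOp E U V aζ aγ aD P, by rw [hc, Branch.coeffUses_calls],
    by rw [hc, Branch.coeffUses_calls], by rw [hc, Branch.coeffUses_calls],
    by rw [hc, Branch.coeffUses_calls], by rw [hc, Branch.coeffUses_calls],
    fun fwd μ => by rw [hd', Branch.diffUses_calls], hQ,
    hQ.mem_unitary (QueryCircuit.op_mem_unitary hU hV Q), zeroBlock_lcuOp E U V aζ aγ aD hζ hγ hD hP0,
    ?_⟩
  intro w' FU FV kU kV hkU hkV
  have hbl : ∀ i, ((br i).expand FU FV).length ≤ 6 * 2 ^ (2 * Nat.clog 2 (d + 2)) + 3 * kU + kV +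
      6 * 2 ^ (d * Nat.clog 2 (2 * K + 1)) := fun i => by
    simp only [br, QueryCircuit.expand_append, List.length_append,
      QueryCircuit.length_expand_gates]
    have h1 := hRl i
    have h2 := hRl' i
    have h3 := Branch.length_expand_calls E NZ FU FV hkU hkV i
    omega
  have hb := QueryCircuit.length_expand_flatMap_le FU FV br hbl
  have hcard : Fintype.card (Branch d) = 2 * d + 2 := by
    simp [add_comm]
  rw [hcard] at hb
  simp only [Q, QueryCircuit.expand_append, List.length_append, QueryCircuit.length_expand_gates]
  omega

end Circuit

/-! ### Spectral norms of block matrices. -/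

section BlockNorm
variable {d n : ℕ}

theorem specNorm_sub_le {m : Type} [Fintype m] [DecidableEq m] (M N : Matrix m m ℂ) :
    specNorm (M - N) ≤ specNorm M + specNorm N := by
  rw [sub_eq_add_neg, ← specNorm_neg N]
  exact specNorm_add_le _ _

/-- With one block per block row and block column, the blocks map mutually orthogonal subspaces to
mutually orthogonal subspaces, so the norm is bounded by the largest block norm. -/
theorem specNorm_blockPerm_le (π : Equiv.Perm (Bits (Sel d))) (X : Bits (Sel d) → Op (Sys d n))
    {e : ℝ} (he : 0 ≤ e) (hX : ∀ r, specNorm (X r) ≤ e) :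
    specNorm (fun x y => if π (x ∘ Sum.inl) = y ∘ Sum.inl then
      X (x ∘ Sum.inl) (x ∘ Sum.inr) (y ∘ Sum.inr) else 0 :
        Matrix (Bits (Sel d ⊕ Sys d n)) (Bits (Sel d ⊕ Sys d n)) ℂ) ≤ e := by
  refine specNorm_le_of_sq he fun v => ?_
  let q := (Equiv.sumArrowEquivProdArrow (Sel d) (Sys d n) Bool).symm
  rw [← q.sum_comp, ← q.sum_comp, Fintype.sum_prod_type, Fintype.sum_prod_type]
  have hl : ∀ r s, (q (r, s)) ∘ Sum.inl = r := fun _ _ => rfl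
  have hr : ∀ r s, (q (r, s)) ∘ Sum.inr = s := fun _ _ => rfl
  have key : ∀ r s, Matrix.mulVec (fun x y => if π (x ∘ Sum.inl) = y ∘ Sum.inl then
      X (x ∘ Sum.inl) (x ∘ Sum.inr) (y ∘ Sum.inr) else 0 :
        Matrix (Bits (Sel d ⊕ Sys d n)) (Bits (Sel d ⊕ Sys d n)) ℂ) v (q (r, s)) =
      ((X r).mulVec fun t => v (q (π r, t))) s := by
    intro r s
    simp only [Matrix.mulVec, dotProduct]
    rw [← q.sum_comp, Fintype.sum_prod_type, Finset.sum_eq_single (π r)]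
    · simp only [hl, hr, if_pos]
    · intro r' _ hr'
      simp only [hl, if_neg (Ne.symm hr'), zero_mul, Finset.sum_const_zero]
    · simp
  simp only [key]
  calc ∑ r, ∑ s, ‖((X r).mulVec fun t => v (q (π r, t))) s‖ ^ 2
      ≤ ∑ r, e ^ 2 * ∑ t, ‖v (q (π r, t))‖ ^ 2 := by
        refine Finset.sum_le_sum fun r _ => (sum_sq_mulVec_le _ _).trans ?_
        have := hX r
        have := specNorm_nonneg (X r)
        gcongr
    _ = e ^ 2 * ∑ r, ∑ t, ‖v (q (r, t))‖ ^ 2 := by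
        rw [← Finset.mul_sum, Equiv.sum_comp π fun r => ∑ t, ‖v (q (r, t))‖ ^ 2]

theorem specNorm_selBlock_zero_le {X : Op (Sys d n)} {e : ℝ} (hX : specNorm X ≤ e) :
    specNorm (selBlock 0 0 X) ≤ e := by
  have he : 0 ≤ e := (specNorm_nonneg X).trans hX
  have h := specNorm_blockPerm_le 1 (fun r => if bitsVal r = 0 then X else 0) he fun r => by
    split_ifs
    · exact hX
    · rwa [specNorm_zero]
  refine le_of_eq_of_le (congrArg specNorm ?_) h
  ext x y
  simp only [selBlock, Equiv.Perm.one_apply]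
  generalize x ∘ Sum.inl = u
  generalize y ∘ Sum.inl = v
  by_cases hu : bitsVal u = 0
  · by_cases huv : u = v
    · simp [hu, ← huv]
    · have hv : bitsVal v ≠ 0 := fun hv => huv (bitsVal_injective (hu.trans hv.symm))
      simp [huv, hv]
  · simp [hu]

/-- Blocks at (0, l) and (l, 0) follow the transposition of 0 and l, so together they cost one error
term instead of two. -/
theorem specNorm_selBlock_pair_le {l : ℕ} (hl : l ≠ 0) (hlt : l < 2 ^ Nat.clog 2 (d + 2))
    {X Y : Op (Sys d n)} {e : ℝ} (hX : specNorm X ≤ e) (hY : specNorm Y ≤ e) :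
    specNorm (selBlock 0 l X + selBlock l 0 Y) ≤ e := by
  have he : 0 ≤ e := (specNorm_nonneg X).trans hX
  obtain ⟨r, hr⟩ := exists_bitsVal hlt
  have h0 : bitsVal (fun _ : Sel d => false) = 0 := bitsVal_zero
  have hr0 : r ≠ fun _ => false := fun h => hl (by rw [← hr, h, h0])
  have h := specNorm_blockPerm_le (Equiv.swap (fun _ => false) r)
    (fun s => if s = fun _ => false then X else if s = r then Y else 0) he fun s => by
      split_ifs
      · exact hX
      · exact hY
      · rwa [specNorm_zero]
  refine le_of_eq_of_le (congrArg specNorm ?_) h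
  ext x y
  have e0 : ∀ u : Bits (Sel d), bitsVal u = 0 ↔ u = fun _ => false := fun u =>
    ⟨fun h => bitsVal_injective (h.trans h0.symm), fun h => by rw [h, h0]⟩
  have el : ∀ u : Bits (Sel d), bitsVal u = l ↔ u = r := fun u =>
    ⟨fun h => bitsVal_injective (h.trans hr.symm), fun h => by rw [h, hr]⟩
  simp only [Matrix.add_apply, selBlock, e0, el]
  generalize x ∘ Sum.inl = u
  generalize y ∘ Sum.inl = v
  by_cases h1 : u = fun _ => false
  · rw [h1, Equiv.swap_apply_left]
    by_cases h2 : v = r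
    · simp [h2, hr0.symm]
    · simp [h2, hr0.symm, Ne.symm h2]
  · by_cases h3 : u = r
    · rw [h3, Equiv.swap_apply_right]
      by_cases h2 : v = fun _ => false
      · simp [h2, hr0]
      · simp [h2, hr0, Ne.symm h2]
    · simp [h1, h3]

theorem selBlock_sub (i j : ℕ) (X Y : Op (Sys d n)) :
    selBlock i j X - selBlock i j Y = selBlock i j (X - Y) := by
  ext x y
  simp only [Matrix.sub_apply, selBlock]
  split_ifs <;> simp

theorem smul_selBlock (c : ℂ) (i j : ℕ) (X : Op (Sys d n)) :
    c • selBlock i j X = selBlock i j (c • X) := by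
  ext x y
  simp only [Matrix.smul_apply, selBlock]
  split_ifs <;> simp

/-- Spectral norm of an operator with blocks in the first row and the first column. -/
theorem specNorm_arrow_le {X₀ Xγ Yγ : Op (Sys d n)} {X Y : Fin d → Op (Sys d n)} {e₀ e eγ : ℝ}
    (h₀ : specNorm X₀ ≤ e₀) (hX : ∀ μ, specNorm (X μ) ≤ e) (hY : ∀ μ, specNorm (Y μ) ≤ e)
    (hXγ : specNorm Xγ ≤ eγ) (hYγ : specNorm Yγ ≤ eγ) :
    specNorm (selBlock 0 0 X₀ - ∑ μ : Fin d, selBlock 0 (μ + 1) (X μ) + selBlock 0 (d + 1) Xγ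
      - ∑ μ : Fin d, selBlock (μ + 1) 0 (Y μ) - selBlock (d + 1) 0 Yγ) ≤ e₀ + d * e + eγ := by
  have hpow : d + 2 ≤ 2 ^ Nat.clog 2 (d + 2) := Nat.le_pow_clog (by norm_num) _
  have hn : -selBlock (d := d) (d + 1) 0 Yγ = selBlock (d + 1) 0 (-Yγ) := by
    rw [← neg_one_smul ℂ, smul_selBlock, neg_one_smul]
  have e1 : selBlock 0 0 X₀ - ∑ μ : Fin d, selBlock 0 (μ + 1) (X μ) + selBlock 0 (d + 1) Xγ
      - ∑ μ : Fin d, selBlock (μ + 1) 0 (Y μ) - selBlock (d + 1) 0 Yγ =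
      -- Transposed blocks are paired, which leaves d+2 summands.
      selBlock 0 0 X₀ - ∑ μ : Fin d, (selBlock 0 (μ + 1) (X μ) + selBlock (μ + 1) 0 (Y μ)) +
        (selBlock 0 (d + 1) Xγ + selBlock (d + 1) 0 (-Yγ)) := by
    rw [← hn, Finset.sum_add_distrib]
    abel
  rw [e1]
  refine (specNorm_add_le _ _).trans (add_le_add ((specNorm_sub_le _ _).trans (add_le_add ?_ ?_)) ?_)
  · exact specNorm_selBlock_zero_le h₀
  · refine (specNorm_sum_le _ _).trans ?_
    calc ∑ μ : Fin d, specNorm (selBlock 0 (μ + 1) (X μ) + selBlock (μ + 1) 0 (Y μ))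
        ≤ ∑ _μ : Fin d, e := Finset.sum_le_sum fun μ _ =>
          specNorm_selBlock_pair_le (by omega) (by omega) (hX μ) (hY μ)
      _ = d * e := by simp
  · exact specNorm_selBlock_pair_le (by omega) (by omega) hXγ (by rwa [specNorm_neg])

end BlockNorm

/-! ### Perturbation of products. -/

section Perturbation
variable {m : Type} [Fintype m] [DecidableEq m]

theorem specNorm_mul_le_of_le {M N : Matrix m m ℂ} {a b : ℝ} (hM : specNorm M ≤ a)
    (hN : specNorm N ≤ b) : specNorm (M * N) ≤ a * b :=
  (specNorm_mul_le M N).trans (mul_le_mul hM hN (specNorm_nonneg N) ((specNorm_nonneg M).trans hM))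

theorem specNorm_mul_sub_mul_le {A A' B B' : Matrix m m ℂ} {a b εa εb : ℝ} (hA : specNorm A ≤ a)
    (hB' : specNorm B' ≤ b) (hAA' : specNorm (A - A') ≤ εa) (hBB' : specNorm (B - B') ≤ εb) :
    specNorm (A * B - A' * B') ≤ a * εb + b * εa := by
  have e : A * B - A' * B' = A * (B - B') + (A - A') * B' := by
    rw [Matrix.mul_sub, Matrix.sub_mul]
    abel
  rw [e, mul_comm b]
  exact (specNorm_add_le _ _).trans (add_le_add (specNorm_mul_le_of_le hA hBB')
    (specNorm_mul_le_of_le hAA' hB'))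

/-- The circuit encodes z'|r'|², because one of the two factors is an adjoint. |r² - |r'|²| is at
most (|r| + |r'|)·||r| - |r'|| ≤ 2αε, and also at most α² because both squares lie in [0, α²]. -/
theorem norm_sq_mul_sub_le {r z αr αz εr εz : ℝ} {r' z' : ℂ} (hr : |r| ≤ αr) (hr' : ‖r'‖ ≤ αr)
    (hz' : ‖z'‖ ≤ αz) (hεr : ‖(r : ℂ) - r'‖ ≤ εr) (hεz : ‖(z : ℂ) - z'‖ ≤ εz) :
    ‖((r ^ 2 * z : ℝ) : ℂ) - z' * (star r' * r')‖ ≤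
      αr ^ 2 * εz + αz * min (2 * αr * εr) (αr ^ 2) := by
  have h0 : (star r' * r' : ℂ) = ((‖r'‖ ^ 2 : ℝ) : ℂ) := by
    rw [RCLike.star_def, mul_comm, Complex.mul_conj, Complex.normSq_eq_norm_sq]
  have e : ((r ^ 2 * z : ℝ) : ℂ) - z' * (star r' * r') =
      ((r ^ 2 : ℝ) : ℂ) * ((z : ℂ) - z') + z' * ((r ^ 2 - ‖r'‖ ^ 2 : ℝ) : ℂ) := by
    rw [h0]
    push_cast
    ring
  have hα : 0 ≤ αr := (abs_nonneg r).trans hr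
  have hr2 : r ^ 2 ≤ αr ^ 2 := by
    rw [← sq_abs]
    gcongr
  have hr2' : ‖r'‖ ^ 2 ≤ αr ^ 2 := by gcongr
  rw [e]
  refine (norm_add_le _ _).trans (add_le_add ?_ ?_)
  · rw [norm_mul, Complex.norm_real, Real.norm_eq_abs, abs_of_nonneg (sq_nonneg r)]
    gcongr
  · rw [norm_mul, Complex.norm_real, Real.norm_eq_abs]
    refine mul_le_mul hz' (le_min ?_ ?_) (abs_nonneg _) ((norm_nonneg z').trans hz')
    · have h1 : |(|r| - ‖r'‖)| ≤ εr := by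
        have := abs_norm_sub_norm_le (r : ℂ) r'
        rw [Complex.norm_real, Real.norm_eq_abs] at this
        exact this.trans hεr
      have h2 : r ^ 2 - ‖r'‖ ^ 2 = (|r| + ‖r'‖) * (|r| - ‖r'‖) := by
        rw [← sq_abs r]
        ring
      rw [h2, abs_mul, abs_of_nonneg (by positivity)]
      refine mul_le_mul (by linarith) h1 (abs_nonneg _) (by linarith)
    · rw [abs_le]
      constructor <;> nlinarith [sq_nonneg r, sq_nonneg ‖r'‖]

end Perturbation

theorem norm_fourierSeries_le {d : ℕ} (G : Grid d) (K : ℕ) (c : (Fin d → ℤ) → ℂ) (x : Fin d → ℝ) :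
    ‖fourierSeries G K c x‖ ≤ ∑ k ∈ degreeBox d K, ‖c k‖ := by
  refine (norm_sum_le _ _).trans (Finset.sum_le_sum fun k _ => ?_)
  have h : ‖fourierMode G k x‖ = 1 := by
    have e : 2 * Real.pi * Complex.I * ((∑ μ, (k μ : ℝ) * x μ / G.period μ : ℝ) : ℂ) =
        ((2 * Real.pi * ∑ μ, (k μ : ℝ) * x μ / G.period μ : ℝ) : ℂ) * Complex.I := by
      push_cast
      ring
    rw [fourierMode, e, Complex.norm_exp_ofReal_mul_I]
  rw [norm_mul, h, mul_one]

/-! ### The error of the block-encoding. -/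

section Error
variable {d n K : ℕ} (G : Grid d) (p : PDECoefficients d) (c : Coeff → (Fin d → ℤ) → ℂ)
  (α ε : Coeff → ℝ) (B : Bool → Fin d → Matrix Bool Bool ℂ) (αD : ℝ)

/-- Rescaled by their normalizations, the coefficient blocks are multiplications by the Fourier
series and the difference blocks are exact. So the difference is again an arrow matrix, and its
blocks are differences of products. -/
theorem specNorm_secondOrderOp_sub_le (hα : ∀ g, 0 < α g)
    (hc : ∀ g, ∑ k ∈ degreeBox d K, ‖c g k‖ ≤ α g)
    (hf : ∀ g, ∀ s : Bits (Sys d n), |p.field g (G.point s)| ≤ α g)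
    (hε : ∀ g, ∀ s : Bits (Sys d n),
      ‖(p.field g (G.point s) : ℂ) - fourierSeries G K (c g) (G.point s)‖ ≤ ε g)
    (hρ : ∀ s : Bits (Sys d n), 0 < p.rho (G.point s)) (hαD : 0 < αD)
    {U : Coeff → Op (Sys d n ⊕ FourierAnc d K)} {V : Bool → Fin d → Op (Sys d n ⊕ Fin 3)}
    (hU : ∀ g, zeroBlock (U g) =
      Matrix.diagonal fun s => fourierSeries G K (c g) (G.point s) / (α g : ℂ))
    (hV : ∀ fwd μ, V fwd μ ∈ Matrix.unitaryGroup _ ℂ)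
    (hVD : ∀ fwd μ, diffOp G B fwd μ = (αD : ℂ) • zeroBlock (V fwd μ)) :
    specNorm (secondOrderOp G p B -
      (selBlock 0 0 (((α .invSqrtRho ^ 2 * α .zeta : ℝ) : ℂ) • Branch.block U V (.inl false))
        - ∑ μ : Fin d, selBlock 0 (μ + 1) (((α .sqrtKappa * αD * α .invSqrtRho : ℝ) : ℂ) •
            Branch.block U V (.inr (true, μ)))
        + selBlock 0 (d + 1) (((α .invSqrtRho * α .sqrtGamma : ℝ) : ℂ) •
            Branch.block U V (.inl true))
        - ∑ μ : Fin d, selBlock (μ + 1) 0 (((α .sqrtKappa * αD * α .invSqrtRho : ℝ) : ℂ) •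
            Branch.block U V (.inr (false, μ)))
        - selBlock (d + 1) 0 (((α .invSqrtRho * α .sqrtGamma : ℝ) : ℂ) •
            Branch.block U V (.inl true)))) ≤ totalEps d α ε αD := by
  let T : Coeff → Op (Sys d n) := fun g =>
    Matrix.diagonal fun s => fourierSeries G K (c g) (G.point s)
  have hT : ∀ g, (α g : ℂ) • zeroBlock (U g) = T g := by
    intro g
    have h0 : (α g : ℂ) ≠ 0 := by exact_mod_cast (hα g).ne'
    ext s t
    simp only [T, hU, Matrix.smul_apply, Matrix.diagonal_apply]
    split_ifs
    · rw [smul_eq_mul, mul_div_cancel₀ _ h0]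
    · simp
  have hF : ∀ g, specNorm (diagOp (n := n) G (p.field g)) ≤ α g := fun g =>
    specNorm_diagonal_le (hα g).le fun s => by
      rw [Complex.norm_real]
      exact hf g s
  have hTn : ∀ g, specNorm (T g) ≤ α g := fun g =>
    specNorm_diagonal_le (hα g).le fun s => (norm_fourierSeries_le G K _ _).trans (hc g)
  have hε0 : ∀ g, 0 ≤ ε g := fun g => (norm_nonneg _).trans (hε g fun _ => false)
  have hFT : ∀ g, specNorm (diagOp (n := n) G (p.field g) - T g) ≤ ε g := fun g => by
    rw [diagOp, Matrix.diagonal_sub]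
    exact specNorm_diagonal_le (hε0 g) (hε g)
  -- Being α_D times a compression of a unitary already bounds the norm; no computation with the
  -- stencil is needed.
  have hDn : ∀ fwd μ, specNorm (diffOp (n := n) G B fwd μ) ≤ αD := fun fwd μ => by
    rw [hVD, specNorm_smul, Complex.norm_real, Real.norm_eq_abs, abs_of_pos hαD]
    exact mul_le_of_le_one_right hαD.le ((specNorm_zeroBlock_le _).trans
      (specNorm_le_one_of_mem_unitary (hV fwd μ)))
  have bD : ∀ f g fwd μ, ((α f * αD * α g : ℝ) : ℂ) •
      (zeroBlock (U f) * (zeroBlock (V fwd μ) * zeroBlock (U g))) =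
        T f * (diffOp G B fwd μ * T g) := by
    intro f g fwd μ
    rw [← hT, ← hT, hVD]
    simp only [Matrix.smul_mul, Matrix.mul_smul, smul_smul]
    congr 1
    push_cast
    ring
  have bγ : ((α .invSqrtRho * α .sqrtGamma : ℝ) : ℂ) • Branch.block U V (.inl true) =
      T .invSqrtRho * T .sqrtGamma := by
    rw [← hT, ← hT, Branch.block]
    simp only [Matrix.smul_mul, Matrix.mul_smul, smul_smul]
    congr 1
    push_cast
    ring
  have bζ : ((α .invSqrtRho ^ 2 * α .zeta : ℝ) : ℂ) • Branch.block U V (.inl false) =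
      T .zeta * ((T .invSqrtRho).conjTranspose * T .invSqrtRho) := by
    rw [← hT, ← hT, Branch.block]
    simp only [Matrix.smul_mul, Matrix.mul_smul, smul_smul, Matrix.conjTranspose_smul,
      RCLike.star_def, Complex.conj_ofReal]
    congr 1
    push_cast
    ring
  have bf : ∀ μ, ((α .sqrtKappa * αD * α .invSqrtRho : ℝ) : ℂ) •
      Branch.block U V (.inr (true, μ)) =
        T .invSqrtRho * (diffOp G B true μ * T .sqrtKappa) := fun μ => by
    rw [← bD, Branch.block]
    congr 2
    ring
  have bb : ∀ μ, ((α .sqrtKappa * αD * α .invSqrtRho : ℝ) : ℂ) •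
      Branch.block U V (.inr (false, μ)) =
        T .sqrtKappa * (diffOp G B false μ * T .invSqrtRho) := fun μ => bD _ _ _ _
  rw [bγ, bζ]
  simp only [bf, bb]
  set e1 := αD * α .sqrtKappa * ε .invSqrtRho + α .invSqrtRho * αD * ε .sqrtKappa with he1
  set e2 := α .invSqrtRho * ε .sqrtGamma + α .sqrtGamma * ε .invSqrtRho with he2
  set e3 := α .invSqrtRho ^ 2 * ε .zeta +
    α .zeta * min (2 * α .invSqrtRho * ε .invSqrtRho) (α .invSqrtRho ^ 2) with he3
  have hγ : specNorm (diagOp (n := n) G (p.field .invSqrtRho) * diagOp G (p.field .sqrtGamma) -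
      T .invSqrtRho * T .sqrtGamma) ≤ e2 :=
    specNorm_mul_sub_mul_le (hF _) (hTn _) (hFT _) (hFT _)
  have hD : ∀ f g fwd μ, specNorm (diagOp G (p.field f) * diffOp (n := n) G B fwd μ *
      diagOp G (p.field g) - T f * (diffOp G B fwd μ * T g)) ≤
        α f * (αD * ε g) + αD * α g * ε f := by
    intro f g fwd μ
    rw [Matrix.mul_assoc]
    refine specNorm_mul_sub_mul_le (hF _) (specNorm_mul_le_of_le (hDn _ _) (hTn _)) (hFT _) ?_
    rw [← Matrix.mul_sub]
    exact specNorm_mul_le_of_le (hDn _ _) (hFT _)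
  have hζ : specNorm (diagOp (n := n) G (fun x => (p.rho x)⁻¹) * diagOp G p.zeta -
      T .zeta * ((T .invSqrtRho).conjTranspose * T .invSqrtRho)) ≤ e3 := by
    have h3 : 0 ≤ e3 := by
      have h1 := hα .zeta
      have h2 := hε0 .zeta
      have h4 : 0 ≤ min (2 * α .invSqrtRho * ε .invSqrtRho) (α .invSqrtRho ^ 2) :=
        le_min (mul_nonneg (by linarith [hα .invSqrtRho]) (hε0 _)) (sq_nonneg _)
      positivity
    have e : diagOp (n := n) G (fun x => (p.rho x)⁻¹) * diagOp G p.zeta -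
      T .zeta * ((T .invSqrtRho).conjTranspose * T .invSqrtRho) =
        Matrix.diagonal fun s => (((p.field .invSqrtRho (G.point s)) ^ 2 *
          p.field .zeta (G.point s) : ℝ) : ℂ) - fourierSeries G K (c .zeta) (G.point s) *
            (star (fourierSeries G K (c .invSqrtRho) (G.point s)) *
              fourierSeries G K (c .invSqrtRho) (G.point s)) := by
      simp only [diagOp, T, Matrix.diagonal_conjTranspose, Matrix.diagonal_mul_diagonal,
        Matrix.diagonal_sub]
      congr 1
      funext s
      simp only [PDECoefficients.field, inv_pow, Real.sq_sqrt (hρ s).le, Pi.star_apply]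
      push_cast
      rfl
    rw [e]
    exact specNorm_diagonal_le h3 fun s => norm_sq_mul_sub_le (hf _ s)
      ((norm_fourierSeries_le G K _ _).trans (hc _)) ((norm_fourierSeries_le G K _ _).trans (hc _))
      (hε _ s) (hε _ s)
  have hsum := specNorm_arrow_le hζ (fun μ => (hD .invSqrtRho .sqrtKappa true μ).trans_eq
    (show _ = e1 by rw [he1]; ring)) (fun μ => (hD .sqrtKappa .invSqrtRho false μ).trans_eq
    (show _ = e1 by rw [he1]; ring)) hγ hγ
  -- One damping block, d difference pairs and one mass pair, each at most the maximum.
  have hM : e3 + d * e1 + e2 ≤ totalEps d α ε αD := by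
    rw [totalEps, ← he1, ← he2, ← he3]
    have h1 := le_max_left e1 (max e2 e3)
    have h2 := (le_max_left e2 e3).trans (le_max_right e1 _)
    have h3 := (le_max_right e2 e3).trans (le_max_right e1 _)
    have h4 : (d : ℝ) * e1 ≤ d * max e1 (max e2 e3) := by gcongr
    linarith
  refine le_trans (le_of_eq ?_) (hsum.trans hM)
  congr 1
  simp only [← selBlock_sub, Finset.sum_sub_distrib, secondOrderOp]
  abel

end Error

/-! ### Gate counts. -/

section Counting

/-- By minimality the power one below `Nat.clog` is less than N. For N = 2K+1 this gives 4K, the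
source of the factor 4^d. -/
theorem two_pow_clog_le {N : ℕ} (hN : 2 ≤ N) : 2 ^ Nat.clog 2 N ≤ 2 * (N - 1) := by
  have h := Nat.pow_pred_clog_lt_self (b := 2) (by norm_num) (x := N) (by omega)
  have hpos : 0 < Nat.clog 2 N := Nat.clog_pos (by norm_num) hN
  obtain ⟨k, hk⟩ : ∃ k, Nat.clog 2 N = k + 1 := ⟨Nat.clog 2 N - 1, by omega⟩
  rw [hk] at h ⊢
  rw [Nat.pred_succ] at h
  rw [pow_succ]
  omega

/-- There are 2d+2 ≤ 4d branches. With m = n/d one has dm = n, so d·m² = nm ≤ n² for the differences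
and d·(d b m) = d b n for SELECT, where b is the number of ancilla qubits per coordinate. The
constant 1506 is 168 + 108 + 6 + 4(216 + 90). -/
theorem gate_count_le {d n K : ℕ} (hd : 0 < d) (hdn : d ∣ n) (hK : 1 ≤ K) :
    28 * 2 ^ Nat.clog 2 (d + 2) + 3 * 2 ^ (2 * Nat.clog 2 (d + 2)) + Nat.clog 2 (d + 2) +
      (2 * d + 2) * (6 * 2 ^ (2 * Nat.clog 2 (d + 2)) +
        3 * (28 * 2 ^ (d * Nat.clog 2 (2 * K + 1)) +
          32 * (d * Nat.clog 2 (2 * K + 1) * (n / d))) + 2000 * (n / d) ^ 2 +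
        6 * 2 ^ (d * Nat.clog 2 (2 * K + 1))) ≤
      1506 * (4 ^ d * (d * K ^ d)) + 384 * (d * Nat.clog 2 (2 * K + 1) * n) + 8000 * n ^ 2 := by
  have hp : 2 ^ Nat.clog 2 (d + 2) ≤ 6 * d := (two_pow_clog_le (by omega)).trans (by omega)
  have hb' : Nat.clog 2 (d + 2) ≤ 6 * d := Nat.lt_two_pow_self.le.trans hp
  have hq : 2 ^ (d * Nat.clog 2 (2 * K + 1)) ≤ 4 ^ d * K ^ d := by
    rw [mul_comm d, pow_mul, ← mul_pow]
    exact Nat.pow_le_pow_left ((two_pow_clog_le (by omega)).trans (by omega)) d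
  -- Label registers cost polynomially in d; d ≤ 2^d lets the first term absorb this.
  have hdq : d * d ≤ 4 ^ d * K ^ d := by
    have h1 : d ≤ 2 ^ d := Nat.lt_two_pow_self.le
    have h2 : 1 ≤ K ^ d := Nat.one_le_pow _ _ hK
    calc d * d ≤ 2 ^ d * 2 ^ d := Nat.mul_le_mul h1 h1
      _ = 4 ^ d := by rw [← mul_pow, show 2 * 2 = 4 by norm_num]
      _ ≤ 4 ^ d * K ^ d := Nat.le_mul_of_pos_right _ h2
  have hX : 4 ^ d * (d * K ^ d) = d * (4 ^ d * K ^ d) := by ring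
  have hn : d * (n / d) = n := Nat.mul_div_cancel' hdn
  have hmn : n / d ≤ n := Nat.div_le_self _ _
  rw [hX, mul_comm 2 (Nat.clog 2 (d + 2)), pow_mul]
  generalize 2 ^ Nat.clog 2 (d + 2) = p at *
  generalize Nat.clog 2 (d + 2) = b' at *
  generalize 2 ^ (d * Nat.clog 2 (2 * K + 1)) = t at *
  generalize 4 ^ d * K ^ d = q at *
  generalize Nat.clog 2 (2 * K + 1) = b at *
  generalize n / d = m at *
  have hd1 : d ≤ d * q := Nat.le_mul_of_pos_right _ (lt_of_lt_of_le (Nat.mul_pos hd hd) hdq)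
  have hp2 : p ^ 2 ≤ 36 * (d * d) := by nlinarith
  have hdq' : d * d ≤ d * q := Nat.mul_le_mul_left d ((Nat.le_mul_of_pos_left d hd).trans hdq)
  have h4 : 2 * d + 2 ≤ 4 * d := by omega
  have e1 : d * (6 * p ^ 2) ≤ 216 * (d * q) := by
    calc d * (6 * p ^ 2) ≤ d * (6 * (36 * q)) := by gcongr; exact hp2.trans (by gcongr)
      _ = 216 * (d * q) := by ring
  have e2 : d * (90 * t) ≤ 90 * (d * q) := by
    calc d * (90 * t) ≤ d * (90 * q) := by gcongr
      _ = 90 * (d * q) := by ring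
  have e3 : d * (96 * (d * b * m)) = 96 * (d * b * n) := by
    rw [← hn]
    ring
  have e4 : d * (2000 * m ^ 2) ≤ 2000 * n ^ 2 := by
    calc d * (2000 * m ^ 2) = 2000 * (d * m * m) := by ring
      _ ≤ 2000 * (n * n) := by rw [hn]; gcongr
      _ = 2000 * n ^ 2 := by ring
  calc _ ≤ 28 * p + 3 * p ^ 2 + b' + 4 * d * (6 * p ^ 2 + 3 * (28 * t + 32 * (d * b * m)) +
        2000 * m ^ 2 + 6 * t) := by gcongr
    _ = 28 * p + 3 * p ^ 2 + b' + 4 * (d * (6 * p ^ 2) + d * (90 * t) + d * (96 * (d * b * m)) +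
        d * (2000 * m ^ 2)) := by ring
    _ ≤ _ := by rw [e3]; omega

/-- From 2^b ≤ 4K follows (b - 2) log 2 ≤ log K, and log 2 ≥ 1/2. -/
theorem clog_le_log {K : ℕ} (hK : 1 ≤ K) :
    (Nat.clog 2 (2 * K + 1) : ℝ) ≤ 2 + 2 * Real.log K := by
  have hK' : (0 : ℝ) < K := by exact_mod_cast hK
  have h1 : (2 : ℝ) ^ Nat.clog 2 (2 * K + 1) ≤ 4 * K := by
    have : 2 ^ Nat.clog 2 (2 * K + 1) ≤ 4 * K := (two_pow_clog_le (by omega)).trans (by omega)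
    exact_mod_cast this
  have h2 := Real.log_le_log (by positivity) h1
  rw [Real.log_pow, Real.log_mul (by norm_num) hK'.ne', show (4 : ℝ) = 2 ^ 2 by norm_num,
    Real.log_pow] at h2
  have hl : (1 : ℝ) / 2 ≤ Real.log 2 := by linarith [Real.log_two_gt_d9]
  have hK0 : 0 ≤ Real.log K := Real.log_nonneg (by exact_mod_cast hK)
  by_contra hlt
  push Not at hlt
  have h3 : (Nat.clog 2 (2 * K + 1) - 2 : ℝ) * Real.log 2 ≤ Real.log K := by
    push_cast at h2
    linarith
  nlinarith

/-- b ≤ 2 + 2 log K leaves a term of order dn without a logarithm, which for K = 1 the term dn log K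
cannot absorb; d ≤ n moves it into n². -/
theorem gate_count_real_le {d n K : ℕ} (hd : 0 < d) (hn : 0 < n) (hdn : d ∣ n) (hK : 1 ≤ K)
    {k : ℕ} (hk : k ≤ 1506 * (4 ^ d * (d * K ^ d)) + 384 * (d * Nat.clog 2 (2 * K + 1) * n) +
      8000 * n ^ 2) :
    (k : ℝ) ≤ 10000 * (4 ^ d * (d * (K : ℝ) ^ d) + d * n * Real.log K + (n : ℝ) ^ 2) := by
  have hk' : (k : ℝ) ≤ 1506 * (4 ^ d * (d * (K : ℝ) ^ d)) +
      384 * (d * Nat.clog 2 (2 * K + 1) * n) + 8000 * (n : ℝ) ^ 2 := by exact_mod_cast hk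
  have hb := clog_le_log hK
  have hdn' : (d : ℝ) ≤ n := by exact_mod_cast Nat.le_of_dvd hn hdn
  have hK0 : 0 ≤ Real.log K := Real.log_nonneg (by exact_mod_cast hK)
  have h1 : (d : ℝ) * Nat.clog 2 (2 * K + 1) * n ≤ 2 * (n : ℝ) ^ 2 + 2 * (d * n * Real.log K) := by
    calc (d : ℝ) * Nat.clog 2 (2 * K + 1) * n ≤ d * (2 + 2 * Real.log K) * n := by gcongr
      _ = 2 * (d * n) + 2 * (d * n * Real.log K) := by ring
      _ ≤ 2 * (n * n) + 2 * (d * n * Real.log K) := by gcongr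
      _ = _ := by ring
  have h2 : (0 : ℝ) ≤ 4 ^ d * (d * (K : ℝ) ^ d) := by positivity
  have h3 : (0 : ℝ) ≤ d * n * Real.log K := by positivity
  have h4 : (0 : ℝ) ≤ (n : ℝ) ^ 2 := by positivity
  linarith

theorem card_ancillas (d K : ℕ) :
    Fintype.card ((Sel d ⊕ Fin 1) ⊕ BodyAnc d K) = totalAncillas d K 3 := by
  simp [totalAncillas]
  ring

end Counting

/-! ### The theorem. -/

theorem theorem2 :
    -- absolute constants
    ∃ (C : ℝ) (aD : ℕ),
    ∀ (d n K : ℕ), 0 < d → 0 < n → d ∣ n → 1 ≤ K →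
    ∀ (G : Grid d) (p : PDECoefficients d),
    (∀ s : Bits (Sys d n), 0 < p.rho (G.point s) ∧ 0 ≤ p.kappa (G.point s) ∧
      0 ≤ p.gamma (G.point s)) →
    -- degree-`K` Fourier approximations of the four coefficient functions
    ∀ (c : Coeff → (Fin d → ℤ) → ℂ) (α ε : Coeff → ℝ),
    (∀ g, 0 < α g) →
    (∀ g, ∑ k ∈ degreeBox d K, ‖c g k‖ ≤ α g) →
    (∀ g, ∀ s : Bits (Sys d n), |p.field g (G.point s)| ≤ α g) →
    (∀ g, ∀ s : Bits (Sys d n),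
      ‖(p.field g (G.point s) : ℂ) - fourierSeries G K (c g) (G.point s)‖ ≤ ε g) →
    -- boundary parts of the difference operators
    ∀ (B : Bool → Fin d → Matrix Bool Bool ℂ), (∀ fwd μ, specNorm (B fwd μ) ≤ 1) →
    ∀ (αD : ℝ), (∀ μ, 3 / G.spacing μ ≤ αD) →
    -- the block-encodings of coefficients (LCU Fourier) and of difference operators
    ∃ (U : Coeff → Matrix (Bits (Sys d n ⊕ FourierAnc d K)) (Bits (Sys d n ⊕ FourierAnc d K)) ℂ)
      (V : Bool → Fin d → Matrix (Bits (Sys d n ⊕ Fin aD)) (Bits (Sys d n ⊕ Fin aD)) ℂ),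
    (∀ g, IsLCUFourier G (α g) (c g) (U g) ∧
      IsBlockEncoding (α g) (ε g) (U g) (diagOp G (p.field g))) ∧
    (∀ fwd μ, IsBlockEncoding αD 0 (V fwd μ) (diffOp G B fwd μ)) ∧
    -- the block-encoding of the second-order operator built from them
    ∃ (w w' : ℕ)
      (Q : QueryCircuit d (Sys d n ⊕ FourierAnc d K) (Sys d n ⊕ Fin aD)
        (((Sel d ⊕ Sys d n) ⊕ Fin (totalAncillas d K aD)) ⊕ Fin w))
      (W : Matrix (Bits ((Sel d ⊕ Sys d n) ⊕ Fin (totalAncillas d K aD)))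
        (Bits ((Sel d ⊕ Sys d n) ⊕ Fin (totalAncillas d K aD))) ℂ)
      (FU : CoeffCall → Circuit (Option (Sys d n ⊕ FourierAnc d K) ⊕ Fin w'))
      (FV : Bool → Fin d → Circuit (Option (Sys d n ⊕ Fin aD) ⊕ Fin w')),
      -- numbers of controlled uses
      Q.coeffUses (.direct .invSqrtRho) = 2 * d + 2 ∧
      Q.coeffUses .adjInvSqrtRho = 1 ∧
      Q.coeffUses (.direct .sqrtKappa) = 2 * d ∧
      Q.coeffUses (.direct .zeta) = 1 ∧
      Q.coeffUses (.direct .sqrtGamma) = 1 ∧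
      (∀ fwd μ, Q.diffUses fwd μ = 1) ∧
      -- `Q` implements a block-encoding `W` of the second-order operator
      Implements (Q.op U V) W ∧
      IsBlockEncoding (totalAlpha d α αD) (totalEps d α ε αD) W (secondOrderOp G p B) ∧
      -- `FU` and `FV` implement the controlled oracles by two-qubit gates
      (∀ q, Implements (FU q).op (controlled (coeffCallOp U q))) ∧
      (∀ fwd μ, Implements (FV fwd μ).op (controlled (V fwd μ))) ∧
      Implements (Q.expand FU FV).op (Q.op U V) ∧
      -- number of two-qubit gates, and number of work qubits
      ((Q.expand FU FV).length : ℝ) ≤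
        C * (4 ^ d * (d * (K : ℝ) ^ d) + d * n * Real.log K + (n : ℝ) ^ 2) ∧
      ((w + w' : ℕ) : ℝ) ≤ C * (n + d * Real.log K) := by
  -- The three ancillas of the difference oracles: overflow or flag qubit, and two label qubits.
  refine ⟨10000, 3, ?_⟩
  intro d n K hd hn hdn hK G p hp c α ε hα hc hf hε B hB αD hαD
  have hm : 0 < n / d := Nat.div_pos (Nat.le_of_dvd hn hdn) hd
  have hαD0 : 0 < αD := (div_pos (by norm_num) (G.spacing_pos ⟨0, hd⟩)).trans_le (hαD ⟨0, hd⟩)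
  choose U hUF hUz hUc using fun g =>
    exists_coeff_oracle (n := n) hd hK hm G (hα g) (c g) (hc g)
  choose V hVu hVD hVc using fun fwd μ => exists_diff_oracle (n := n) hm G B hB hαD fwd μ
  have hUu : ∀ g, U g ∈ Matrix.unitaryGroup _ ℂ := fun g => (hUc g).1.mem_unitary
  have hε0 : ∀ g, 0 ≤ ε g := fun g => (norm_nonneg _).trans (hε g fun _ => false)
  -- The amplitude of a branch is its normalization over M, hence at most 1, and (d+2)M is the total
  -- normalization.
  set M := max (α .invSqrtRho ^ 2 * α .zeta) (max (α .sqrtKappa * αD * α .invSqrtRho)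
    (α .invSqrtRho * α .sqrtGamma)) with hM
  have hζ0 : 0 < α .invSqrtRho ^ 2 * α .zeta := mul_pos (pow_pos (hα _) 2) (hα _)
  have hκ0 : 0 < α .sqrtKappa * αD * α .invSqrtRho := mul_pos (mul_pos (hα _) hαD0) (hα _)
  have hγ0 : 0 < α .invSqrtRho * α .sqrtGamma := mul_pos (hα _) (hα _)
  have hM0 : 0 < M := hζ0.trans_le (le_max_left _ _)
  have hdiv : ∀ b, 0 < b → b ≤ M → |b / M| ≤ 1 := fun b h0 h1 => by
    rw [abs_of_pos (div_pos h0 hM0)]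
    exact (div_le_one hM0).mpr h1
  have hMb : ∀ (b : ℝ) (X : Op (Sys d n)), (M : ℂ) • ((b / M : ℝ) : ℂ) • X = (b : ℂ) • X :=
    fun b X => by
      rw [smul_smul, ← Complex.ofReal_mul, mul_div_cancel₀ _ hM0.ne']
  obtain ⟨Q, W, q1, q2, q3, q4, q5, q6, hQW, hW, hWz, hlen⟩ := exists_second_order_circuit
    hd (card_ancillas d K) hUu hVu (hdiv _ hζ0 (le_max_left _ _))
    (hdiv _ hγ0 ((le_max_right _ _).trans (le_max_right _ _)))
    (hdiv _ hκ0 ((le_max_left _ _).trans (le_max_right _ _)))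
  have hcall : ∀ q, ImplBy (n / d + 3) (controlled (coeffCallOp U q))
      (28 * 2 ^ (d * Nat.clog 2 (2 * K + 1)) +
        32 * (d * Nat.clog 2 (2 * K + 1) * (n / d))) := fun q => by
    cases q with
    | direct g => exact (hUc g).2.implBy
    | adjInvSqrtRho => exact (hUc .invSqrtRho).conjTranspose.2.implBy
  choose FU hFU hFUl using hcall
  choose FV hFV hFVl using hVc
  -- One work qubit holds the conditions of the branches in turn; n/d + 3 serve the ladders of the
  -- difference oracles.
  refine ⟨U, V, fun g => ⟨hUF g, hUu g, ?_⟩, fun fwd μ => ⟨hVu fwd μ, ?_⟩, 1, n / d + 3, Q, W,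
    FU, FV, q1, q2, q3, q4, q5, q6, hQW, ⟨hW, ?_⟩, hFU, hFV,
    QueryCircuit.op_expand U V FU FV hFU hFV Q, ?_, ?_⟩
  · have h : diagOp G (p.field g) - (α g : ℂ) • zeroBlock (U g) = Matrix.diagonal fun s =>
        (p.field g (G.point s) : ℂ) - fourierSeries G K (c g) (G.point s) := by
      have h0 : (α g : ℂ) ≠ 0 := by exact_mod_cast (hα g).ne'
      rw [hUz, diagOp, ← Matrix.diagonal_smul, Matrix.diagonal_sub]
      congr 1
      funext s
      rw [Pi.smul_apply, smul_eq_mul, mul_div_cancel₀ _ h0]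
    rw [h]
    exact specNorm_diagonal_le (hε0 g) (hε g)
  · rw [hVD, sub_self, specNorm_zero]
  · have hz : ((totalAlpha d α αD : ℝ) : ℂ) • zeroBlock W =
        (M : ℂ) • ((d + 2 : ℕ) : ℂ) • zeroBlock W := by
      rw [smul_smul, totalAlpha, ← hM]
      congr 1
      push_cast
      ring
    have h := specNorm_secondOrderOp_sub_le G p c α ε B αD hα hc hf hε (fun s => (hp s).1) hαD0
      hUz hVu hVD
    rw [hz, hWz]
    simpa only [smul_sub, smul_add, Finset.smul_sum, smul_selBlock, hMb] using h
  · exact gate_count_real_le hd hn hdn hK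
      ((hlen FU FV _ _ hFUl hFVl).trans (gate_count_le hd hdn hK))
  · have h1 : (1 + (n / d + 3) : ℕ) ≤ 5 * n := by
      have := Nat.div_le_self n d
      omega
    have h2 : ((1 + (n / d + 3) : ℕ) : ℝ) ≤ 5 * n := by exact_mod_cast h1
    have hK0 : 0 ≤ Real.log K := Real.log_nonneg (by exact_mod_cast hK)
    have h3 : (0 : ℝ) ≤ d * Real.log K := by positivity
    have h4 : (0 : ℝ) ≤ n := by positivity
    linarith
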